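/- **Setting.** Let $\Omega\subset\mathbb C$ be either a discrete set without accumulation points, or a finite union of pairwise disjoint oriented simple contours (piecewise $C^1$ and regular), each of which is closed or extends to infinity at both ends. Let $\mu$ be the counting measure in the first case and $\mathrm d\mu=\mathrm dz$ in the second, and let $\mathcal H=\ell^2(\Omega)$, respectively $\mathcal H=L^2(\Omega,|\mathrm dz|)$. Fix $m\ge 1$. For $(x,y,t)\in\mathbb R^m\times\mathbb R^m\times\mathbb R^m$ put $$\Delta(z)=\Delta(z\mid x,y,t)=\operatorname{diag}\bigl(e^{t_1z^3+y_1z^2+x_1z},\dots,e^{t_mz^3+y_mz^2+x_mz},1\bigr).$$ A bounded operator $\mathsf H$ on $\mathcal H$ is *cubic integrable* at $(x,y,t)$ if it is the integral operator (with respect to $\mu$, in the principal value sense where the integral does not converge absolutely) with kernel $$\mathsf H(u,v)=\frac{f(u)^Tg(v)}{u-v}\ (u\ne v),\qquad \mathsf H(u,u)=0,\qquad f(u)=c(u)\Delta(u)F(u),\quad g(u)=c(u)^{-1}\Delta(u)^{-1}G(u),$$ where $F,G:\Omega\to\mathbb C^{m+1}$ do not depend on $(x,y,t)$ and satisfy $F_i(u)G_i(u)=0$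 for all $u\in\Omega$ and $1\le i\le m+1$, where $c$ is a non-vanishing scalar function on $\Omega$, which may depend on $(x,y,t)$, and where $f,g\in L^2(\Omega,|\mu|)\cap L^\infty(\Omega,|\mu|)$. Let $U\subset\mathbb R^{3m}$ be open, let $F,G$ be fixed, and for each $p=(x,y,t)\in U$ let $\mathsf H=\mathsf H_p$ be cubic integrable at $p$ with data $F,G$ and scalar $c(\cdot\mid p)$, with $1-\mathsf H_p$ invertible. If $c$ depends on $p$, assume that it does so regularly, in the following sense: every $p_0\in U$ has a neighbourhood such that, for $p$ in it, $c(\cdot\mid p)/c(\cdot\mid p_0)$ and its inverse are bounded on bounded subsets of $\Omega$, and the components of $c(\cdot\mid p_0)\Delta(\cdot\mid p)F$ and $c(\cdot\mid p_0)^{-1}\Delta(\cdot\mid p)^{-1}G$ are square integrable. (If $c$ does not depend on $p$, this holds automatically.) Define the $(m+1)\times(m+1)$ matrix $$\Phi_1(x,y,t)=\int_\Omega\bigl((1-\mathsf H)^{-1}f\bigr)(s)\,g(s)^T\,\mathrm d\mu(s).$$ Let $\emptyset\neq S\subset\{1,\dots,m\}$, let $\pi$ be the permutation of $\{1,\dots,m+1\}$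 that lists first the elements of $S$ in increasing order and then those of $\{1,\dots,m+1\}\setminus S$ in increasing order, let $P=(\delta_{\pi(i),j})$, and write $$P\,\Phi_1\,P^T=\begin{pmatrix} q&p\\ r&s\end{pmatrix}$$ with $q$ of size $|S|\times|S|$ and $s$ of size $(m+1-|S|)\times(m+1-|S|)$. Put $\partial_x=\sum_{k\in S}\partial_{x_k}$, $\partial_y=\sum_{k\in S}\partial_{y_k}$, $\partial_t=\sum_{k\in S}\partial_{t_k}$. **Theorem (Matrix KP).** The entries of $\Phi_1$ are three times continuously differentiable on $U$, and the following equations hold on $U$. (a) The $|S|\times|S|$ matrices $u=pr$ and $q$ satisfy the matrix KP-II equation $$-4\partial_tu+\partial_x^3u+6\partial_x(u^2)-3\partial_y^2q+6[u,\partial_yq]=0,\qquad \partial_xq=-u.$$ (b) The $(m+1-|S|)\times(m+1-|S|)$ matrices $v=rp$ and $s$ satisfy the matrix KP-II equation $$-4\partial_tv+\partial_x^3v+6\partial_x(v^2)+3\partial_y^2s+6[v,\partial_ys]=0,\qquad \partial_xs=v.$$ -/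

import Mathlib

open MeasureTheory Filter Topology

noncomputable section

namespace CubicKP

/-! ### The set `Ω`, the measure `μ` and the Hilbert space `L²(Ω, μ)` -/

/-- `γ` restricted to `I` is a regular `C¹` arc. -/
def IsRegularArc (γ : ℝ → ℂ) (I : Set ℝ) : Prop :=
  ContDiffOn ℝ 1 γ I ∧ ∀ s ∈ I, derivWithin γ I s ≠ 0

/-- An oriented simple contour in `ℂ`, given by a parametrization that is piecewise `C¹` and regular
(corners are allowed, and they are isolated).  It is either closed (one period of a periodic
parametrization), or it extends to infinity at both ends; in particular it has no finite end point. -/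
structure SimpleContour where
  /-- the parametrization -/
  γ : ℝ → ℂ
  /-- the parameter interval, which is run through once -/
  dom : Set ℝ
  regular : ∀ s : ℝ, ∃ ε > 0,
    IsRegularArc γ (Set.Icc s (s + ε)) ∧ IsRegularArc γ (Set.Icc (s - ε) s)
  closed_or_infinite :
    (∃ T > 0, dom = Set.Ico 0 T ∧ Function.Periodic γ T ∧ Set.InjOn γ (Set.Ico 0 T)) ∨
    (dom = Set.univ ∧ Function.Injective γ ∧ Tendsto γ (cocompact ℝ) (cocompact ℂ))

/-- The set of points of a contour. -/
def SimpleContour.trace (C : SimpleContour) : Set ℂ := C.γ '' C.dom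

/-- The arc length measure `|dz|` of a contour, as a measure on `ℂ`. -/
def SimpleContour.arcLength (C : SimpleContour) : Measure ℂ :=
  ((volume.restrict C.dom).withDensity fun s => ‖deriv C.γ s‖ₑ).map C.γ

/-- The sets `Ω` under consideration: a discrete subset of `ℂ` without accumulation points, or
a finite union of pairwise disjoint simple contours. -/
inductive Support : Type
  | discrete (A : Set ℂ) (noAcc : ∀ z : ℂ, ¬ AccPt z (𝓟 A)) : Support
  | contours (n : ℕ) (C : Fin n → SimpleContour)
      (disj : Pairwise fun i j => Disjoint (C i).trace (C j).trace) : Support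

/-- The underlying set of points. -/
def Support.carrier : Support → Set ℂ
  | .discrete A _ => A
  | .contours _ C _ => ⋃ i, (C i).trace

/-- The positive measure `|μ|`: counting measure on a discrete set, arc length `|dz|` on contours. -/
def Support.absMeasure : Support → Measure ℂ
  | .discrete A _ => Measure.count.restrict A
  | .contours _ C _ => Measure.sum fun i => (C i).arcLength

open Classical in
/-- The unimodular density `dμ / d|μ|`: it is `1` on a discrete set, and on contours it is the unit
tangent `dz / |dz|` (the parameter `q` is unique because the contours are simple and disjoint;
the value at the corners is irrelevant, since they form a null set). -/
def Support.direction : Support → ℂ → ℂ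
  | .discrete _ _ => fun _ => 1
  | .contours n C _ => fun w =>
      if h : ∃ q : Fin n × ℝ, q.2 ∈ (C q.1).dom ∧ (C q.1).γ q.2 = w then
        deriv (C h.choose.1).γ h.choose.2 / (‖deriv (C h.choose.1).γ h.choose.2‖ : ℂ)
      else 0

/-- The Hilbert space `L²(Ω, |μ|)`, i.e. `ℓ²(Ω)` or `L²(Ω, dz)`. -/
abbrev Support.L2 (Ω : Support) : Type := Lp ℂ 2 Ω.absMeasure

/-- `∫_A φ dμ`, with `dμ = dz` on contours and `μ` the counting measure on a discrete set. -/
def Support.integralOn (Ω : Support) (A : Set ℂ) (φ : ℂ → ℂ) : ℂ :=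
  ∫ v in A, φ v * Ω.direction v ∂Ω.absMeasure

/-- `∫_Ω φ dμ`. -/
def Support.integral (Ω : Support) (φ : ℂ → ℂ) : ℂ := Ω.integralOn Set.univ φ

open Classical in
/-- The class in `L²(Ω, |μ|)` of a square integrable function (and `0` for any other function). -/
def Support.toL2 (Ω : Support) (φ : ℂ → ℂ) : Ω.L2 :=
  if h : MemLp φ 2 Ω.absMeasure then h.toLp φ else 0

/-- The bounded operator `T` on `L²(Ω, |μ|)` is the integral operator with kernel `K`:
`(T h)(u) = ∫_Ω K(u, v) h(v) dμ(v)` for almost every `u`.  The integral is a principal value at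
`v = u`, which is the ordinary integral whenever that converges absolutely and `K(u, u) = 0`. -/
def IsIntegralOperator (Ω : Support) (T : Ω.L2 →L[ℂ] Ω.L2) (K : ℂ → ℂ → ℂ) : Prop :=
  ∀ h : Ω.L2, ∀ᵐ u ∂Ω.absMeasure,
    Tendsto (fun ε : ℝ => Ω.integralOn {v | ε ≤ dist u v} fun v => K u v * h v) (𝓝[>] 0)
      (𝓝 (T h u))

/-! ### Cubic integrable operators -/

/-- The parameters `(x, y, t)`, three vectors of `ℝᵐ`. -/
abbrev Params (m : ℕ) : Type := (Fin m → ℝ) × (Fin m → ℝ) × (Fin m → ℝ)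

/-- The diagonal entries `exp (t_j z³ + y_j z² + x_j z)`, `j = 1, …, m`, and `1` of `Δ(z | x, y, t)`. -/
def expDiag {m : ℕ} (p : Params m) (z : ℂ) : Fin (m + 1) → ℂ :=
  Fin.snoc (α := fun _ => ℂ)
    (fun j : Fin m => Complex.exp (p.2.2 j * z ^ 3 + p.2.1 j * z ^ 2 + p.1 j * z)) 1

/-- `f(u) = c(u) Δ(u | x, y, t) F(u)`. -/
def fVec {m : ℕ} (F : ℂ → Fin (m + 1) → ℂ) (c : ℂ → ℂ) (p : Params m) (u : ℂ) :
    Fin (m + 1) → ℂ :=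
  fun a => c u * expDiag p u a * F u a

/-- `g(u) = c(u)⁻¹ Δ(u | x, y, t)⁻¹ G(u)`. -/
def gVec {m : ℕ} (G : ℂ → Fin (m + 1) → ℂ) (c : ℂ → ℂ) (p : Params m) (u : ℂ) :
    Fin (m + 1) → ℂ :=
  fun a => (c u)⁻¹ * (expDiag p u a)⁻¹ * G u a

open Classical in
/-- The kernel `f(u)ᵀ g(v) / (u - v)` for `u ≠ v`, and `0` for `u = v`. -/
def iiksKernel {m : ℕ} (f g : ℂ → Fin (m + 1) → ℂ) (u v : ℂ) : ℂ :=
  if u = v then 0 else (∑ a, f u a * g v a) / (u - v)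

/-- `T` is the cubic integrable operator with data `F`, `G` and scalar `c` at the parameters `p`. -/
structure IsCubicIntegrable {m : ℕ} (Ω : Support) (F G : ℂ → Fin (m + 1) → ℂ) (c : ℂ → ℂ)
    (p : Params m) (T : Ω.L2 →L[ℂ] Ω.L2) : Prop where
  orthogonal : ∀ u ∈ Ω.carrier, ∀ i, F u i * G u i = 0
  scalar_ne_zero : ∀ u ∈ Ω.carrier, c u ≠ 0
  f_memL2 : ∀ a, MemLp (fun u => fVec F c p u a) 2 Ω.absMeasure
  f_memLinfty : ∀ a, MemLp (fun u => fVec F c p u a) ⊤ Ω.absMeasure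
  g_memL2 : ∀ a, MemLp (fun u => gVec G c p u a) 2 Ω.absMeasure
  g_memLinfty : ∀ a, MemLp (fun u => gVec G c p u a) ⊤ Ω.absMeasure
  kernel : IsIntegralOperator Ω T (iiksKernel (fVec F c p) (gVec G c p))

/-- Regularity of the scalar `c(u | p)` in the parameters `p ∈ U`; it says nothing if `c` does not
depend on `p`.  Near each `p₀ ∈ U`, the ratio `c(· | p) / c(· | p₀)` and its inverse are bounded
on bounded subsets of `Ω`, and the vectors `f`, `g` formed at `p` with the frozen scalar `c(· | p₀)`
are still square integrable. -/
def IsRegularScalar {m : ℕ} (Ω : Support) (F G : ℂ → Fin (m + 1) → ℂ)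
    (c : Params m → ℂ → ℂ) (U : Set (Params m)) : Prop :=
  ∀ p₀ ∈ U, ∀ᶠ p in 𝓝 p₀,
    (∀ R : ℝ, ∃ B : ℝ, ∀ u ∈ Ω.carrier, ‖u‖ ≤ R →
      ‖c p u‖ ≤ B * ‖c p₀ u‖ ∧ ‖c p₀ u‖ ≤ B * ‖c p u‖) ∧
    ∀ a, MemLp (fun u => fVec F (c p₀) p u a) 2 Ω.absMeasure ∧
      MemLp (fun u => gVec G (c p₀) p u a) 2 Ω.absMeasure

/-- The matrix `Φ₁ = ∫_Ω ((1 - T)⁻¹ f)(s) g(s)ᵀ dμ(s)`. -/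
def phiOne {m : ℕ} (Ω : Support) (F G : ℂ → Fin (m + 1) → ℂ) (c : ℂ → ℂ) (p : Params m)
    (T : Ω.L2 →L[ℂ] Ω.L2) : Matrix (Fin (m + 1)) (Fin (m + 1)) ℂ :=
  Matrix.of fun a b => Ω.integral fun s =>
    (Ring.inverse (1 - T) (Ω.toL2 fun u => fVec F c p u a) : Ω.L2) s * gVec G c p s b

/-! ### Blocks and differential operators attached to a subset `S ⊆ {1, …, m}` -/

/-- `S` as a subset of `{1, …, m + 1}`. -/
def liftSet {m : ℕ} (S : Finset (Fin m)) : Finset (Fin (m + 1)) := S.map Fin.castSuccEmb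

theorem card_liftSet {m : ℕ} (S : Finset (Fin m)) : (liftSet S).card = S.card := by
  simp [liftSet]

theorem card_compl_liftSet {m : ℕ} (S : Finset (Fin m)) :
    (liftSet S)ᶜ.card = m + 1 - S.card := by
  rw [Finset.card_compl, card_liftSet, Fintype.card_fin]

/-- The permutation `π` listing first the elements of `S` and then those of
`{1, …, m + 1} \ S` (the last of which is `m + 1`), both in increasing order. -/
def blockPerm {m : ℕ} (S : Finset (Fin m)) :
    Fin S.card ⊕ Fin (m + 1 - S.card) ≃ Fin (m + 1) :=
  finSumEquivOfFinset (card_liftSet S) (card_compl_liftSet S)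

/-- `P A Pᵀ` for the permutation matrix `P = (δ_{π(i), j})`; its `(i, j)` entry is `A (π i) (π j)`. -/
def permuted {m : ℕ} (S : Finset (Fin m)) (A : Matrix (Fin (m + 1)) (Fin (m + 1)) ℂ) :
    Matrix (Fin S.card ⊕ Fin (m + 1 - S.card)) (Fin S.card ⊕ Fin (m + 1 - S.card)) ℂ :=
  A.submatrix (blockPerm S) (blockPerm S)

/-- The upper left block. -/
def qBlock {m : ℕ} (S : Finset (Fin m)) (A : Matrix (Fin (m + 1)) (Fin (m + 1)) ℂ) :
    Matrix (Fin S.card) (Fin S.card) ℂ := (permuted S A).toBlocks₁₁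

/-- The upper right block. -/
def pBlock {m : ℕ} (S : Finset (Fin m)) (A : Matrix (Fin (m + 1)) (Fin (m + 1)) ℂ) :
    Matrix (Fin S.card) (Fin (m + 1 - S.card)) ℂ := (permuted S A).toBlocks₁₂

/-- The lower left block. -/
def rBlock {m : ℕ} (S : Finset (Fin m)) (A : Matrix (Fin (m + 1)) (Fin (m + 1)) ℂ) :
    Matrix (Fin (m + 1 - S.card)) (Fin S.card) ℂ := (permuted S A).toBlocks₂₁

/-- The lower right block. -/
def sBlock {m : ℕ} (S : Finset (Fin m)) (A : Matrix (Fin (m + 1)) (Fin (m + 1)) ℂ) :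
    Matrix (Fin (m + 1 - S.card)) (Fin (m + 1 - S.card)) ℂ := (permuted S A).toBlocks₂₂

/-- `∑_{k ∈ S} ∂_{e k}` applied entrywise to a matrix-valued function of the parameters. -/
def sumPartial {m : ℕ} {ι κ : Type} (e : Fin m → Params m) (S : Finset (Fin m))
    (A : Params m → Matrix ι κ ℂ) : Params m → Matrix ι κ ℂ :=
  fun p => Matrix.of fun i j => ∑ k ∈ S, lineDeriv ℝ (fun p' => A p' i j) p (e k)

/-- `∂_x = ∑_{k ∈ S} ∂_{x_k}`. -/
def dX {m : ℕ} {ι κ : Type} (S : Finset (Fin m)) (A : Params m → Matrix ι κ ℂ) :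
    Params m → Matrix ι κ ℂ :=
  sumPartial (fun k => (Pi.single k 1, 0, 0)) S A

/-- `∂_y = ∑_{k ∈ S} ∂_{y_k}`. -/
def dY {m : ℕ} {ι κ : Type} (S : Finset (Fin m)) (A : Params m → Matrix ι κ ℂ) :
    Params m → Matrix ι κ ℂ :=
  sumPartial (fun k => (0, Pi.single k 1, 0)) S A

/-- `∂_t = ∑_{k ∈ S} ∂_{t_k}`. -/
def dT {m : ℕ} {ι κ : Type} (S : Finset (Fin m)) (A : Params m → Matrix ι κ ℂ) :
    Params m → Matrix ι κ ℂ :=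
  sumPartial (fun k => (0, 0, Pi.single k 1)) S A

end CubicKP

end

/-! Write `R = (1 - T)⁻¹` for the operator `T` at the parameters `p`, and let `M_ij = ∫ (R zⁱf) zʲgᵀ
dμ`, so that `Φ₁ = M₀₀`. Along the three flows attached to `S`, the components `f_k`, `k ∈ S`, are
multiplied by `z`, `z²`, `z³`, the `g_k` by the negatives of these, and all other components are
constant. The kernel of `T` is differentiated into `∑_{k ∈ S} f_k(u) g_k(v) (uⁿ - vⁿ) / (u - v)`.
The denominator divides out, and the derivative of `T` has finite rank. With `∂R = R (∂T) R`, every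
derivative of an `M_ij` is a quadratic polynomial in such moments
(`FrozenData.exists_hasFDerivAt_momentMatrix`).

A second source of identities is the commutator `[z, T] = ∑ f_a ⊗ g_a`, the kernel of `T` times `u -
v`. It gives `[z, R] = ∑ R f_a ⊗ Rᵀ g_a`, hence `M_{i,j+1} = M_{i+1,j} + M_{i0} M_{0j}` on the
entries in `S` (`FrozenData.momentMatrix_comm`). Cut into blocks, both families form a
`MomentHierarchy`. Eliminating the higher moments leaves the matrix AKNS equations `p_y = p_xx +
2prp`, `r_y = -r_xx - 2rpr`, `p_t = p_xxx + 3(p_x r p + p r p_x)` and their analogue for `r_t`, with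
`q_x = -pr`, `q_y = p r_x - p_x r`, `s_x = rp`, `s_y = r p_x - r_x p`. The two KP equations then
hold as identities between noncommutative monomials in `p`, `r` and their derivatives.

The analysis has three parts. First, square integrability of `f`, `g` on a ball of parameters forces
exponential moments, because `p` may be shifted by either sign in each flow
(`HasExpMoments.of_ball`). These dominate the Taylor remainders of the vectors and of the difference
of two kernels, so vectors and operators are smooth in `p`. Second, multiplication by `z` is
unbounded and `R zⁱf` is not known to lie in its domain, so the commutator identity is proved for
Lipschitz truncations of `z` and then passed to the limit
(`IsIntegralOperator.pairing_inverse_mul_id`). Third, `c` may depend irregularly on `p`. Changing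
`c` conjugates `T` by a possibly unbounded function, and a cutoff of slope `1/(n+1)` shows that `Φ₁`
does not notice this (`pairing_inverse_gauge`). Near `p₀` one may therefore freeze the scalar at `c
p₀`. -/

noncomputable section

namespace CubicKP

/-! ### Entrywise directional derivatives of matrix valued functions -/

/-- The entries of `A` are differentiable at `z`, and their derivatives in the direction `d` are
the entries of `A'`. -/
def HasEntryDeriv {E : Type*} [NormedAddCommGroup E] [NormedSpace ℝ E] {ι κ : Type}
    (A : E → Matrix ι κ ℂ) (A' : Matrix ι κ ℂ) (z d : E) : Prop :=
  ∀ i j, DifferentiableAt ℝ (fun x => A x i j) z ∧ fderiv ℝ (fun x => A x i j) z d = A' i j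

namespace HasEntryDeriv

variable {E : Type*} [NormedAddCommGroup E] [NormedSpace ℝ E] {ι κ l : Type}
  {A B : E → Matrix ι κ ℂ} {A' B' : Matrix ι κ ℂ} {z d : E}

theorem add (hA : HasEntryDeriv A A' z d) (hB : HasEntryDeriv B B' z d) :
    HasEntryDeriv (fun x => A x + B x) (A' + B') z d := fun i j => by
  refine ⟨(hA i j).1.add (hB i j).1, ?_⟩
  have := fderiv_fun_add (hA i j).1 (hB i j).1
  simp only [Matrix.add_apply]
  rw [this, _root_.add_apply, (hA i j).2, (hB i j).2]

theorem neg (hA : HasEntryDeriv A A' z d) : HasEntryDeriv (fun x => -A x) (-A') z d :=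
  fun i j => by
  refine ⟨(hA i j).1.neg, ?_⟩
  simp only [Matrix.neg_apply]
  rw [fderiv_fun_neg, _root_.neg_apply, (hA i j).2]

theorem sub (hA : HasEntryDeriv A A' z d) (hB : HasEntryDeriv B B' z d) :
    HasEntryDeriv (fun x => A x - B x) (A' - B') z d := by
  simpa only [sub_eq_add_neg] using hA.add hB.neg

theorem mul [Fintype κ] {C : E → Matrix κ l ℂ} {C' : Matrix κ l ℂ}
    (hA : HasEntryDeriv A A' z d) (hC : HasEntryDeriv C C' z d) :
    HasEntryDeriv (fun x => A x * C x) (A' * C z + A z * C') z d := fun i j => by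
  have h : ∀ k ∈ (Finset.univ : Finset κ), HasFDerivAt (fun x => A x i k * C x k j)
      (A z i k • fderiv ℝ (fun x => C x k j) z + C z k j • fderiv ℝ (fun x => A x i k) z) z :=
    fun k _ => (hA i k).1.hasFDerivAt.mul (hC k j).1.hasFDerivAt
  have h2 := HasFDerivAt.fun_sum h
  simp only [Matrix.mul_apply]
  refine ⟨h2.differentiableAt, ?_⟩
  rw [h2.fderiv]
  simp only [_root_.sum_apply, _root_.add_apply,
    _root_.smul_apply, smul_eq_mul, (hA _ _).2, (hC _ _).2, Matrix.add_apply,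
    Matrix.mul_apply, Finset.sum_add_distrib]
  rw [add_comm]
  congr 1
  exact Finset.sum_congr rfl fun k _ => mul_comm _ _

theorem congr_of_eventuallyEq (hA : HasEntryDeriv A A' z d) (h : B =ᶠ[𝓝 z] A) :
    HasEntryDeriv B A' z d := fun i j => by
  have h' : (fun x => B x i j) =ᶠ[𝓝 z] fun x => A x i j := h.fun_comp fun M => M i j
  exact ⟨h'.differentiableAt_iff.2 (hA i j).1, by rw [h'.fderiv_eq, (hA i j).2]⟩

theorem congr_deriv (hA : HasEntryDeriv A A' z d) (h : A' = B') : HasEntryDeriv A B' z d := h ▸ hA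

end HasEntryDeriv

section sumPartial

variable {m : ℕ} {ι κ : Type} {e : Fin m → Params m} {S : Finset (Fin m)}
  {A : Params m → Matrix ι κ ℂ}

/-- Differentiability makes the line derivative linear in the direction, so the sum over `S` is one
derivative along the summed direction. -/
theorem HasEntryDeriv.sumPartial_eq {A' : Matrix ι κ ℂ} {z : Params m}
    (h : HasEntryDeriv A A' z (∑ k ∈ S, e k)) : sumPartial e S A z = A' := by
  ext i j
  simp only [sumPartial, Matrix.of_apply, ← (h i j).2, map_sum]
  exact Finset.sum_congr rfl fun k _ => (h i j).1.lineDeriv_eq_fderiv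

/-- This is the step that iterates derivatives. A second derivative needs the formula for the first
one on a whole neighbourhood, hence the open set `V`. -/
theorem HasEntryDeriv.sumPartial {V : Set (Params m)} (hV : IsOpen V)
    {A₁ : Params m → Matrix ι κ ℂ} {A₂ : Matrix ι κ ℂ} {z d : Params m} (hz : z ∈ V)
    (h₁ : ∀ w ∈ V, HasEntryDeriv A (A₁ w) w (∑ k ∈ S, e k)) (h₂ : HasEntryDeriv A₁ A₂ z d) :
    HasEntryDeriv (CubicKP.sumPartial e S A) A₂ z d :=
  h₂.congr_of_eventuallyEq <| by
    filter_upwards [hV.mem_nhds hz] with w hw using (h₁ w hw).sumPartial_eq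

end sumPartial

/-! ### The matrix AKNS hierarchy and its consequence, the matrix KP equation -/

/-- The evolution of the moment matrices of a cubic integrable operator in the three flows. -/
structure MomentHierarchy {E : Type*} [NormedAddCommGroup E] [NormedSpace ℝ E] {ι κ : Type}
    [Fintype ι] [Fintype κ] (V : Set E) (X Y T : E)
    (q : ℕ → ℕ → E → Matrix ι ι ℂ) (p : ℕ → E → Matrix ι κ ℂ) (r : ℕ → E → Matrix κ ι ℂ)
    (s : E → Matrix κ κ ℂ) : Prop where
  comm : ∀ i j, ∀ z ∈ V, q i (j + 1) z = q (i + 1) j z + q i 0 z * q 0 j z + p i z * r j z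
  q_x : ∀ i j, ∀ z ∈ V,
    HasEntryDeriv (q i j) (q (i + 1) j z - q i (j + 1) z + q i 0 z * q 0 j z) z X
  q_y : ∀ i j, ∀ z ∈ V, HasEntryDeriv (q i j)
    (q (i + 2) j z - q i (j + 2) z + (q i 0 z * q 1 j z + q i 1 z * q 0 j z)) z Y
  p_x : ∀ i, ∀ z ∈ V, HasEntryDeriv (p i) (p (i + 1) z + q i 0 z * p 0 z) z X
  p_y : ∀ i, ∀ z ∈ V,
    HasEntryDeriv (p i) (p (i + 2) z + (q i 0 z * p 1 z + q i 1 z * p 0 z)) z Y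
  p_t : ∀ i, ∀ z ∈ V, HasEntryDeriv (p i)
    (p (i + 3) z + (q i 0 z * p 2 z + q i 1 z * p 1 z + q i 2 z * p 0 z)) z T
  r_x : ∀ j, ∀ z ∈ V, HasEntryDeriv (r j) (-r (j + 1) z + r 0 z * q 0 j z) z X
  r_y : ∀ j, ∀ z ∈ V,
    HasEntryDeriv (r j) (-r (j + 2) z + (r 0 z * q 1 j z + r 1 z * q 0 j z)) z Y
  r_t : ∀ j, ∀ z ∈ V, HasEntryDeriv (r j)
    (-r (j + 3) z + (r 0 z * q 2 j z + r 1 z * q 1 j z + r 2 z * q 0 j z)) z T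
  s_x : ∀ z ∈ V, HasEntryDeriv s (r 0 z * p 0 z) z X
  s_y : ∀ z ∈ V, HasEntryDeriv s (r 0 z * p 1 z + r 1 z * p 0 z) z Y

namespace MomentHierarchy

variable {E : Type*} [NormedAddCommGroup E] [NormedSpace ℝ E] {ι κ : Type}
    [Fintype ι] [Fintype κ] {V : Set E} {X Y T : E}
    {q : ℕ → ℕ → E → Matrix ι ι ℂ} {p : ℕ → E → Matrix ι κ ℂ} {r : ℕ → E → Matrix κ ι ℂ}
    {s : E → Matrix κ κ ℂ}

variable (q p r) in
/-- The first derivative of `p₀` along `X`. -/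
def px : E → Matrix ι κ ℂ := fun z => p 1 z + q 0 0 z * p 0 z

variable (q p r) in
/-- The second derivative of `p₀` along `X`. -/
def pxx : E → Matrix ι κ ℂ := fun z =>
  p 2 z + q 1 0 z * p 0 z - p 0 z * r 0 z * p 0 z + q 0 0 z * px q p z

variable (q p r) in
/-- The third derivative of `p₀` along `X`. -/
def pxxx : E → Matrix ι κ ℂ := fun z =>
  p 3 z + q 2 0 z * p 0 z - p 1 z * r 0 z * p 0 z + q 1 0 z * px q p z
    - (px q p z * r 0 z * p 0 z + p 0 z * (-r 1 z + r 0 z * q 0 0 z) * p 0 z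
      + p 0 z * r 0 z * px q p z)
    - p 0 z * r 0 z * px q p z + q 0 0 z * pxx q p r z

variable (q r) in
/-- The first derivative of `r₀` along `X`. -/
def rx : E → Matrix κ ι ℂ := fun z => -r 1 z + r 0 z * q 0 0 z

variable (q p r) in
/-- The second derivative of `r₀` along `X`. -/
def rxx : E → Matrix κ ι ℂ := fun z =>
  r 2 z - r 0 z * q 0 1 z + rx q r z * q 0 0 z - r 0 z * p 0 z * r 0 z

variable (q p r) in
/-- The third derivative of `r₀` along `X`. -/
def rxxx : E → Matrix κ ι ℂ := fun z =>
  -r 3 z + r 0 z * q 0 2 z - (rx q r z * q 0 1 z - r 0 z * (p 0 z * r 1 z))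
    + (rxx q p r z * q 0 0 z - rx q r z * (p 0 z * r 0 z))
    - (rx q r z * p 0 z * r 0 z + r 0 z * px q p z * r 0 z + r 0 z * p 0 z * rx q r z)

variable (h : MomentHierarchy V X Y T q p r s) {z : E} (hz : z ∈ V)
include h hz

/-- The commutation relation `comm` cancels both raised moments and the quadratic term in `q`. -/
theorem q_x' (i j : ℕ) : HasEntryDeriv (q i j) (-(p i z * r j z)) z X :=
  (h.q_x i j z hz).congr_deriv (by rw [h.comm i j z hz]; abel)

theorem p0_x : HasEntryDeriv (p 0) (px q p z) z X := h.p_x 0 z hz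

theorem r0_x : HasEntryDeriv (r 0) (rx q r z) z X := h.r_x 0 z hz

theorem px_x : HasEntryDeriv (px q p) (pxx q p r z) z X :=
  ((h.p_x 1 z hz).add ((h.q_x' hz 0 0).mul (h.p0_x hz))).congr_deriv <| by
    simp only [pxx, Matrix.neg_mul, Matrix.mul_assoc]; abel

theorem rx_x : HasEntryDeriv (rx q r) (rxx q p r z) z X :=
  ((h.r_x 1 z hz).neg.add ((h.r0_x hz).mul (h.q_x' hz 0 0))).congr_deriv <| by
    simp only [rxx, Matrix.mul_neg, Matrix.mul_assoc, neg_add, neg_neg]; abel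

theorem pxx_x : HasEntryDeriv (pxx q p r) (pxxx q p r z) z X :=
  ((((h.p_x 2 z hz).add ((h.q_x' hz 1 0).mul (h.p0_x hz))).sub
    (((h.p0_x hz).mul (h.r0_x hz)).mul (h.p0_x hz))).add
    ((h.q_x' hz 0 0).mul (h.px_x hz))).congr_deriv <| by
    simp only [pxxx, rx, Matrix.neg_mul, Matrix.mul_assoc, Matrix.add_mul]; abel

theorem rxx_x : HasEntryDeriv (rxx q p r) (rxxx q p r z) z X :=
  ((((h.r_x 2 z hz).sub ((h.r0_x hz).mul (h.q_x' hz 0 1))).add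
    ((h.rx_x hz).mul (h.q_x' hz 0 0))).sub
    (((h.r0_x hz).mul (h.p0_x hz)).mul (h.r0_x hz))).congr_deriv <| by
    simp only [rxxx, Matrix.mul_neg, Matrix.mul_assoc, Matrix.add_mul]; abel

/-- The moment `p 2` is expressed through `pxx`, and `q 0 1` is traded for `q 1 0` by `comm`. The
trade produces one copy of `p r p`, and `pxx` contains another with the opposite sign, whence the
coefficient 2. -/
theorem p0_y : HasEntryDeriv (p 0) (pxx q p r z + (2 : ℂ) • (p 0 z * r 0 z * p 0 z)) z Y :=
  (h.p_y 0 z hz).congr_deriv <| by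
    simp only [pxx, px, h.comm 0 0 z hz, Matrix.add_mul, Matrix.mul_add, Matrix.mul_assoc, zero_add]
    module

theorem r0_y : HasEntryDeriv (r 0) (-rxx q p r z - (2 : ℂ) • (r 0 z * p 0 z * r 0 z)) z Y :=
  (h.r_y 0 z hz).congr_deriv <| by
    simp only [rxx, rx, h.comm 0 0 z hz, Matrix.add_mul, Matrix.mul_add, Matrix.mul_assoc, zero_add,
      Matrix.neg_mul]
    module

/-- Two applications of `comm` telescope `q 2 0 - q 0 2` through `q 1 1`; only products of `p` and
`r` survive. -/
theorem q_y' : HasEntryDeriv (q 0 0) (p 0 z * rx q r z - px q p z * r 0 z) z Y :=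
  (h.q_y 0 0 z hz).congr_deriv <| by
    have h1 := h.comm 0 1 z hz
    have h2 := h.comm 1 0 z hz
    have h3 := h.comm 0 0 z hz
    norm_num at h1 h2 h3 ⊢
    simp only [h1, h2, h3, px, rx, Matrix.add_mul, Matrix.mul_add, Matrix.mul_assoc, 
      Matrix.mul_neg]
    abel

theorem s_y' : HasEntryDeriv s (r 0 z * px q p z - rx q r z * p 0 z) z Y :=
  (h.s_y z hz).congr_deriv <| by
    simp only [px, rx, Matrix.add_mul, Matrix.mul_add, Matrix.mul_assoc, Matrix.neg_mul]
    abel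

/-- The hierarchy is differentiated directly in `Y`. The result is the `X`-derivative of the right
side of `p0_y`, obtained without interchanging mixed derivatives. -/
theorem px_y : HasEntryDeriv (px q p) (pxxx q p r z + (2 : ℂ) • (px q p z * r 0 z * p 0 z
    + p 0 z * rx q r z * p 0 z + p 0 z * r 0 z * px q p z)) z Y :=
  ((h.p_y 1 z hz).add ((h.q_y' hz).mul (h.p0_y hz))).congr_deriv <| by
    have h2 := h.comm 1 0 z hz
    norm_num at h2 ⊢
    simp only [h2, pxxx, pxx, px, rx, Matrix.add_mul, Matrix.mul_add, Matrix.mul_assoc,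
      Matrix.mul_neg, Matrix.neg_mul, Matrix.mul_sub, Matrix.sub_mul, Matrix.mul_smul]
    module

theorem rx_y : HasEntryDeriv (rx q r) (-rxxx q p r z - (2 : ℂ) • (rx q r z * p 0 z * r 0 z
    + r 0 z * px q p z * r 0 z + r 0 z * p 0 z * rx q r z)) z Y :=
  ((h.r_y 1 z hz).neg.add ((h.r0_y hz).mul (h.q_y' hz))).congr_deriv <| by
    have h1 := h.comm 0 1 z hz
    have h2 := h.comm 1 0 z hz
    have h3 := h.comm 0 0 z hz
    norm_num at h1 h2 h3 ⊢
    simp only [h1, h2, h3, rxxx, rxx, px, rx, Matrix.add_mul, Matrix.mul_add, Matrix.mul_assoc,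
      Matrix.mul_neg, Matrix.neg_mul, Matrix.mul_sub, Matrix.sub_mul, Matrix.smul_mul]
    module

theorem p0_t : HasEntryDeriv (p 0) (pxxx q p r z + (3 : ℂ) • (px q p z * r 0 z * p 0 z
    + p 0 z * r 0 z * px q p z)) z T :=
  (h.p_t 0 z hz).congr_deriv <| by
    have h1 := h.comm 0 1 z hz
    have h2 := h.comm 1 0 z hz
    have h3 := h.comm 0 0 z hz
    norm_num at h1 h2 h3 ⊢
    simp only [h1, h2, h3, pxxx, pxx, px, Matrix.add_mul, Matrix.mul_add, Matrix.mul_assoc,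
      Matrix.mul_neg, Matrix.neg_mul, Matrix.mul_sub]
    module

theorem r0_t : HasEntryDeriv (r 0) (rxxx q p r z + (3 : ℂ) • (rx q r z * p 0 z * r 0 z
    + r 0 z * p 0 z * rx q r z)) z T :=
  (h.r_t 0 z hz).congr_deriv <| by
    have h1 := h.comm 0 1 z hz
    have h2 := h.comm 1 0 z hz
    have h3 := h.comm 0 0 z hz
    norm_num at h1 h2 h3 ⊢
    simp only [h1, h2, h3, rxxx, rxx, px, rx, Matrix.add_mul, Matrix.mul_add, Matrix.mul_assoc,
      Matrix.mul_neg, Matrix.neg_mul, Matrix.sub_mul]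
    module

end MomentHierarchy

/-! ### Elimination of the higher moments: the two matrix KP equations -/

section KP

variable {m : ℕ} {ι κ : Type} [Fintype ι] [Fintype κ]
    {V : Set (Params m)} {S : Finset (Fin m)} {ex ey et : Fin m → Params m}
    {q : ℕ → ℕ → Params m → Matrix ι ι ℂ} {p : ℕ → Params m → Matrix ι κ ℂ}
    {r : ℕ → Params m → Matrix κ ι ℂ} {s : Params m → Matrix κ κ ℂ}
open MomentHierarchy

theorem MomentHierarchy.kp_left [DecidableEq ι] (hV : IsOpen V)
    (h : MomentHierarchy V (∑ k ∈ S, ex k) (∑ k ∈ S, ey k) (∑ k ∈ S, et k) q p r s)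
    {z : Params m} (hz : z ∈ V) :
    (-4 : ℂ) • sumPartial et S (fun w => p 0 w * r 0 w) z
      + sumPartial ex S (sumPartial ex S (sumPartial ex S fun w => p 0 w * r 0 w)) z
      + (6 : ℂ) • sumPartial ex S (fun w => (p 0 w * r 0 w) ^ 2) z
      - (3 : ℂ) • sumPartial ey S (sumPartial ey S (q 0 0)) z
      + (6 : ℂ) • (p 0 z * r 0 z * sumPartial ey S (q 0 0) z
        - sumPartial ey S (q 0 0) z * (p 0 z * r 0 z)) = 0 ∧
    sumPartial ex S (q 0 0) z = -(p 0 z * r 0 z) := by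
  -- Leibniz expansions of the first three `X`-derivatives of `p r`, on all of `V` so that they can
  -- be iterated.
  have u1 := fun w (hw : w ∈ V) => (h.p0_x hw).mul (h.r0_x hw)
  have u2 := fun w (hw : w ∈ V) => ((h.px_x hw).mul (h.r0_x hw)).add ((h.p0_x hw).mul (h.rx_x hw))
  have u3 := fun w (hw : w ∈ V) => (((h.pxx_x hw).mul (h.r0_x hw)).add ((h.px_x hw).mul (h.rx_x hw))).add
    (((h.px_x hw).mul (h.rx_x hw)).add ((h.p0_x hw).mul (h.rxx_x hw)))
  have v2 := HasEntryDeriv.sumPartial hV hz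
    (fun w hw => HasEntryDeriv.sumPartial hV hw u1 (u2 w hw)) (u3 z hz)
  have y2 := HasEntryDeriv.sumPartial hV hz (fun w hw => h.q_y' hw)
    (((h.p0_y hz).mul (h.rx_y hz)).sub ((h.px_y hz).mul (h.r0_y hz)))
  simp only [pow_two]
  refine ⟨?_, (h.q_x' hz 0 0).sumPartial_eq⟩
  rw [((h.p0_t hz).mul (h.r0_t hz)).sumPartial_eq, v2.sumPartial_eq,
    ((u1 z hz).mul (u1 z hz)).sumPartial_eq, y2.sumPartial_eq, (h.q_y' hz).sumPartial_eq]
  simp only [Matrix.add_mul, Matrix.mul_add, Matrix.mul_assoc, Matrix.smul_mul, Matrix.mul_smul,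
      Matrix.mul_neg, Matrix.mul_sub, Matrix.sub_mul]
  -- After expansion, both sides are linear combinations of noncommutative monomials in `p`, `r` and
  -- their `X`-derivatives, and the coefficients agree.
  module

theorem MomentHierarchy.kp_right [DecidableEq κ] (hV : IsOpen V)
    (h : MomentHierarchy V (∑ k ∈ S, ex k) (∑ k ∈ S, ey k) (∑ k ∈ S, et k) q p r s)
    {z : Params m} (hz : z ∈ V) :
    (-4 : ℂ) • sumPartial et S (fun w => r 0 w * p 0 w) z
      + sumPartial ex S (sumPartial ex S (sumPartial ex S fun w => r 0 w * p 0 w)) z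
      + (6 : ℂ) • sumPartial ex S (fun w => (r 0 w * p 0 w) ^ 2) z
      + (3 : ℂ) • sumPartial ey S (sumPartial ey S s) z
      + (6 : ℂ) • (r 0 z * p 0 z * sumPartial ey S s z
        - sumPartial ey S s z * (r 0 z * p 0 z)) = 0 ∧
    sumPartial ex S s z = r 0 z * p 0 z := by
  have u1 := fun w (hw : w ∈ V) => (h.r0_x hw).mul (h.p0_x hw)
  have u2 := fun w (hw : w ∈ V) => ((h.rx_x hw).mul (h.p0_x hw)).add ((h.r0_x hw).mul (h.px_x hw))
  have u3 := fun w (hw : w ∈ V) => (((h.rxx_x hw).mul (h.p0_x hw)).add ((h.rx_x hw).mul (h.px_x hw))).add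
    (((h.rx_x hw).mul (h.px_x hw)).add ((h.r0_x hw).mul (h.pxx_x hw)))
  have v2 := HasEntryDeriv.sumPartial hV hz
    (fun w hw => HasEntryDeriv.sumPartial hV hw u1 (u2 w hw)) (u3 z hz)
  have y2 := HasEntryDeriv.sumPartial hV hz (fun w hw => h.s_y' hw)
    (((h.r0_y hz).mul (h.px_y hz)).sub ((h.rx_y hz).mul (h.p0_y hz)))
  simp only [pow_two]
  refine ⟨?_, (h.s_x z hz).sumPartial_eq⟩
  rw [((h.r0_t hz).mul (h.p0_t hz)).sumPartial_eq, v2.sumPartial_eq,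
    ((u1 z hz).mul (u1 z hz)).sumPartial_eq, y2.sumPartial_eq, (h.s_y' hz).sumPartial_eq]
  simp only [Matrix.add_mul, Matrix.mul_add, Matrix.mul_assoc, Matrix.smul_mul, Matrix.mul_smul,
      Matrix.neg_mul, Matrix.mul_sub, Matrix.sub_mul]
  module

end KP

end CubicKP

namespace CubicKP

/-! ### Measurability of contours -/

/-- The arcs on both sides of a parameter are closed, so one-sided continuity holds up to corners.
-/
theorem SimpleContour.continuous (C : SimpleContour) : Continuous C.γ := by
  rw [continuous_iff_continuousAt]
  intro s
  obtain ⟨ε, hε, h1, h2⟩ := C.regular s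
  rw [continuousAt_iff_continuous_left'_right']
  have hr := (h1.1.continuousOn s ⟨le_rfl, by linarith⟩)
  have hl := (h2.1.continuousOn s ⟨by linarith, le_rfl⟩)
  constructor
  · exact hl.mono_of_mem_nhdsWithin
      (mem_of_superset (Ioo_mem_nhdsLT (show s - ε < s by linarith)) Set.Ioo_subset_Icc_self)
  · exact hr.mono_of_mem_nhdsWithin
      (mem_of_superset (Ioo_mem_nhdsGT (show s < s + ε by linarith)) Set.Ioo_subset_Icc_self)

theorem SimpleContour.measurableSet_dom (C : SimpleContour) : MeasurableSet C.dom := by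
  rcases C.closed_or_infinite with ⟨T, -, h, -⟩ | ⟨h, -⟩ <;> rw [h]
  · exact measurableSet_Ico
  · exact MeasurableSet.univ

theorem SimpleContour.injOn (C : SimpleContour) : Set.InjOn C.γ C.dom := by
  rcases C.closed_or_infinite with ⟨T, -, h, -, h'⟩ | ⟨h, h', -⟩ <;> rw [h]
  · exact h'
  · exact h'.injOn

/-- Lusin–Souslin: an injective continuous image of a Borel set is Borel. -/
theorem SimpleContour.measurableSet_image (C : SimpleContour) {s : Set ℝ} (hs : MeasurableSet s)
    (h : s ⊆ C.dom) : MeasurableSet (C.γ '' s) :=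
  hs.image_of_continuousOn_injOn C.continuous.continuousOn (C.injOn.mono h)

instance SimpleContour.sFinite_arcLength (C : SimpleContour) : SFinite C.arcLength := by
  unfold SimpleContour.arcLength
  infer_instance

theorem SimpleContour.ae_mem_trace (C : SimpleContour) : ∀ᵐ u ∂C.arcLength, u ∈ C.trace := by
  have hm : MeasurableSet C.trace := C.measurableSet_image C.measurableSet_dom subset_rfl
  refine (ae_map_iff C.continuous.aemeasurable hm).2 ?_
  refine (withDensity_absolutelyContinuous _ _).ae_le ?_
  filter_upwards [ae_restrict_mem C.measurableSet_dom] with s hs using ⟨s, hs, rfl⟩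

/-! ### The supports `Ω` -/

theorem countable_of_forall_not_accPt {A : Set ℂ} (h : ∀ z : ℂ, ¬ AccPt z (𝓟 A)) :
    A.Countable := by
  have : DiscreteTopology A := discreteTopology_of_noAccPts fun x _ => h x
  exact Set.countable_coe_iff.mp <| TopologicalSpace.separableSpace_iff_countable.mp inferInstance

theorem sFinite_count_restrict {A : Set ℂ} (hA : A.Countable) :
    SFinite (Measure.count.restrict A) := by
  have := hA.to_subtype
  have hU : A = ⋃ a : A, {(a : ℂ)} := by simp
  rw [hU, Measure.restrict_iUnion (fun a b hab => by
    simpa [Subtype.ext_iff] using hab) fun a => measurableSet_singleton _]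
  have : ∀ a : A, SFinite (Measure.count.restrict {(a : ℂ)}) := fun a => by
    have : IsFiniteMeasure (Measure.count.restrict {(a : ℂ)}) := ⟨by simp⟩
    infer_instance
  infer_instance

instance Support.sFinite_absMeasure (Ω : Support) : SFinite Ω.absMeasure := by
  cases Ω with
  | discrete A h => exact sFinite_count_restrict (countable_of_forall_not_accPt h)
  | contours n C h => unfold Support.absMeasure; infer_instance

theorem Support.ae_mem_carrier (Ω : Support) : ∀ᵐ u ∂Ω.absMeasure, u ∈ Ω.carrier := by
  cases Ω with
  | discrete A h => exact ae_restrict_mem (countable_of_forall_not_accPt h).measurableSet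
  | contours n C h =>
    rw [Support.absMeasure, Measure.ae_sum_iff]
    intro i
    filter_upwards [(C i).ae_mem_trace] with u hu using Set.mem_iUnion.2 ⟨i, hu⟩

theorem Support.norm_direction_le (Ω : Support) (u : ℂ) : ‖Ω.direction u‖ ≤ 1 := by
  cases Ω with
  | discrete A h => simp [Support.direction]
  | contours n C h =>
    unfold Support.direction
    dsimp only
    split_ifs with h
    · simpa using div_self_le_one _
    · simp

theorem Support.measurable_direction (Ω : Support) : Measurable Ω.direction := by
  cases Ω with
  | discrete A h => exact measurable_const
  | contours n C hd =>
    let τ : Fin n → ℝ → ℂ := fun i s => deriv (C i).γ s / (‖deriv (C i).γ s‖ : ℂ)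
    have hτ : ∀ i, Measurable (τ i) := fun i =>
      (measurable_deriv _).div (Complex.measurable_ofReal.comp (measurable_deriv _).norm)
    have on_trace : ∀ i, ∀ s ∈ (C i).dom,
        (Support.contours n C hd).direction ((C i).γ s) = τ i s := by
      intro i s hs
      have hex : ∃ q : Fin n × ℝ, q.2 ∈ (C q.1).dom ∧ (C q.1).γ q.2 = (C i).γ s := ⟨(i, s), hs, rfl⟩
      have hcs := hex.choose_spec
      have hi : hex.choose.1 = i := by
        by_contra hne
        exact Set.disjoint_left.1 (hd hne) ⟨_, hcs.1, hcs.2⟩ ⟨s, hs, rfl⟩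
      have hs' : hex.choose.2 = s := by
        refine (C i).injOn (by have := hcs.1; rwa [hi] at this) hs ?_
        have := hcs.2
        rwa [hi] at this
      simp only [Support.direction]
      rw [dif_pos hex, hi, hs']
    have off_trace : ∀ w, (∀ i, w ∉ (C i).trace) →
        (Support.contours n C hd).direction w = 0 := by
      intro w hw
      simp only [Support.direction]
      rw [dif_neg]
      rintro ⟨q, h1, h2⟩
      exact hw q.1 ⟨q.2, h1, h2⟩
    intro B hB
    -- The direction is the tangent `τ i` on the `i`-th trace and `0` off all traces, so a preimage
    -- is a union of images of Borel parameter sets, together with the complement of the contours if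
    -- `0 ∈ B`.
    have key : (Support.contours n C hd).direction ⁻¹' B =
        (⋃ i, (C i).γ '' ((C i).dom ∩ τ i ⁻¹' B)) ∪
          ((⋃ i, (C i).trace)ᶜ ∩ {_w : ℂ | (0 : ℂ) ∈ B}) := by
      ext w
      by_cases hw : ∃ i, w ∈ (C i).trace
      · obtain ⟨i, s, hs, rfl⟩ := hw
        constructor
        · intro h
          rw [Set.mem_preimage, on_trace i s hs] at h
          exact Or.inl (Set.mem_iUnion.2 ⟨i, s, ⟨hs, h⟩, rfl⟩)
        · rintro (h | h)
          · obtain ⟨j, s', ⟨hs', h'⟩, he⟩ := Set.mem_iUnion.1 h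
            rw [Set.mem_preimage, ← he, on_trace j s' hs']
            exact h'
          · exact (h.1 (Set.mem_iUnion.2 ⟨i, s, hs, rfl⟩)).elim
      · push Not at hw
        rw [Set.mem_preimage, off_trace w hw]
        constructor
        · exact fun h => Or.inr ⟨by simpa using hw, h⟩
        · rintro (h | h)
          · obtain ⟨j, s', ⟨hs', h'⟩, he⟩ := Set.mem_iUnion.1 h
            exact (hw j ⟨s', hs', he⟩).elim
          · exact h.2
    rw [key]
    refine (MeasurableSet.iUnion fun i => (C i).measurableSet_image
      ((C i).measurableSet_dom.inter (hτ i hB)) Set.inter_subset_left).union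
      ((MeasurableSet.iUnion fun i => (C i).measurableSet_image
        (C i).measurableSet_dom subset_rfl).compl.inter (MeasurableSet.const _))

end CubicKP

namespace CubicKP

/-! ### Tools in `L²(Ω, |μ|)` -/

theorem integral_norm_mul_le {α : Type*} [MeasurableSpace α] {μ : Measure α} {φ ψ : α → ℝ}
    (hφ : MemLp φ 2 μ) (hψ : MemLp ψ 2 μ) :
    ∫ x, ‖φ x * ψ x‖ ∂μ ≤ (eLpNorm φ 2 μ).toReal * (eLpNorm ψ 2 μ).toReal := by
  rw [integral_norm_eq_lintegral_enorm (f := fun x => φ x * ψ x) (hφ.1.mul hψ.1), ← ENNReal.toReal_mul]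
  refine ENNReal.toReal_mono (ENNReal.mul_ne_top hφ.2.ne hψ.2.ne) ?_
  have h := eLpNorm_smul_le_mul_eLpNorm (p := 2) (q := 2) (r := 1) hψ.1 hφ.1
  rw [eLpNorm_one_eq_lintegral_enorm] at h
  exact h

theorem tendsto_L2_of_dominated {α : Type*} [MeasurableSpace α] {μ : Measure α}
    {F : ℕ → Lp ℂ 2 μ} {f : Lp ℂ 2 μ} {E : α → ℝ} (hE : MemLp E 2 μ)
    (hb : ∀ n, ∀ᵐ u ∂μ, ‖F n u‖ ≤ E u)
    (hlim : ∀ᵐ u ∂μ, Tendsto (fun n => F n u) atTop (𝓝 (f u))) :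
    Tendsto F atTop (𝓝 f) := by
  rw [Lp.tendsto_Lp_iff_tendsto_eLpNorm']
  have h2 : ∀ n, eLpNorm (⇑(F n) - ⇑f) 2 μ =
      (∫⁻ u, ‖F n u - f u‖ₑ ^ (2 : ℝ) ∂μ) ^ (1 / 2 : ℝ) := fun n => by
    rw [eLpNorm_eq_lintegral_rpow_enorm_toReal (by norm_num) (by norm_num)]
    norm_num
  simp_rw [h2]
  have key : Tendsto (fun n => ∫⁻ u, ‖F n u - f u‖ₑ ^ (2 : ℝ) ∂μ) atTop
      (𝓝 (∫⁻ _, 0 ∂μ)) := by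
    refine tendsto_lintegral_of_dominated_convergence' (fun u => ‖(2 : ℝ) * E u‖ₑ ^ (2 : ℝ))
      (fun n => (((Lp.aestronglyMeasurable _).sub
        (Lp.aestronglyMeasurable _)).enorm).pow_const _) ?_ ?_ ?_
    · intro n
      filter_upwards [hb n, ae_all_iff.2 hb, hlim] with u hu hall hl
      -- The limit inherits the bound `E`, so the differences are dominated by `2E`.
      have hfu : ‖f u‖ ≤ E u := le_of_tendsto hl.norm (Eventually.of_forall hall)
      refine ENNReal.rpow_le_rpow (enorm_le_iff_norm_le.2 ?_) (by norm_num)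
      have h0 : 0 ≤ E u := (norm_nonneg _).trans hu
      rw [Real.norm_of_nonneg (by positivity)]
      linarith [norm_sub_le (F n u) (f u)]
    · have := (hE.const_mul 2).2
      rw [eLpNorm_lt_top_iff_lintegral_rpow_enorm_lt_top (by norm_num) (by norm_num)] at this
      simpa using this.ne
    · filter_upwards [hlim] with u hl
      have := (tendsto_sub_nhds_zero_iff.2 hl).enorm
      rw [enorm_zero] at this
      simpa [Function.comp_def] using
        (ENNReal.continuous_rpow_const (y := 2)).continuousAt.tendsto.comp this
  have := (ENNReal.continuous_rpow_const (y := (1 / 2 : ℝ))).continuousAt.tendsto.comp key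
  simpa [Function.comp_def] using this

variable (Ω : Support)

theorem memLp_top_of_bounded {θ : ℂ → ℂ} (hθ : AEStronglyMeasurable θ Ω.absMeasure) {C : ℝ}
    (hC : ∀ᵐ u ∂Ω.absMeasure, ‖θ u‖ ≤ C) : MemLp θ ⊤ Ω.absMeasure :=
  memLp_top_of_bound hθ C hC

/-- Multiplication by an essentially bounded function. -/
def mulL2 (θ : ℂ → ℂ) (hθ : MemLp θ ⊤ Ω.absMeasure) : Ω.L2 →L[ℂ] Ω.L2 :=
  (ContinuousLinearMap.mul ℂ ℂ).holderL Ω.absMeasure ⊤ 2 2 (hθ.toLp θ)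

theorem mulL2_coeFn {θ : ℂ → ℂ} (hθ : MemLp θ ⊤ Ω.absMeasure) (h : Ω.L2) :
    mulL2 Ω θ hθ h =ᵐ[Ω.absMeasure] fun u => θ u * h u := by
  have h1 := (ContinuousLinearMap.mul ℂ ℂ).coeFn_holder (r := 2) (hθ.toLp θ) h
  filter_upwards [h1, hθ.coeFn_toLp] with u h1 h2
  exact h1.trans (by simp [h2])

theorem direction_memLp : MemLp Ω.direction ⊤ Ω.absMeasure :=
  memLp_top_of_bounded Ω Ω.measurable_direction.aestronglyMeasurable
    (ae_of_all _ Ω.norm_direction_le)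

/-- The bilinear pairing `(φ, ψ) ↦ ∫_Ω φ ψ dμ`. -/
def pairing : Ω.L2 →L[ℂ] Ω.L2 →L[ℂ] ℂ :=
  ((ContinuousLinearMap.mul ℂ ℂ).lpPairing Ω.absMeasure 2 2).comp
    (mulL2 Ω Ω.direction (direction_memLp Ω))

theorem pairing_apply (φ ψ : Ω.L2) : pairing Ω φ ψ = Ω.integral fun u => φ u * ψ u := by
  rw [pairing, ContinuousLinearMap.comp_apply, ContinuousLinearMap.lpPairing_eq_integral,
    Support.integral, Support.integralOn, Measure.restrict_univ]
  refine integral_congr_ae ?_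
  filter_upwards [mulL2_coeFn Ω (direction_memLp Ω) φ] with u hu
  simp only [hu, ContinuousLinearMap.mul_apply']
  ring

theorem integral_congr_ae' {φ ψ : ℂ → ℂ} (h : φ =ᵐ[Ω.absMeasure] ψ) :
    Ω.integral φ = Ω.integral ψ := by
  simp only [Support.integral, Support.integralOn, Measure.restrict_univ]
  refine integral_congr_ae ?_
  filter_upwards [h] with u hu
  rw [hu]

variable {Ω}

theorem toL2_of_memLp {φ : ℂ → ℂ} (h : MemLp φ 2 Ω.absMeasure) : Ω.toL2 φ = h.toLp φ := by
  rw [Support.toL2, dif_pos h]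

theorem toL2_coeFn {φ : ℂ → ℂ} (h : MemLp φ 2 Ω.absMeasure) :
    Ω.toL2 φ =ᵐ[Ω.absMeasure] φ := by
  rw [toL2_of_memLp h]
  exact h.coeFn_toLp

theorem norm_le_of_ae_le {E : ℂ → ℝ} (hE : MemLp E 2 Ω.absMeasure) {h : Ω.L2} {C : ℝ}
    (hb : ∀ᵐ u ∂Ω.absMeasure, ‖h u‖ ≤ C * E u) (hC : 0 ≤ C) :
    ‖h‖ ≤ C * (eLpNorm E 2 Ω.absMeasure).toReal := by
  rw [← Lp.norm_toLp E hE]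
  refine Lp.norm_le_mul_norm_of_ae_le_mul ?_
  filter_upwards [hb, hE.coeFn_toLp] with u h1 h2
  rw [h2]
  exact h1.trans (mul_le_mul_of_nonneg_left (le_abs_self _) hC)

theorem integral_mul_norm_le {E : ℂ → ℝ} (hE : MemLp E 2 Ω.absMeasure) (h : Ω.L2) :
    ∫ v, E v * ‖h v‖ ∂Ω.absMeasure ≤ (eLpNorm E 2 Ω.absMeasure).toReal * ‖h‖ := by
  have h1 := integral_norm_mul_le hE (Lp.memLp h).norm
  rw [eLpNorm_norm] at h1
  refine le_trans (le_trans (le_abs_self _) ?_) h1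
  exact abs_integral_le_integral_abs

/-- Cauchy–Schwarz on the inner integral, followed by the norm of `E₁`, as for Hilbert–Schmidt
kernels of product type. -/
theorem norm_le_of_kernel_bound {E₁ E₂ : ℂ → ℝ} (h₁ : MemLp E₁ 2 Ω.absMeasure)
    (h₂ : MemLp E₂ 2 Ω.absMeasure) (h0 : ∀ᵐ u ∂Ω.absMeasure, 0 ≤ E₂ u) {h k : Ω.L2} {C : ℝ}
    (hC : 0 ≤ C)
    (hb : ∀ᵐ u ∂Ω.absMeasure, ‖k u‖ ≤ C * (E₁ u * ∫ v, E₂ v * ‖h v‖ ∂Ω.absMeasure)) :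
    ‖k‖ ≤ C * ((eLpNorm E₁ 2 Ω.absMeasure).toReal * (eLpNorm E₂ 2 Ω.absMeasure).toReal) * ‖h‖ := by
  have hI : 0 ≤ ∫ v, E₂ v * ‖h v‖ ∂Ω.absMeasure := by
    refine integral_nonneg_of_ae ?_
    filter_upwards [h0] with u hu using mul_nonneg hu (norm_nonneg _)
  have h1 := norm_le_of_ae_le h₁ (h := k) (C := C * ∫ v, E₂ v * ‖h v‖ ∂Ω.absMeasure)
    (by filter_upwards [hb] with u hu; exact hu.trans (le_of_eq (by ring))) (by positivity)
  refine h1.trans ?_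
  have h2 := mul_le_mul_of_nonneg_left (integral_mul_norm_le h₂ h)
    (mul_nonneg hC (ENNReal.toReal_nonneg (a := eLpNorm E₁ 2 Ω.absMeasure)))
  linarith

theorem opNorm_le_of_kernel_bound {E₁ E₂ : ℂ → ℝ} (h₁ : MemLp E₁ 2 Ω.absMeasure)
    (h₂ : MemLp E₂ 2 Ω.absMeasure) (h0 : ∀ᵐ u ∂Ω.absMeasure, 0 ≤ E₂ u) {T : Ω.L2 →L[ℂ] Ω.L2}
    {C : ℝ} (hC : 0 ≤ C)
    (hb : ∀ h : Ω.L2, ∀ᵐ u ∂Ω.absMeasure,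
      ‖T h u‖ ≤ C * (E₁ u * ∫ v, E₂ v * ‖h v‖ ∂Ω.absMeasure)) :
    ‖T‖ ≤ C * ((eLpNorm E₁ 2 Ω.absMeasure).toReal * (eLpNorm E₂ 2 Ω.absMeasure).toReal) :=
  T.opNorm_le_bound (by positivity) fun h => norm_le_of_kernel_bound h₁ h₂ h0 hC (hb h)

/-- The integrability that makes all kernel integrals below converge absolutely. -/
theorem integrable_kernel_mul {k : ℂ → ℂ} (hk : AEStronglyMeasurable k Ω.absMeasure) {C : ℝ}
    {E : ℂ → ℝ} (hE : MemLp E 2 Ω.absMeasure) (hb : ∀ᵐ v ∂Ω.absMeasure, ‖k v‖ ≤ C * E v)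
    (h : Ω.L2) : Integrable (fun v => k v * h v * Ω.direction v) Ω.absMeasure := by
  have h1 : Integrable (fun v => C * (E v * ‖h v‖)) Ω.absMeasure :=
    (hE.integrable_mul (Lp.memLp h).norm).const_mul C
  refine h1.mono' ((hk.mul (Lp.aestronglyMeasurable h)).mul
    Ω.measurable_direction.aestronglyMeasurable) ?_
  filter_upwards [hb] with v hv
  rw [norm_mul, norm_mul, ← mul_assoc]
  have := mul_le_mul_of_nonneg_right hv (norm_nonneg (h v))
  exact (mul_le_of_le_one_right (by positivity) (Ω.norm_direction_le v)).trans this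

theorem norm_kernel_integral_le {k : ℂ → ℂ} {C : ℝ} {E : ℂ → ℝ}
    (hE : MemLp E 2 Ω.absMeasure) (hb : ∀ᵐ v ∂Ω.absMeasure, ‖k v‖ ≤ C * E v) (h : Ω.L2) :
    ‖∫ v, k v * h v * Ω.direction v ∂Ω.absMeasure‖ ≤
      C * ∫ v, E v * ‖h v‖ ∂Ω.absMeasure := by
  rw [← integral_const_mul]
  have h1 : Integrable (fun v => C * (E v * ‖h v‖)) Ω.absMeasure :=
    (hE.integrable_mul (Lp.memLp h).norm).const_mul C
  refine norm_integral_le_of_norm_le h1 ?_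
  filter_upwards [hb] with v hv
  rw [norm_mul, norm_mul, ← mul_assoc]
  have := mul_le_mul_of_nonneg_right hv (norm_nonneg (h v))
  exact (mul_le_of_le_one_right (by positivity) (Ω.norm_direction_le v)).trans this

/-- A kernel dominated by a product of two square integrable functions defines a bounded
operator. -/
theorem exists_operator_of_kernel {k : ℂ → ℂ → ℂ}
    (hk : AEStronglyMeasurable (Function.uncurry k) (Ω.absMeasure.prod Ω.absMeasure))
    {E₁ E₂ : ℂ → ℝ} (h₁ : MemLp E₁ 2 Ω.absMeasure) (h₂ : MemLp E₂ 2 Ω.absMeasure)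
    (h0 : ∀ᵐ u ∂Ω.absMeasure, 0 ≤ E₂ u)
    (hb : ∀ᵐ u ∂Ω.absMeasure, ∀ᵐ v ∂Ω.absMeasure, ‖k u v‖ ≤ E₁ u * E₂ v) :
    ∃ T : Ω.L2 →L[ℂ] Ω.L2, ∀ h : Ω.L2, ∀ᵐ u ∂Ω.absMeasure,
      T h u = ∫ v, k u v * h v * Ω.direction v ∂Ω.absMeasure := by
  let I : Ω.L2 → ℂ → ℂ := fun h u => ∫ v, k u v * h v * Ω.direction v ∂Ω.absMeasure
  -- Joint measurability of the integrand gives measurability of its partial integral; this is where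
  -- s-finiteness of the measure enters.
  have hmeas : ∀ h, AEStronglyMeasurable (I h) Ω.absMeasure := fun h => by
    have : AEStronglyMeasurable (fun z : ℂ × ℂ => k z.1 z.2 * h z.2 * Ω.direction z.2)
        (Ω.absMeasure.prod Ω.absMeasure) :=
      (hk.mul (Lp.aestronglyMeasurable h).comp_snd).mul
        Ω.measurable_direction.aestronglyMeasurable.comp_snd
    exact this.integral_prod_right'
  have hbd : ∀ h : Ω.L2, ∀ᵐ u ∂Ω.absMeasure,
      ‖I h u‖ ≤ E₁ u * ∫ v, E₂ v * ‖h v‖ ∂Ω.absMeasure := fun h => by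
    filter_upwards [hb] with u hu using norm_kernel_integral_le h₂ hu h
  have hmem : ∀ h, MemLp (I h) 2 Ω.absMeasure := fun h => by
    refine (h₁.mul_const (∫ v, E₂ v * ‖h v‖ ∂Ω.absMeasure)).of_le (hmeas h) ?_
    filter_upwards [hbd h] with u hu using hu.trans (le_abs_self _)
  have hint : ∀ h : Ω.L2, ∀ᵐ u ∂Ω.absMeasure,
      Integrable (fun v => k u v * h v * Ω.direction v) Ω.absMeasure := fun h => by
    filter_upwards [hb, hk.prodMk_left] with u hu hku
    exact integrable_kernel_mul hku h₂ hu h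
  let L : Ω.L2 →ₗ[ℂ] Ω.L2 :=
    { toFun := fun h => (hmem h).toLp (I h)
      map_add' := fun h h' => by
        rw [← MemLp.toLp_add]
        refine MemLp.toLp_congr _ _ ?_
        filter_upwards [hint h, hint h'] with u hu hu'
        rw [Pi.add_apply, ← integral_add hu hu']
        refine integral_congr_ae ?_
        filter_upwards [Lp.coeFn_add h h'] with v hv
        rw [hv, Pi.add_apply]
        ring
      map_smul' := fun c h => by
        rw [RingHom.id_apply, ← MemLp.toLp_const_smul]
        refine MemLp.toLp_congr _ _ (ae_of_all _ fun u => ?_)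
        rw [Pi.smul_apply, smul_eq_mul, ← integral_const_mul]
        refine integral_congr_ae ?_
        filter_upwards [Lp.coeFn_smul c h] with v hv
        rw [hv, Pi.smul_apply, smul_eq_mul]
        ring }
  refine ⟨L.mkContinuous (1 * ((eLpNorm E₁ 2 Ω.absMeasure).toReal *
    (eLpNorm E₂ 2 Ω.absMeasure).toReal)) fun h => norm_le_of_kernel_bound h₁ h₂ h0 zero_le_one ?_,
    fun h => (hmem h).coeFn_toLp⟩
  filter_upwards [(hmem h).coeFn_toLp, hbd h] with u hu hu'
  rw [one_mul]
  exact (congrArg norm hu).trans_le hu'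

end CubicKP

namespace CubicKP

/-! ### Cutoff functions -/

/-- A cutoff that is `1` at the origin, vanishes for `‖u‖ ≥ n + 1` and has slope `1 / (n + 1)`. -/
def cutoff (n : ℕ) (u : ℂ) : ℝ := max 0 (1 - ‖u‖ / (n + 1))

theorem cutoff_nonneg (n : ℕ) (u : ℂ) : 0 ≤ cutoff n u := le_max_left _ _

theorem cutoff_le_one (n : ℕ) (u : ℂ) : cutoff n u ≤ 1 :=
  max_le zero_le_one (sub_le_self _ (by positivity))

theorem cutoff_eq_zero {n : ℕ} {u : ℂ} (h : (n : ℝ) + 1 ≤ ‖u‖) : cutoff n u = 0 :=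
  max_eq_left (sub_nonpos.2 ((one_le_div (by positivity)).2 h))

theorem continuous_cutoff (n : ℕ) : Continuous (cutoff n) := by
  unfold cutoff; fun_prop

theorem norm_cutoff_le (n : ℕ) (u : ℂ) : ‖(cutoff n u : ℂ)‖ ≤ 1 := by
  rw [Complex.norm_real, Real.norm_of_nonneg (cutoff_nonneg n u)]
  exact cutoff_le_one n u

theorem abs_cutoff_sub_le (n : ℕ) (u v : ℂ) :
    |cutoff n u - cutoff n v| ≤ 1 / (n + 1) * ‖u - v‖ := by
  have h1 := abs_max_sub_max_le_abs (1 - ‖u‖ / ((n : ℝ) + 1)) (1 - ‖v‖ / ((n : ℝ) + 1)) 0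
  rw [max_comm _ (0 : ℝ), max_comm _ (0 : ℝ)] at h1
  refine h1.trans ?_
  have : 1 - ‖u‖ / ((n : ℝ) + 1) - (1 - ‖v‖ / (n + 1)) = 1 / (n + 1) * (‖v‖ - ‖u‖) := by
    field_simp; ring
  rw [this, abs_mul, abs_of_pos (by positivity : (0 : ℝ) < 1 / (n + 1)), norm_sub_rev]
  exact mul_le_mul_of_nonneg_left (abs_norm_sub_norm_le v u) (by positivity)

theorem tendsto_cutoff (u : ℂ) : Tendsto (fun n => (cutoff n u : ℂ)) atTop (𝓝 1) := by
  have h := (tendsto_const_nhds (x := (1 : ℝ))).sub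
    ((tendsto_one_div_add_atTop_nhds_zero_nat (𝕜 := ℝ)).const_mul ‖u‖)
  have h2 := (tendsto_const_nhds (x := (0 : ℝ))).max h
  have h3 : Tendsto (fun n => cutoff n u) atTop (𝓝 1) := by
    convert h2 using 2 with n
    · simp [cutoff, div_eq_mul_inv]
    · simp
  exact_mod_cast (Complex.continuous_ofReal.tendsto 1).comp h3

/-- Bounded Lipschitz approximations of the identity function. -/
def truncId (n : ℕ) (u : ℂ) : ℂ := cutoff n u * u

theorem continuous_truncId (n : ℕ) : Continuous (truncId n) := by
  have := continuous_cutoff n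
  unfold truncId; fun_prop

theorem norm_truncId_le (n : ℕ) (u : ℂ) : ‖truncId n u‖ ≤ ‖u‖ := by
  rw [truncId, norm_mul]
  exact mul_le_of_le_one_left (norm_nonneg _) (norm_cutoff_le n u)

theorem norm_truncId_le' (n : ℕ) (u : ℂ) : ‖truncId n u‖ ≤ n + 1 := by
  rcases le_total ‖u‖ (n + 1) with h | h
  · exact (norm_truncId_le n u).trans h
  · rw [truncId, cutoff_eq_zero h]
    simp; positivity

theorem tendsto_truncId (u : ℂ) : Tendsto (fun n => truncId n u) atTop (𝓝 u) := by
  simpa [truncId] using (tendsto_cutoff u).mul_const u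

theorem norm_truncId_sub_le (n : ℕ) (u v : ℂ) : ‖truncId n u - truncId n v‖ ≤ 2 * ‖u - v‖ := by
  wlog huv : ‖u‖ ≤ ‖v‖ generalizing u v
  · rw [norm_sub_rev, norm_sub_rev u v]
    exact this v u (le_of_not_ge huv)
  -- The cutoff has slope `1 / (n + 1)` and multiplies the smaller modulus, which is at most `n + 1`
  -- in the second case. This contributes Lipschitz constant 1, and the term with `u - v` another 1,
  -- uniformly in `n`.
  rcases le_total ((n : ℝ) + 1) ‖u‖ with h | h
  · rw [truncId, truncId, cutoff_eq_zero h, cutoff_eq_zero (h.trans huv)]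
    simp
  · have e : truncId n u - truncId n v =
        ((cutoff n u - cutoff n v : ℝ) : ℂ) * u + (cutoff n v : ℂ) * (u - v) := by
      simp only [truncId, Complex.ofReal_sub]; ring
    have h1 : ‖((cutoff n u - cutoff n v : ℝ) : ℂ) * u‖ ≤ ‖u - v‖ := by
      rw [norm_mul, Complex.norm_real, Real.norm_eq_abs]
      refine (mul_le_mul (abs_cutoff_sub_le n u v) h (norm_nonneg _) (by positivity)).trans
        (le_of_eq ?_)
      field_simp
    have h2 : ‖(cutoff n v : ℂ) * (u - v)‖ ≤ ‖u - v‖ := by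
      rw [norm_mul]
      exact mul_le_of_le_one_left (norm_nonneg _) (norm_cutoff_le n v)
    rw [e]
    linarith [norm_add_le (((cutoff n u - cutoff n v : ℝ) : ℂ) * u) ((cutoff n v : ℂ) * (u - v))]

/-! ### Commutators with multiplication operators -/

/-- Sum of the moduli of the components. -/
def absSum {m : ℕ} (f : ℂ → Fin (m + 1) → ℂ) (u : ℂ) : ℝ := ∑ a, ‖f u a‖

theorem absSum_nonneg {m : ℕ} (f : ℂ → Fin (m + 1) → ℂ) (u : ℂ) : 0 ≤ absSum f u :=
  Finset.sum_nonneg fun _ _ => norm_nonneg _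

theorem norm_sum_mul_le {m : ℕ} (f g : ℂ → Fin (m + 1) → ℂ) (u v : ℂ) :
    ‖∑ a, f u a * g v a‖ ≤ absSum f u * absSum g v := by
  refine (norm_sum_le _ _).trans ?_
  rw [absSum, absSum, Finset.sum_mul]
  refine Finset.sum_le_sum fun a _ => ?_
  rw [norm_mul]
  exact mul_le_mul_of_nonneg_left
    (Finset.single_le_sum (f := fun a => ‖g v a‖) (fun _ _ => norm_nonneg _) (Finset.mem_univ a))
    (norm_nonneg _)

variable {m : ℕ} {Ω : Support}

theorem memLp_absSum {f : ℂ → Fin (m + 1) → ℂ}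
    (hf : ∀ a, MemLp (fun u => f u a) 2 Ω.absMeasure) : MemLp (absSum f) 2 Ω.absMeasure :=
  memLp_finsetSum Finset.univ fun a _ => (hf a).norm

theorem aestronglyMeasurable_sum_mul {g : ℂ → Fin (m + 1) → ℂ}
    (hg : ∀ a, MemLp (fun u => g u a) 2 Ω.absMeasure) (w : Fin (m + 1) → ℂ) :
    AEStronglyMeasurable (fun v => ∑ a, w a * g v a) Ω.absMeasure :=
  Finset.aestronglyMeasurable_fun_sum _ fun a _ => (hg a).1.const_mul _

theorem measurableSet_dist_ge (u : ℂ) (ε : ℝ) : MeasurableSet {v : ℂ | ε ≤ dist u v} :=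
  measurableSet_le measurable_const (measurable_const.dist measurable_id)

/-- The difference quotient of a Lipschitz function. -/
theorem norm_diffQuot_le {θ : ℂ → ℂ} {K : ℝ} (hK : 0 ≤ K)
    (hL : ∀ u v, ‖θ u - θ v‖ ≤ K * ‖u - v‖) (u v : ℂ) : ‖(θ u - θ v) / (u - v)‖ ≤ K := by
  rw [norm_div]
  exact div_le_of_le_mul₀ (norm_nonneg _) hK (hL u v)

/-- As `ε → 0` the truncations exhaust everything except the point `u` itself, which may be an atom.
The condition `φ u = 0` removes its contribution. -/
theorem tendsto_setIntegral_dist_ge {φ : ℂ → ℂ} {u : ℂ} (hφ : Integrable φ Ω.absMeasure)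
    (h0 : φ u = 0) :
    Tendsto (fun ε : ℝ => ∫ v in {v | ε ≤ dist u v}, φ v ∂Ω.absMeasure) (𝓝[>] 0)
      (𝓝 (∫ v, φ v ∂Ω.absMeasure)) := by
  simp_rw [← integral_indicator (measurableSet_dist_ge u _)]
  refine tendsto_integral_filter_of_dominated_convergence _
    (Eventually.of_forall fun ε => (hφ.indicator (measurableSet_dist_ge u ε)).1)
    (Eventually.of_forall fun ε => ae_of_all _ fun v => norm_indicator_le_norm_self _ _)
    hφ.norm (ae_of_all _ fun v => ?_)
  rcases eq_or_ne u v with rfl | huv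
  · have : ∀ ε : ℝ, Set.indicator {v | ε ≤ dist u v} φ u = 0 := fun ε => by
      by_cases hm : u ∈ {v : ℂ | ε ≤ dist u v}
      · rw [Set.indicator_of_mem hm, h0]
      · rw [Set.indicator_of_notMem hm]
    simp only [this, h0]
    exact tendsto_const_nhds
  · refine tendsto_const_nhds.congr' ?_
    filter_upwards [Ioo_mem_nhdsGT (dist_pos.2 huv)] with ε hε
    rw [Set.indicator_of_mem (show v ∈ {v | ε ≤ dist u v} from hε.2.le)]

theorem integrableOn_iiksKernel {f g : ℂ → Fin (m + 1) → ℂ}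
    (hg : ∀ a, MemLp (fun u => g u a) 2 Ω.absMeasure) {ε : ℝ} (hε : 0 < ε) (u : ℂ) (h : Ω.L2) :
    IntegrableOn (fun v => iiksKernel f g u v * h v * Ω.direction v) {v | ε ≤ dist u v}
      Ω.absMeasure := by
  have hms := measurableSet_dist_ge u ε
  have hkm : AEStronglyMeasurable (fun v => Set.indicator {v | ε ≤ dist u v}
      (fun v => (∑ a, f u a * g v a) / (u - v)) v) Ω.absMeasure := by
    refine AEStronglyMeasurable.indicator ?_ hms
    simp_rw [div_eq_mul_inv]
    exact (aestronglyMeasurable_sum_mul hg (f u)).mul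
      (measurable_const.sub measurable_id).inv.aestronglyMeasurable
  have := integrable_kernel_mul hkm (memLp_absSum hg) (C := absSum f u / ε) (ae_of_all _ fun v => by
    by_cases hm : v ∈ {v : ℂ | ε ≤ dist u v}
    · rw [Set.indicator_of_mem hm, norm_div, div_mul_eq_mul_div]
      have : ε ≤ ‖u - v‖ := by rw [← dist_eq_norm]; exact hm
      exact div_le_div₀ (mul_nonneg (absSum_nonneg f u) (absSum_nonneg g v))
        (norm_sum_mul_le f g u v) hε this
    · rw [Set.indicator_of_notMem hm, norm_zero]
      exact mul_nonneg (div_nonneg (absSum_nonneg f u) hε.le) (absSum_nonneg g v)) h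
  refine (this.restrict (s := {v | ε ≤ dist u v})).congr ?_
  filter_upwards [ae_restrict_mem hms] with v hv
  have hne : u ≠ v := by
    rintro rfl
    exact absurd hv (by simpa using hε)
  rw [Set.indicator_of_mem (show v ∈ {v | ε ≤ dist u v} from hv), iiksKernel, if_neg hne]

/-- Both principal values use the same truncation. Before the limit, their difference has the kernel
multiplied by `θ u - θ v`, which cancels the singularity for Lipschitz `θ`; the limit is an
absolutely convergent integral. -/
theorem IsIntegralOperator.commutator {f g : ℂ → Fin (m + 1) → ℂ}
    (hg : ∀ a, MemLp (fun u => g u a) 2 Ω.absMeasure) {T : Ω.L2 →L[ℂ] Ω.L2}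
    (hT : IsIntegralOperator Ω T (iiksKernel f g)) {θ : ℂ → ℂ} (hθ : MemLp θ ⊤ Ω.absMeasure)
    (hθm : Measurable θ) {K : ℝ} (hK : 0 ≤ K) (hL : ∀ u v, ‖θ u - θ v‖ ≤ K * ‖u - v‖) (h : Ω.L2) :
    ∀ᵐ u ∂Ω.absMeasure, θ u * T h u - T (mulL2 Ω θ hθ h) u =
      ∫ v, (∑ a, f u a * g v a) * ((θ u - θ v) / (u - v)) * h v * Ω.direction v ∂Ω.absMeasure := by
  filter_upwards [hT h, hT (mulL2 Ω θ hθ h)] with u h1 h2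
  have hG := memLp_absSum hg
  have hk : AEStronglyMeasurable (fun v => (∑ a, f u a * g v a) * ((θ u - θ v) / (u - v)))
      Ω.absMeasure := (aestronglyMeasurable_sum_mul hg (f u)).mul
        ((measurable_const.sub hθm).div (measurable_const.sub measurable_id)).aestronglyMeasurable
  have hkb : ∀ᵐ v ∂Ω.absMeasure, ‖(∑ a, f u a * g v a) * ((θ u - θ v) / (u - v))‖ ≤
      (absSum f u * K) * absSum g v := ae_of_all _ fun v => by
    rw [norm_mul]
    refine (mul_le_mul (norm_sum_mul_le f g u v) (norm_diffQuot_le hK hL u v) (norm_nonneg _)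
      (mul_nonneg (absSum_nonneg f u) (absSum_nonneg g v))).trans (le_of_eq (by ring))
  have hint := integrable_kernel_mul hk hG hkb h
  refine tendsto_nhds_unique ((h1.const_mul (θ u)).sub h2) ?_
  have hlim := tendsto_setIntegral_dist_ge (u := u) hint (by simp)
  refine hlim.congr' ?_
  filter_upwards [self_mem_nhdsWithin] with ε hε
  have hεpos : (0 : ℝ) < ε := hε
  have hms := measurableSet_dist_ge u ε
  have hik := fun h' : Ω.L2 => integrableOn_iiksKernel (f := f) hg hεpos u h'
  simp only [Support.integralOn]
  rw [← integral_const_mul, ← integral_sub ((hik h).const_mul _) (hik _)]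
  refine integral_congr_ae ?_
  filter_upwards [ae_restrict_of_ae (mulL2_coeFn Ω hθ h), ae_restrict_mem hms] with v hv hvm
  have hne : u ≠ v := by
    rintro rfl
    exact absurd hvm (by simpa using hεpos)
  rw [hv, iiksKernel, if_neg hne]
  have := sub_ne_zero.2 hne
  field_simp

theorem pairing_mulL2 {θ : ℂ → ℂ} (hθ : MemLp θ ⊤ Ω.absMeasure) (φ ψ : Ω.L2) :
    pairing Ω (mulL2 Ω θ hθ φ) ψ = pairing Ω φ (mulL2 Ω θ hθ ψ) := by
  rw [pairing_apply, pairing_apply]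
  refine integral_congr_ae' Ω ?_
  filter_upwards [mulL2_coeFn Ω hθ φ, mulL2_coeFn Ω hθ ψ] with u h1 h2
  rw [h1, h2]; ring

theorem inverse_apply_self {T : Ω.L2 →L[ℂ] Ω.L2} (hu : IsUnit T) (h : Ω.L2) :
    Ring.inverse T (T h) = h :=
  congrArg (fun A : Ω.L2 →L[ℂ] Ω.L2 => A h) (Ring.inverse_mul_cancel T hu)

theorem self_apply_inverse {T : Ω.L2 →L[ℂ] Ω.L2} (hu : IsUnit T) (h : Ω.L2) :
    T (Ring.inverse T h) = h :=
  congrArg (fun A : Ω.L2 →L[ℂ] Ω.L2 => A h) (Ring.mul_inverse_cancel T hu)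

theorem cutoff_memLp (n : ℕ) : MemLp (fun u => (cutoff n u : ℂ)) ⊤ Ω.absMeasure :=
  memLp_top_of_bounded Ω
    (Complex.continuous_ofReal.comp (continuous_cutoff n)).measurable.aestronglyMeasurable
    (ae_of_all _ (norm_cutoff_le n))

theorem truncId_memLp (n : ℕ) : MemLp (truncId n) ⊤ Ω.absMeasure :=
  memLp_top_of_bounded Ω (continuous_truncId n).measurable.aestronglyMeasurable
    (ae_of_all _ (norm_truncId_le' n))

end CubicKP

namespace CubicKP

variable {m : ℕ} {Ω : Support}

/-! ### Multiplication by the spectral variable and the resolvent -/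

/-- `[z, (1 - T)⁻¹] = ∑_c (1 - T)⁻¹ f_c ⊗ (1 - Tᵀ)⁻¹ g_c`, paired with square integrable functions
of finite first moment. -/
theorem IsIntegralOperator.pairing_inverse_mul_id {f g : ℂ → Fin (m + 1) → ℂ}
    (hf : ∀ a, MemLp (fun u => f u a) 2 Ω.absMeasure)
    (hg : ∀ a, MemLp (fun u => g u a) 2 Ω.absMeasure)
    (horth : ∀ u ∈ Ω.carrier, ∀ a, f u a * g u a = 0) {T : Ω.L2 →L[ℂ] Ω.L2}
    (hT : IsIntegralOperator Ω T (iiksKernel f g)) (hu : IsUnit (1 - T)) {φ ψ : ℂ → ℂ}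
    (hφ : MemLp φ 2 Ω.absMeasure) (hφ' : MemLp (fun u => u * φ u) 2 Ω.absMeasure)
    (hψ : MemLp ψ 2 Ω.absMeasure) (hψ' : MemLp (fun u => u * ψ u) 2 Ω.absMeasure) :
    pairing Ω (Ring.inverse (1 - T) (Ω.toL2 φ)) (Ω.toL2 fun u => u * ψ u) =
      pairing Ω (Ring.inverse (1 - T) (Ω.toL2 fun u => u * φ u)) (Ω.toL2 ψ) +
      ∑ c, pairing Ω (Ring.inverse (1 - T) (Ω.toL2 φ)) (Ω.toL2 fun u => g u c) *
        pairing Ω (Ring.inverse (1 - T) (Ω.toL2 fun u => f u c)) (Ω.toL2 ψ) := by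
  set R := Ring.inverse (1 - T) with hR
  set h := R (Ω.toL2 φ) with hh
  -- Bounded substitutes for `z h`, which is not known to be square integrable; their convergence in
  -- `L²` is part of what is proved below.
  let w : ℕ → Ω.L2 := fun n => mulL2 Ω (truncId n) (truncId_memLp n) h
  have hF := memLp_absSum hf
  have hG := memLp_absSum hg
  let J : ℝ := ∫ v, absSum g v * ‖h v‖ ∂Ω.absMeasure
  have hhφ : ∀ᵐ u ∂Ω.absMeasure, h u - T h u = φ u := by
    have : h - T h = Ω.toL2 φ := self_apply_inverse hu (Ω.toL2 φ)
    filter_upwards [Lp.coeFn_sub h (T h), toL2_coeFn hφ] with u h1 h2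
    rw [← h2, ← this, h1, Pi.sub_apply]
  have hval : ∀ n, ∀ᵐ u ∂Ω.absMeasure, ((1 - T) (w n)) u = truncId n u * φ u +
      ∫ v, (∑ a, f u a * g v a) * ((truncId n u - truncId n v) / (u - v)) * h v *
        Ω.direction v ∂Ω.absMeasure := fun n => by
    filter_upwards [hT.commutator hg (truncId_memLp n) (continuous_truncId n).measurable
      zero_le_two (norm_truncId_sub_le n) h, Lp.coeFn_sub (w n) (T (w n)),
      mulL2_coeFn Ω (truncId_memLp n) h, hhφ] with u h1 h2 h3 h4
    have : ((1 - T) (w n)) u = (w n) u - (T (w n)) u := h2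
    rw [this, ← h1, ← h4, show (w n) u = truncId n u * h u from h3]
    ring
  have hkb : ∀ (n : ℕ) (u v : ℂ), ‖(∑ a, f u a * g v a) *
      ((truncId n u - truncId n v) / (u - v))‖ ≤ (absSum f u * 2) * absSum g v := fun n u v => by
    rw [norm_mul]
    exact (mul_le_mul (norm_sum_mul_le f g u v)
      (norm_diffQuot_le zero_le_two (norm_truncId_sub_le n) u v) (norm_nonneg _)
      (mul_nonneg (absSum_nonneg f u) (absSum_nonneg g v))).trans (le_of_eq (by ring))
  have hkm : ∀ (n : ℕ) (u : ℂ), AEStronglyMeasurable (fun v => (∑ a, f u a * g v a) *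
      ((truncId n u - truncId n v) / (u - v))) Ω.absMeasure := fun n u =>
    (aestronglyMeasurable_sum_mul hg (f u)).mul ((measurable_const.sub
      (continuous_truncId n).measurable).div
        (measurable_const.sub measurable_id)).aestronglyMeasurable
  -- The expected value of `(1 - T)(z h)`, namely `z φ + [z, T] h`.
  let lim : Ω.L2 := Ω.toL2 (fun u => u * φ u) +
    ∑ a, pairing Ω h (Ω.toL2 fun u => g u a) • Ω.toL2 fun u => f u a
  have hlimval : ∀ᵐ u ∂Ω.absMeasure, lim u = u * φ u +
      ∫ v, (∑ a, f u a * g v a) * h v * Ω.direction v ∂Ω.absMeasure := by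
    have hsum : ∀ᵐ u ∂Ω.absMeasure, (∑ a, pairing Ω h (Ω.toL2 fun u => g u a) •
        Ω.toL2 fun u => f u a : Ω.L2) u = ∑ a, pairing Ω h (Ω.toL2 fun u => g u a) * f u a := by
      have h1 : ∀ a, ∀ᵐ u ∂Ω.absMeasure, (pairing Ω h (Ω.toL2 fun u => g u a) •
          Ω.toL2 fun u => f u a : Ω.L2) u = pairing Ω h (Ω.toL2 fun u => g u a) * f u a :=
        fun a => by
        filter_upwards [Lp.coeFn_smul (pairing Ω h (Ω.toL2 fun u => g u a))
          (Ω.toL2 fun u => f u a), toL2_coeFn (hf a)] with u h1 h2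
        rw [h1, Pi.smul_apply, h2, smul_eq_mul]
      filter_upwards [Lp.coeFn_finsetSum Finset.univ fun a =>
        (pairing Ω h (Ω.toL2 fun u => g u a) • Ω.toL2 fun u => f u a : Ω.L2),
        ae_all_iff.2 h1] with u h2 h3
      rw [h2, Finset.sum_apply]
      exact Finset.sum_congr rfl fun a _ => h3 a
    have hp : ∀ a, pairing Ω h (Ω.toL2 fun u => g u a) =
        ∫ v, g v a * h v * Ω.direction v ∂Ω.absMeasure := fun a => by
      rw [pairing_apply, Support.integral, Support.integralOn, Measure.restrict_univ]
      refine integral_congr_ae ?_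
      filter_upwards [toL2_coeFn (hg a)] with v hv
      rw [hv]; ring
    have hia : ∀ a, Integrable (fun v => g v a * h v * Ω.direction v) Ω.absMeasure := fun a =>
      integrable_kernel_mul (hg a).1 (hg a).norm (C := 1) (ae_of_all _ fun v => by simp) h
    filter_upwards [Lp.coeFn_add (Ω.toL2 fun u => u * φ u)
      (∑ a, pairing Ω h (Ω.toL2 fun u => g u a) • Ω.toL2 fun u => f u a), hsum,
      toL2_coeFn hφ'] with u h1 h2 h3
    rw [h1, Pi.add_apply, h2, h3]
    congr 1
    simp_rw [Finset.sum_mul]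
    rw [integral_finsetSum _ fun a _ => by
      simpa only [mul_assoc] using (hia a).const_mul (f u a)]
    refine Finset.sum_congr rfl fun a _ => ?_
    rw [hp, mul_comm, ← integral_const_mul]
    simp only [mul_assoc]
  have hconv : Tendsto (fun n => (1 - T) (w n)) atTop (𝓝 lim) := by
    refine tendsto_L2_of_dominated (E := fun u => ‖u * φ u‖ + 2 * J * absSum f u)
      (hφ'.norm.add (hF.const_mul (2 * J))) (fun n => ?_) ?_
    · filter_upwards [hval n] with u hu
      rw [hu]
      refine (norm_add_le _ _).trans (add_le_add ?_ ?_)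
      · rw [norm_mul, norm_mul]
        exact mul_le_mul_of_nonneg_right (norm_truncId_le n u) (norm_nonneg _)
      · refine (norm_kernel_integral_le hG (ae_of_all _ (hkb n u)) h).trans (le_of_eq ?_)
        ring
    · filter_upwards [ae_all_iff.2 hval, hlimval, Ω.ae_mem_carrier] with u h1 h2 hcu
      simp only [h1, h2]
      refine ((tendsto_truncId u).mul_const _).add ?_
      have hbi : Integrable (fun v => absSum f u * 2 * (absSum g v * ‖h v‖)) Ω.absMeasure :=
        (hG.integrable_mul (Lp.memLp h).norm).const_mul _
      refine tendsto_integral_filter_of_dominated_convergence _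
        (Eventually.of_forall fun n => (integrable_kernel_mul (hkm n u) hG
          (ae_of_all _ (hkb n u)) h).1) (Eventually.of_forall fun n => ae_of_all _ fun v => ?_)
        hbi (ae_of_all _ fun v => ?_)
      · rw [norm_mul, norm_mul, ← mul_assoc (absSum f u * 2)]
        exact (mul_le_of_le_one_right (by positivity) (Ω.norm_direction_le v)).trans
          (mul_le_mul_of_nonneg_right (hkb n u v) (norm_nonneg _))
      -- On the diagonal the difference quotient is `0 / 0 = 0` and does not tend to `1`.
      -- Orthogonality of `f` and `g` makes the kernel vanish there, which matters when `u` is an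
      -- atom.
      · rcases eq_or_ne u v with rfl | huv
        · have : ∑ a, f u a * g u a = 0 := Finset.sum_eq_zero fun a _ => horth u hcu a
          simp only [this, zero_mul]
          exact tendsto_const_nhds
        · have hne := sub_ne_zero.2 huv
          have := ((((tendsto_truncId u).sub (tendsto_truncId v)).div_const (u - v)).const_mul
            (∑ a, f u a * g v a)).mul_const (h v) |>.mul_const (Ω.direction v)
          rwa [div_self hne, mul_one] at this
  have hw : Tendsto w atTop (𝓝 (R lim)) := by
    have := (R.continuous.tendsto lim).comp hconv
    refine this.congr fun n => ?_
    exact inverse_apply_self hu (w n)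
  have hw1 : Tendsto (fun n => pairing Ω (w n) (Ω.toL2 ψ)) atTop
      (𝓝 (pairing Ω (R lim) (Ω.toL2 ψ))) :=
    (((pairing Ω).flip (Ω.toL2 ψ)).continuous.tendsto _).comp hw
  have hψc : Tendsto (fun n => mulL2 Ω (truncId n) (truncId_memLp n) (Ω.toL2 ψ)) atTop
      (𝓝 (Ω.toL2 fun u => u * ψ u)) := by
    refine tendsto_L2_of_dominated hψ'.norm (fun n => ?_) ?_
    · filter_upwards [mulL2_coeFn Ω (truncId_memLp n) (Ω.toL2 ψ), toL2_coeFn hψ] with u h1 h2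
      rw [h1, h2, norm_mul, norm_mul]
      exact mul_le_mul_of_nonneg_right (norm_truncId_le n u) (norm_nonneg _)
    · filter_upwards [ae_all_iff.2 fun n => mulL2_coeFn Ω (truncId_memLp n) (Ω.toL2 ψ),
        toL2_coeFn hψ, toL2_coeFn hψ'] with u h1 h2 h3
      simp only [h1, h2, h3]
      exact (tendsto_truncId u).mul_const _
  have hw2 : Tendsto (fun n => pairing Ω (w n) (Ω.toL2 ψ)) atTop
      (𝓝 (pairing Ω h (Ω.toL2 fun u => u * ψ u))) := by
    refine (((pairing Ω h).continuous.tendsto _).comp hψc).congr fun n => ?_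
    exact (pairing_mulL2 _ _ _).symm
  -- The truncated multiplication is moved across the symmetric pairing, so `pairing (w n) ψ` has
  -- two limits; equating them is the claim.
  rw [tendsto_nhds_unique hw2 hw1]
  simp [lim]

/-! ### Independence of the scalar factor -/

/-- Changing the scalar factor by a measurable, locally bounded function does not change `Φ₁`. -/
theorem pairing_inverse_gauge {f g f₀ g₀ : ℂ → Fin (m + 1) → ℂ}
    (hf : ∀ a, MemLp (fun u => f u a) 2 Ω.absMeasure)
    (hg : ∀ a, MemLp (fun u => g u a) 2 Ω.absMeasure)
    (hf₀ : ∀ a, MemLp (fun u => f₀ u a) 2 Ω.absMeasure)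
    (hg₀ : ∀ a, MemLp (fun u => g₀ u a) 2 Ω.absMeasure)
    {T T₀ : Ω.L2 →L[ℂ] Ω.L2} (hT : IsIntegralOperator Ω T (iiksKernel f g))
    (hT₀ : IsIntegralOperator Ω T₀ (iiksKernel f₀ g₀)) (hu : IsUnit (1 - T))
    (hu₀ : IsUnit (1 - T₀)) {s : ℂ → ℂ} (hs : AEStronglyMeasurable s Ω.absMeasure)
    (hsb : ∀ R : ℝ, ∃ B : ℝ, ∀ u ∈ Ω.carrier, ‖u‖ ≤ R → ‖s u‖ ≤ B)
    (hsf : ∀ u ∈ Ω.carrier, ∀ a, f₀ u a = s u * f u a)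
    (hsg : ∀ u ∈ Ω.carrier, ∀ a, g u a = s u * g₀ u a) (a b : Fin (m + 1)) :
    pairing Ω (Ring.inverse (1 - T) (Ω.toL2 fun u => f u a)) (Ω.toL2 fun u => g u b) =
      pairing Ω (Ring.inverse (1 - T₀) (Ω.toL2 fun u => f₀ u a)) (Ω.toL2 fun u => g₀ u b) := by
  set R := Ring.inverse (1 - T) with hR
  set R₀ := Ring.inverse (1 - T₀) with hR₀
  set h := R (Ω.toL2 fun u => f u a) with hh
  have hG := memLp_absSum hg
  let J : ℝ := ∫ v, absSum g v * ‖h v‖ ∂Ω.absMeasure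
  have hJ : 0 ≤ J := integral_nonneg fun v => mul_nonneg (absSum_nonneg g v) (norm_nonneg _)
  -- The factor `s` is bounded only on bounded sets, hence the product with a compactly supported
  -- cutoff.
  have hsχ : ∀ n, MemLp (fun u => s u * cutoff n u) ⊤ Ω.absMeasure := fun n => by
    obtain ⟨B, hB⟩ := hsb (n + 1)
    refine memLp_top_of_bounded Ω (C := max B 0) (hs.mul (Complex.continuous_ofReal.comp
      (continuous_cutoff n)).measurable.aestronglyMeasurable) ?_
    filter_upwards [Ω.ae_mem_carrier] with u hcu
    rcases le_total ‖u‖ (n + 1) with hle | hle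
    · rw [norm_mul]
      exact (mul_le_of_le_one_right (norm_nonneg _) (norm_cutoff_le n u)).trans
        ((hB u hcu hle).trans (le_max_left _ _))
    · rw [cutoff_eq_zero hle]; simp
  let w : ℕ → Ω.L2 := fun n => mulL2 Ω _ (hsχ n) h
  let χh : ℕ → Ω.L2 := fun n => mulL2 Ω _ (cutoff_memLp n) h
  have hhf : ∀ᵐ u ∂Ω.absMeasure, h u - T h u = f u a := by
    have : h - T h = Ω.toL2 fun u => f u a := self_apply_inverse hu (Ω.toL2 fun u => f u a)
    filter_upwards [Lp.coeFn_sub h (T h), toL2_coeFn (hf a)] with u h1 h2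
    rw [← h2, ← this, h1, Pi.sub_apply]
  -- Formally `T₀ = s T s⁻¹`. The identity is exact for each truncated integral, and `s⁻¹` is
  -- avoided by applying it to `s χ h`.
  have hTw : ∀ n, ∀ᵐ u ∂Ω.absMeasure, T₀ (w n) u = s u * T (χh n) u := fun n => by
    filter_upwards [hT₀ (w n), hT (χh n), Ω.ae_mem_carrier] with u h1 h2 hcu
    refine tendsto_nhds_unique h1 ((h2.const_mul (s u)).congr fun ε => ?_)
    simp only [Support.integralOn]
    rw [← integral_const_mul]
    refine integral_congr_ae (ae_restrict_of_ae ?_)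
    filter_upwards [mulL2_coeFn Ω (hsχ n) h, mulL2_coeFn Ω (cutoff_memLp n) h,
      Ω.ae_mem_carrier] with v h3 h4 hcv
    rw [show (w n) v = _ from h3, show (χh n) v = _ from h4, iiksKernel, iiksKernel]
    split_ifs with huv
    · simp
    · have : (∑ a, f₀ u a * g₀ v a) * s v = s u * ∑ a, f u a * g v a := by
        rw [Finset.sum_mul, Finset.mul_sum]
        refine Finset.sum_congr rfl fun c _ => ?_
        rw [hsf u hcu, hsg v hcv]; ring
      calc _ = s u * (∑ a, f u a * g v a) * (cutoff n v * h v * Ω.direction v / (u - v)) := by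
            ring
        _ = (∑ a, f₀ u a * g₀ v a) * s v * (cutoff n v * h v * Ω.direction v / (u - v)) := by
            rw [this]
        _ = _ := by ring
  have hlip : ∀ (n : ℕ) (u v : ℂ), ‖(cutoff n u : ℂ) - cutoff n v‖ ≤ 1 / (n + 1) * ‖u - v‖ :=
    fun n u v => by
    rw [← Complex.ofReal_sub, Complex.norm_real]
    exact abs_cutoff_sub_le n u v
  -- Here `(1 - T₀)(s χ h) = χ f₀ + s [χ, T] h`. The outer `s` turns `f` into `f₀`, so no bound on
  -- `s` is needed, and the slope of the cutoff makes the commutator `O(1/(n+1))`.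
  have hbd : ∀ n, ∀ᵐ u ∂Ω.absMeasure, ‖((1 - T₀) (w n)) u - cutoff n u * f₀ u a‖ ≤
      1 / ((n : ℝ) + 1) * (J * absSum f₀ u) := fun n => by
    have hn : (0 : ℝ) ≤ 1 / (n + 1) := by positivity
    filter_upwards [hT.commutator hg (cutoff_memLp n)
      (Complex.continuous_ofReal.comp (continuous_cutoff n)).measurable hn (hlip n) h,
      Lp.coeFn_sub (w n) (T₀ (w n)), mulL2_coeFn Ω (hsχ n) h, hhf, hTw n,
      Ω.ae_mem_carrier] with u h1 h2 h3 h4 h5 hcu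
    have e1 : ((1 - T₀) (w n)) u = (w n) u - (T₀ (w n)) u := h2
    have e2 : ((1 - T₀) (w n)) u - cutoff n u * f₀ u a =
        ∫ v, (∑ a, f₀ u a * g v a) * (((cutoff n u : ℂ) - cutoff n v) / (u - v)) * h v *
          Ω.direction v ∂Ω.absMeasure := by
      have e3 : s u * (∫ v, (∑ a, f u a * g v a) * (((cutoff n u : ℂ) - cutoff n v) / (u - v)) *
          h v * Ω.direction v ∂Ω.absMeasure) = ∫ v, (∑ a, f₀ u a * g v a) *
          (((cutoff n u : ℂ) - cutoff n v) / (u - v)) * h v * Ω.direction v ∂Ω.absMeasure := by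
        rw [← integral_const_mul]
        refine integral_congr_ae (ae_of_all _ fun v => ?_)
        have : ∑ a, f₀ u a * g v a = s u * ∑ a, f u a * g v a := by
          rw [Finset.mul_sum]
          exact Finset.sum_congr rfl fun c _ => by rw [hsf u hcu]; ring
        simp only [this]
        ring
      rw [← e3, ← h1, e1, h5, hsf u hcu, ← h4, show (w n) u = _ from h3]
      simp only [χh]
      ring
    rw [e2]
    refine (norm_kernel_integral_le hG (C := 1 / ((n : ℝ) + 1) * absSum f₀ u)
      (ae_of_all _ fun v => ?_) h).trans (le_of_eq (by ring))
    rw [norm_mul]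
    exact (mul_le_mul (norm_sum_mul_le f₀ g u v) (norm_diffQuot_le hn (hlip n) u v)
      (norm_nonneg _) (mul_nonneg (absSum_nonneg f₀ u) (absSum_nonneg g v))).trans
      (le_of_eq (by ring))
  have hconv : Tendsto (fun n => (1 - T₀) (w n)) atTop (𝓝 (Ω.toL2 fun u => f₀ u a)) := by
    refine tendsto_L2_of_dominated (E := fun u => ‖f₀ u a‖ + J * absSum f₀ u)
      ((hf₀ a).norm.add ((memLp_absSum hf₀).const_mul J)) (fun n => ?_) ?_
    · filter_upwards [hbd n] with u hu
      have h1 : ‖(cutoff n u : ℂ) * f₀ u a‖ ≤ ‖f₀ u a‖ := by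
        rw [norm_mul]
        exact mul_le_of_le_one_left (norm_nonneg _) (norm_cutoff_le n u)
      have h2 : 1 / ((n : ℝ) + 1) * (J * absSum f₀ u) ≤ J * absSum f₀ u :=
        mul_le_of_le_one_left (mul_nonneg hJ (absSum_nonneg _ _))
          ((div_le_one (by positivity)).2 (by linarith [(Nat.cast_nonneg n : (0 : ℝ) ≤ n)]))
      have h3 := norm_add_le (((1 - T₀) (w n)) u - cutoff n u * f₀ u a) (cutoff n u * f₀ u a)
      rw [sub_add_cancel] at h3
      linarith
    · filter_upwards [ae_all_iff.2 hbd, toL2_coeFn (hf₀ a)] with u h1 h2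
      rw [h2]
      have h3 : Tendsto (fun n => ((1 - T₀) (w n)) u - cutoff n u * f₀ u a) atTop (𝓝 0) := by
        refine squeeze_zero_norm h1 ?_
        simpa using (tendsto_one_div_add_atTop_nhds_zero_nat (𝕜 := ℝ)).mul_const (J * absSum f₀ u)
      simpa using h3.add ((tendsto_cutoff u).mul_const (f₀ u a))
  have hw : Tendsto w atTop (𝓝 (R₀ (Ω.toL2 fun u => f₀ u a))) := by
    refine ((R₀.continuous.tendsto _).comp hconv).congr fun n => ?_
    exact inverse_apply_self hu₀ (w n)
  have hw1 : Tendsto (fun n => pairing Ω (w n) (Ω.toL2 fun u => g₀ u b)) atTop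
      (𝓝 (pairing Ω (R₀ (Ω.toL2 fun u => f₀ u a)) (Ω.toL2 fun u => g₀ u b))) :=
    (((pairing Ω).flip (Ω.toL2 fun u => g₀ u b)).continuous.tendsto _).comp hw
  have hgc : Tendsto (fun n => mulL2 Ω _ (cutoff_memLp n) (Ω.toL2 fun u => g u b)) atTop
      (𝓝 (Ω.toL2 fun u => g u b)) := by
    refine tendsto_L2_of_dominated (hg b).norm (fun n => ?_) ?_
    · filter_upwards [mulL2_coeFn Ω (cutoff_memLp n) (Ω.toL2 fun u => g u b),
        toL2_coeFn (hg b)] with u h1 h2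
      rw [h1, h2, norm_mul]
      exact mul_le_of_le_one_left (norm_nonneg _) (norm_cutoff_le n u)
    · filter_upwards [ae_all_iff.2 fun n => mulL2_coeFn Ω (cutoff_memLp n)
        (Ω.toL2 fun u => g u b)] with u h1
      simp only [h1]
      simpa using (tendsto_cutoff u).mul_const ((Ω.toL2 fun u => g u b) u)
  have hw2 : Tendsto (fun n => pairing Ω (w n) (Ω.toL2 fun u => g₀ u b)) atTop
      (𝓝 (pairing Ω h (Ω.toL2 fun u => g u b))) := by
    refine (((pairing Ω h).continuous.tendsto _).comp hgc).congr fun n => ?_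
    rw [Function.comp_apply, pairing_apply, pairing_apply]
    refine integral_congr_ae' Ω ?_
    filter_upwards [mulL2_coeFn Ω (cutoff_memLp n) (Ω.toL2 fun u => g u b),
      mulL2_coeFn Ω (hsχ n) h, toL2_coeFn (hg b), toL2_coeFn (hg₀ b),
      Ω.ae_mem_carrier] with u h1 h2 h3 h4 hcu
    rw [h1, show (w n) u = _ from h2, h3, h4, hsg u hcu]
    ring
  exact tendsto_nhds_unique hw2 hw1

end CubicKP

namespace CubicKP

/-! ### The cubic phase -/

/-- The exponent `t_k z³ + y_k z² + x_k z`. -/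
def phase {m : ℕ} (p : Params m) (k : Fin m) (z : ℂ) : ℂ :=
  p.2.2 k * z ^ 3 + p.2.1 k * z ^ 2 + p.1 k * z

/-- The function `|Re z| + |Re z²| + |Re z³|`, which controls the growth of the exponentials. -/
def growth (z : ℂ) : ℝ := |z.re| + |(z ^ 2).re| + |(z ^ 3).re|

/-- The divided difference `(phase p k u - phase p k v) / (u - v)`. -/
def phaseQuot {m : ℕ} (p : Params m) (k : Fin m) (u v : ℂ) : ℂ :=
  p.2.2 k * (u ^ 2 + u * v + v ^ 2) + p.2.1 k * (u + v) + p.1 k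

theorem growth_nonneg (z : ℂ) : 0 ≤ growth z := by unfold growth; positivity

theorem continuous_growth : Continuous growth := by unfold growth; fun_prop

/-- Where `|Im z|` is not controlled by `|Re z|`, the term `|Re z²|` is comparable with `|Im z|²`.
Exponential weights in `growth` therefore dominate all powers of `|z|`, also in vertical directions.
-/
theorem norm_le_growth (z : ℂ) : ‖z‖ ≤ 3 * growth z + 1 := by
  have h1 := Complex.norm_le_abs_re_add_abs_im z
  have h2 : |z.re| + |(z ^ 2).re| ≤ growth z := le_add_of_nonneg_right (abs_nonneg _)
  have h3 : (z ^ 2).re = z.re ^ 2 - z.im ^ 2 := by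
    rw [pow_two, Complex.mul_re]; ring
  rw [h3, ← sq_abs z.re, ← sq_abs z.im] at h2
  have h4 := neg_le_abs (|z.re| ^ 2 - |z.im| ^ 2)
  have ha := abs_nonneg z.re
  have hb := abs_nonneg z.im
  have hab := abs_nonneg (|z.re| ^ 2 - |z.im| ^ 2)
  rcases le_total |z.im| (2 * |z.re|) with h | h
  · linarith
  · nlinarith [sq_nonneg (|z.im| - 1)]

theorem phase_sub_phase {m : ℕ} (p : Params m) (k : Fin m) (u v : ℂ) :
    phase p k u - phase p k v = (u - v) * phaseQuot p k u v := by
  unfold phase phaseQuot; ring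

theorem phase_add {m : ℕ} (p δ : Params m) (k : Fin m) (u : ℂ) :
    phase (p + δ) k u = phase p k u + phase δ k u := by
  simp only [phase, Prod.fst_add, Prod.snd_add, Pi.add_apply, Complex.ofReal_add]
  ring

theorem continuous_phase {m : ℕ} (p : Params m) (k : Fin m) : Continuous (phase p k) := by
  unfold phase; fun_prop

theorem abs_coord_le {m : ℕ} (p : Params m) (k : Fin m) :
    |p.1 k| ≤ ‖p‖ ∧ |p.2.1 k| ≤ ‖p‖ ∧ |p.2.2 k| ≤ ‖p‖ :=
  ⟨(norm_le_pi_norm p.1 k).trans (norm_fst_le p),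
    (norm_le_pi_norm p.2.1 k).trans ((norm_fst_le p.2).trans (norm_snd_le p)),
    (norm_le_pi_norm p.2.2 k).trans ((norm_snd_le p.2).trans (norm_snd_le p))⟩

theorem norm_phaseQuot_le {m : ℕ} (p : Params m) (k : Fin m) (u v : ℂ) :
    ‖phaseQuot p k u v‖ ≤ ‖p‖ * ((1 + ‖u‖) ^ 2 * (1 + ‖v‖) ^ 2) := by
  obtain ⟨h1, h2, h3⟩ := abs_coord_le p k
  have hu := norm_nonneg u
  have hv := norm_nonneg v
  have e1 : ‖(p.2.2 k : ℂ) * (u ^ 2 + u * v + v ^ 2)‖ ≤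
      ‖p‖ * (‖u‖ ^ 2 + ‖u‖ * ‖v‖ + ‖v‖ ^ 2) := by
    rw [norm_mul, Complex.norm_real]
    refine mul_le_mul h3 ?_ (norm_nonneg _) (norm_nonneg _)
    refine (norm_add₃_le).trans ?_
    simp
  have e2 : ‖(p.2.1 k : ℂ) * (u + v)‖ ≤ ‖p‖ * (‖u‖ + ‖v‖) := by
    rw [norm_mul, Complex.norm_real]
    exact mul_le_mul h2 (norm_add_le _ _) (norm_nonneg _) (norm_nonneg _)
  have e3 : ‖(p.1 k : ℂ)‖ ≤ ‖p‖ := by rw [Complex.norm_real]; exact h1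
  refine (norm_add₃_le).trans ((add_le_add (add_le_add e1 e2) e3).trans ?_)
  rw [← mul_add, ← mul_add_one]
  refine mul_le_mul_of_nonneg_left ?_ (norm_nonneg p)
  have : 0 ≤ ‖u‖ * ‖v‖ := by positivity
  have h5 : 0 ≤ ‖u‖ * ‖v‖ * (‖u‖ + ‖v‖) := by positivity
  nlinarith [sq_nonneg (‖u‖ * ‖v‖)]

theorem norm_phase_le {m : ℕ} (p : Params m) (k : Fin m) (u : ℂ) :
    ‖phase p k u‖ ≤ ‖p‖ * (1 + ‖u‖) ^ 3 := by
  have h := phase_sub_phase p k u 0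
  have h0 : phase p k 0 = 0 := by simp [phase]
  rw [h0, sub_zero, sub_zero] at h
  rw [h, norm_mul]
  have h1 := norm_phaseQuot_le p k u 0
  simp only [norm_zero, add_zero, one_pow, mul_one] at h1
  have := mul_le_mul (show ‖u‖ ≤ 1 + ‖u‖ by linarith) h1 (norm_nonneg _) (by positivity)
  exact this.trans (le_of_eq (by ring))

theorem abs_re_phase_le {m : ℕ} (p : Params m) (k : Fin m) (u : ℂ) :
    |(phase p k u).re| ≤ ‖p‖ * growth u := by
  obtain ⟨h1, h2, h3⟩ := abs_coord_le p k
  have e : (phase p k u).re = p.2.2 k * (u ^ 3).re + p.2.1 k * (u ^ 2).re + p.1 k * u.re := by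
    simp [phase]
  rw [e]
  refine (abs_add_three _ _ _).trans ?_
  rw [abs_mul, abs_mul, abs_mul, growth]
  have a1 := mul_le_mul_of_nonneg_right h1 (abs_nonneg u.re)
  have a2 := mul_le_mul_of_nonneg_right h2 (abs_nonneg (u ^ 2).re)
  have a3 := mul_le_mul_of_nonneg_right h3 (abs_nonneg (u ^ 3).re)
  linarith

/-- Mean value inequality on the half plane `Re w ≤ |Re z|`. The exponent must involve only the real
part, since `growth` controls `Re (phase)` but not its modulus. -/
theorem norm_exp_sub_one_le' (z : ℂ) : ‖Complex.exp z - 1‖ ≤ ‖z‖ * Real.exp |z.re| := by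
  have hc : Convex ℝ {w : ℂ | w.re ≤ |z.re|} := convex_halfSpace_re_le _
  have := hc.norm_image_sub_le_of_norm_hasDerivWithin_le (f := Complex.exp) (f' := Complex.exp)
    (C := Real.exp |z.re|) (fun w _ => (Complex.hasDerivAt_exp w).hasDerivWithinAt)
    (fun w hw => by rw [Complex.norm_exp]; exact Real.exp_le_exp.2 hw)
    (x := 0) (y := z) (by simp) (le_abs_self z.re)
  rw [Complex.exp_zero, sub_zero] at this
  linarith

theorem norm_exp_sub_one_sub_le (z : ℂ) :
    ‖Complex.exp z - 1 - z‖ ≤ ‖z‖ ^ 2 * Real.exp |z.re| := by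
  have := (convex_segment (0 : ℂ) z).norm_image_sub_le_of_norm_hasDerivWithin_le
    (f := fun w => Complex.exp w - w) (f' := fun w => Complex.exp w - 1)
    (C := ‖z‖ * Real.exp |z.re|)
    (fun w _ => ((Complex.hasDerivAt_exp w).sub (hasDerivAt_id w)).hasDerivWithinAt)
    (fun w hw => by
      rw [segment_eq_image] at hw
      obtain ⟨t, ht, rfl⟩ := hw
      have ht1 : |t| ≤ 1 := by rw [abs_of_nonneg ht.1]; exact ht.2
      refine (norm_exp_sub_one_le' _).trans ?_
      simp only [smul_zero, zero_add, Complex.real_smul, norm_mul, Complex.norm_real,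
        Complex.re_ofReal_mul, abs_mul, Real.norm_eq_abs]
      exact mul_le_mul (mul_le_of_le_one_left (norm_nonneg _) ht1)
        (Real.exp_le_exp.2 (mul_le_of_le_one_left (abs_nonneg _) ht1)) (Real.exp_nonneg _)
        (norm_nonneg _))
    (left_mem_segment ℝ 0 z) (right_mem_segment ℝ 0 z)
  have e : Complex.exp z - z - (Complex.exp 0 - 0) = Complex.exp z - 1 - z := by
    rw [Complex.exp_zero]; ring
  rw [e, sub_zero] at this
  exact this.trans (le_of_eq (by ring))

theorem one_add_norm_pow_le_exp {η : ℝ} (hη : 0 < η) (N : ℕ) :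
    ∃ C : ℝ, ∀ u : ℂ, (1 + ‖u‖) ^ N ≤ C * Real.exp (η * growth u) := by
  -- From `xᴺ / N! ≤ eˣ` with `x = η growth u + 2η/3`, for which `(3/η) x = 3 growth u + 2 ≥ 1 +
  -- ‖u‖`.
  refine ⟨(3 / η) ^ N * N.factorial * Real.exp (2 * η / 3), fun u => ?_⟩
  have h1 : 1 + ‖u‖ ≤ 3 / η * (η * growth u + 2 * η / 3) := by
    have := norm_le_growth u
    field_simp
    linarith
  have h0 : 0 ≤ η * growth u + 2 * η / 3 := by have := growth_nonneg u; positivity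
  have h2 := Real.pow_div_factorial_le_exp _ h0 N
  rw [div_le_iff₀ (by positivity), Real.exp_add] at h2
  calc (1 + ‖u‖) ^ N ≤ (3 / η * (η * growth u + 2 * η / 3)) ^ N :=
        pow_le_pow_left₀ (by positivity) h1 N
    _ = (3 / η) ^ N * (η * growth u + 2 * η / 3) ^ N := mul_pow _ _ _
    _ ≤ (3 / η) ^ N * (Real.exp (η * growth u) * Real.exp (2 * η / 3) * N.factorial) :=
        mul_le_mul_of_nonneg_left h2 (by positivity)
    _ = _ := by ring

/-! ### Exponential moments -/

theorem expDiag_castSucc {m : ℕ} (p : Params m) (z : ℂ) (k : Fin m) :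
    expDiag p z k.castSucc = Complex.exp (phase p k z) := by
  simp [expDiag, phase]

theorem expDiag_last {m : ℕ} (p : Params m) (z : ℂ) : expDiag p z (Fin.last m) = 1 := by
  simp [expDiag]

theorem expDiag_neg {m : ℕ} (p : Params m) (z : ℂ) (a : Fin (m + 1)) :
    expDiag (-p) z a = (expDiag p z a)⁻¹ := by
  refine Fin.lastCases ?_ (fun k => ?_) a
  · simp [expDiag_last]
  · rw [expDiag_castSucc, expDiag_castSucc, ← Complex.exp_neg]
    congr 1
    simp [phase]; ring

theorem gVec_eq_fVec {m : ℕ} (G : ℂ → Fin (m + 1) → ℂ) (c : ℂ → ℂ) (p : Params m) :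
    gVec G c p = fVec G (fun u => (c u)⁻¹) (-p) := by
  ext u a
  rw [gVec, fVec, expDiag_neg]

theorem fVec_add_castSucc {m : ℕ} (F : ℂ → Fin (m + 1) → ℂ) (c : ℂ → ℂ) (p δ : Params m) (u : ℂ)
    (k : Fin m) :
    fVec F c (p + δ) u k.castSucc = Complex.exp (phase δ k u) * fVec F c p u k.castSucc := by
  rw [fVec, fVec, expDiag_castSucc, expDiag_castSucc, phase_add, Complex.exp_add]
  ring

theorem fVec_last {m : ℕ} (F : ℂ → Fin (m + 1) → ℂ) (c : ℂ → ℂ) (p q : Params m) (u : ℂ) :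
    fVec F c p u (Fin.last m) = fVec F c q u (Fin.last m) := by
  rw [fVec, fVec, expDiag_last, expDiag_last]

/-- The weight `e^{2η growth(u)} (1 + |u|)^N`. -/
def weight (η : ℝ) (N : ℕ) (u : ℂ) : ℝ := Real.exp (2 * η * growth u) * (1 + ‖u‖) ^ N

theorem weight_nonneg (η : ℝ) (N : ℕ) (u : ℂ) : 0 ≤ weight η N u := by unfold weight; positivity

variable {m : ℕ} {Ω : Support}

/-- The vector `c Δ F` at `p₀` is square integrable and all its components but the last have
exponential moments of order `2η`. -/
structure HasExpMoments (Ω : Support) (F : ℂ → Fin (m + 1) → ℂ) (c : ℂ → ℂ) (p₀ : Params m)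
    (η : ℝ) : Prop where
  pos : 0 < η
  memLp : ∀ a, MemLp (fun u => fVec F c p₀ u a) 2 Ω.absMeasure
  memLp_weight : ∀ (k : Fin m) (N : ℕ),
    MemLp (fun u => ‖fVec F c p₀ u k.castSucc‖ * weight η N u) 2 Ω.absMeasure

/-- `e^{|a|}` is the maximum of `e^a` and `e^{-a}`, and `L²` is closed under maxima. -/
theorem memLp_mul_exp_abs {w a : ℂ → ℝ} (hw : ∀ u, 0 ≤ w u)
    (h : ∀ σ : ℝ, |σ| = 1 → MemLp (fun u => w u * Real.exp (σ * a u)) 2 Ω.absMeasure) :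
    MemLp (fun u => w u * Real.exp |a u|) 2 Ω.absMeasure := by
  have e : (fun u => w u * Real.exp |a u|) =
      (fun u => w u * Real.exp (1 * a u)) ⊔ fun u => w u * Real.exp (-1 * a u) := by
    ext u
    change _ = max _ _
    rw [← mul_max_of_nonneg _ _ (hw u), one_mul, neg_one_mul, ← Real.exp_monotone.map_max]
    rfl
  rw [e]
  exact (h 1 (by simp)).sup (h (-1) (by simp))

theorem HasExpMoments.of_ball {F : ℂ → Fin (m + 1) → ℂ} {c : ℂ → ℂ} {p₀ : Params m} {ε : ℝ}
    (hε : 0 < ε)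
    (h : ∀ p, dist p p₀ < ε → ∀ a, MemLp (fun u => fVec F c p u a) 2 Ω.absMeasure) {η : ℝ}
    (hη : 0 < η) (hηε : 3 * η < ε) : HasExpMoments Ω F c p₀ η where
  pos := hη
  memLp := h p₀ (by simpa using hε)
  memLp_weight k N := by
    let w : ℂ → ℝ := fun u => ‖fVec F c p₀ u k.castSucc‖
    have hw : ∀ u, 0 ≤ w u := fun u => norm_nonneg _
    -- The eight parameter shifts by `±3η` in all `x`, `y`, `t` coordinates stay in the ball of
    -- radius `ε`; each multiplies the modulus of `f_k` by the corresponding exponential.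
    have h8 : ∀ σ₁ : ℝ, |σ₁| = 1 → ∀ σ₂ : ℝ, |σ₂| = 1 → ∀ σ₃ : ℝ, |σ₃| = 1 →
        MemLp (fun u => w u * Real.exp (σ₁ * (3 * η * u.re)) *
          Real.exp (σ₂ * (3 * η * (u ^ 2).re)) * Real.exp (σ₃ * (3 * η * (u ^ 3).re))) 2
          Ω.absMeasure := by
      intro σ₁ h1 σ₂ h2 σ₃ h3
      let δ : Params m := (fun _ => σ₁ * (3 * η), fun _ => σ₂ * (3 * η), fun _ => σ₃ * (3 * η))
      have hc : ∀ σ : ℝ, |σ| = 1 → ‖(fun _ : Fin m => σ * (3 * η))‖ ≤ 3 * η := fun σ hσ =>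
        (pi_norm_le_iff_of_nonneg (by positivity)).2 fun _ => by
          rw [Real.norm_eq_abs, abs_mul, hσ, one_mul, abs_of_pos (by positivity)]
      have hδ : ‖δ‖ ≤ 3 * η := max_le (hc _ h1) (max_le (hc _ h2) (hc _ h3))
      have := (h (p₀ + δ) (by rw [dist_self_add_left]; exact hδ.trans_lt hηε) k.castSucc).norm
      have e : (fun u => ‖fVec F c (p₀ + δ) u k.castSucc‖) = fun u => w u *
          Real.exp (σ₁ * (3 * η * u.re)) * Real.exp (σ₂ * (3 * η * (u ^ 2).re)) *
          Real.exp (σ₃ * (3 * η * (u ^ 3).re)) := by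
        ext u
        have e' : (phase δ k u).re = σ₃ * (3 * η * (u ^ 3).re) + σ₂ * (3 * η * (u ^ 2).re) +
            σ₁ * (3 * η * u.re) := by
          simp only [phase, δ, Complex.add_re, Complex.re_ofReal_mul]
          ring
        rw [fVec_add_castSucc, norm_mul, Complex.norm_exp, e', Real.exp_add, Real.exp_add]
        ring
      rwa [e] at this
    have key : MemLp (fun u => w u * Real.exp (3 * η * growth u)) 2 Ω.absMeasure := by
      have e : (fun u => w u * Real.exp (3 * η * growth u)) = fun u => w u *
          Real.exp |3 * η * u.re| * Real.exp |3 * η * (u ^ 2).re| *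
          Real.exp |3 * η * (u ^ 3).re| := by
        ext u
        simp only [abs_mul, abs_of_pos hη, growth, mul_add, Real.exp_add]
        norm_num
        ring
      rw [e]
      refine memLp_mul_exp_abs (fun u => by have := hw u; positivity) fun σ₃ h3 => ?_
      have e : (fun u => w u * Real.exp |3 * η * u.re| * Real.exp |3 * η * (u ^ 2).re| *
          Real.exp (σ₃ * (3 * η * (u ^ 3).re))) = fun u => w u * Real.exp |3 * η * u.re| *
          Real.exp (σ₃ * (3 * η * (u ^ 3).re)) * Real.exp |3 * η * (u ^ 2).re| := by
        ext u; ring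
      rw [e]
      refine memLp_mul_exp_abs (fun u => by have := hw u; positivity) fun σ₂ h2 => ?_
      have e : (fun u => w u * Real.exp |3 * η * u.re| * Real.exp (σ₃ * (3 * η * (u ^ 3).re)) *
          Real.exp (σ₂ * (3 * η * (u ^ 2).re))) = fun u => w u *
          Real.exp (σ₂ * (3 * η * (u ^ 2).re)) * Real.exp (σ₃ * (3 * η * (u ^ 3).re)) *
          Real.exp |3 * η * u.re| := by
        ext u; ring
      rw [e]
      refine memLp_mul_exp_abs (fun u => by have := hw u; positivity) fun σ₁ h1 => ?_
      have e : (fun u => w u * Real.exp (σ₂ * (3 * η * (u ^ 2).re)) *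
          Real.exp (σ₃ * (3 * η * (u ^ 3).re)) * Real.exp (σ₁ * (3 * η * u.re))) = fun u => w u *
          Real.exp (σ₁ * (3 * η * u.re)) * Real.exp (σ₂ * (3 * η * (u ^ 2).re)) *
          Real.exp (σ₃ * (3 * η * (u ^ 3).re)) := by
        ext u; ring
      rw [e]
      exact h8 σ₁ h1 σ₂ h2 σ₃ h3
    -- Of the available weight `e^{3η growth}`, one factor `e^{η growth}` is spent on the polynomial
    -- `(1 + ‖u‖)ᴺ`.
    obtain ⟨C, hC⟩ := one_add_norm_pow_le_exp hη N
    refine (key.const_mul C).of_le ((h p₀ (by simpa using hε) k.castSucc).1.norm.mul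
      (Continuous.aestronglyMeasurable ?_)) (ae_of_all _ fun u => ?_)
    · have := continuous_growth
      unfold weight; fun_prop
    · rw [Real.norm_of_nonneg (mul_nonneg (hw u) (weight_nonneg _ _ _))]
      refine le_trans ?_ (le_abs_self _)
      have h1 := mul_le_mul_of_nonneg_left (hC u)
        (mul_nonneg (hw u) (Real.exp_nonneg (2 * η * growth u)))
      have h2 : Real.exp (3 * η * growth u) =
          Real.exp (2 * η * growth u) * Real.exp (η * growth u) := by
        rw [← Real.exp_add]; ring_nf
      calc ‖fVec F c p₀ u k.castSucc‖ * weight η N u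
          = w u * Real.exp (2 * η * growth u) * (1 + ‖u‖) ^ N := by
            simp only [weight, w]; ring
        _ ≤ w u * Real.exp (2 * η * growth u) * (C * Real.exp (η * growth u)) := h1
        _ = C * (w u * Real.exp (3 * η * growth u)) := by rw [h2]; ring

theorem norm_fVec_le (F : ℂ → Fin (m + 1) → ℂ) (c : ℂ → ℂ) {p p₀ : Params m} {r : ℝ}
    (hp : dist p p₀ ≤ r) (u : ℂ) (k : Fin m) : ‖fVec F c p u k.castSucc‖ ≤
      ‖fVec F c p₀ u k.castSucc‖ * Real.exp (r * growth u) := by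
  rw [dist_eq_norm] at hp
  have := fVec_add_castSucc F c p₀ (p - p₀) u k
  rw [add_sub_cancel] at this
  rw [this, norm_mul, Complex.norm_exp, mul_comm]
  refine mul_le_mul_of_nonneg_left (Real.exp_le_exp.2 ?_) (norm_nonneg _)
  exact (le_abs_self _).trans ((abs_re_phase_le _ _ _).trans
    (mul_le_mul_of_nonneg_right hp (growth_nonneg u)))

namespace HasExpMoments

variable {F : ℂ → Fin (m + 1) → ℂ} {c : ℂ → ℂ} {p₀ : Params m} {η : ℝ}

/-- Neither `F` nor `c` is assumed measurable; the component at `p` is a continuous exponential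
times the component at `p₀`. -/
theorem aestronglyMeasurable (hE : HasExpMoments Ω F c p₀ η) (p : Params m) (a : Fin (m + 1)) :
    AEStronglyMeasurable (fun u => fVec F c p u a) Ω.absMeasure := by
  refine Fin.lastCases ?_ (fun k => ?_) a
  · simp_rw [fVec_last F c p p₀]
    exact (hE.memLp _).1
  · have := fun u => fVec_add_castSucc F c p₀ (p - p₀) u k
    simp only [add_sub_cancel] at this
    simp_rw [this]
    exact (Complex.continuous_exp.comp (continuous_phase _ _)).aestronglyMeasurable.mul
      (hE.memLp _).1

theorem memLp_mom (hE : HasExpMoments Ω F c p₀ η) {p : Params m} (hp : dist p p₀ < 2 * η) (i : ℕ)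
    (k : Fin m) : MemLp (fun u => u ^ i * fVec F c p u k.castSucc) 2 Ω.absMeasure := by
  refine (hE.memLp_weight k i).of_le ((continuous_pow i).aestronglyMeasurable.mul
    (hE.aestronglyMeasurable p _)) (ae_of_all _ fun u => ?_)
  refine le_trans ?_ (le_abs_self _)
  rw [norm_mul, norm_pow, weight]
  have h1 := norm_fVec_le F c hp.le u k
  have h2 : ‖u‖ ^ i ≤ (1 + ‖u‖) ^ i := pow_le_pow_left₀ (norm_nonneg _) (by linarith) i
  exact (mul_le_mul h2 h1 (norm_nonneg _) (by positivity)).trans (le_of_eq (by ring))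

theorem memLp_fVec (hE : HasExpMoments Ω F c p₀ η) {p : Params m} (hp : dist p p₀ < 2 * η)
    (a : Fin (m + 1)) : MemLp (fun u => fVec F c p u a) 2 Ω.absMeasure := by
  refine Fin.lastCases ?_ (fun k => ?_) a
  · simp_rw [fVec_last F c p p₀]
    exact hE.memLp _
  · simpa using hE.memLp_mom hp 0 k

end HasExpMoments

/-! ### Differentiability of the moments -/

/-- The class of `z^i f_a` in `L²(Ω, |μ|)`. -/
def mom (Ω : Support) (F : ℂ → Fin (m + 1) → ℂ) (c : ℂ → ℂ) (i : ℕ) (a : Fin (m + 1))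
    (p : Params m) : Ω.L2 := Ω.toL2 fun u => u ^ i * fVec F c p u a

/-- The coordinate `x_k`. -/
def coordX (k : Fin m) : Params m →L[ℝ] ℝ :=
  (ContinuousLinearMap.proj k).comp (ContinuousLinearMap.fst ℝ _ _)

/-- The coordinate `y_k`. -/
def coordY (k : Fin m) : Params m →L[ℝ] ℝ :=
  (ContinuousLinearMap.proj k).comp
    ((ContinuousLinearMap.fst ℝ _ _).comp (ContinuousLinearMap.snd ℝ _ _))

/-- The coordinate `t_k`. -/
def coordT (k : Fin m) : Params m →L[ℝ] ℝ :=
  (ContinuousLinearMap.proj k).comp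
    ((ContinuousLinearMap.snd ℝ _ _).comp (ContinuousLinearMap.snd ℝ _ _))

/-- The derivative of `mom Ω F c i k`. -/
def momDeriv (Ω : Support) (F : ℂ → Fin (m + 1) → ℂ) (c : ℂ → ℂ) (i : ℕ) (k : Fin m)
    (p : Params m) : Params m →L[ℝ] Ω.L2 :=
  (coordX k).smulRight (mom Ω F c (i + 1) k.castSucc p) +
    (coordY k).smulRight (mom Ω F c (i + 2) k.castSucc p) +
    (coordT k).smulRight (mom Ω F c (i + 3) k.castSucc p)

theorem hasFDerivAt_of_norm_le_sq {E E' : Type*} [NormedAddCommGroup E] [NormedSpace ℝ E]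
    [NormedAddCommGroup E'] [NormedSpace ℝ E'] {f : E → E'} {D : E →L[ℝ] E'} {p : E} (C : ℝ)
    (h : ∀ᶠ δ in 𝓝 0, ‖f (p + δ) - f p - D δ‖ ≤ C * ‖δ‖ ^ 2) : HasFDerivAt f D p := by
  rw [hasFDerivAt_iff_isLittleO_nhds_zero]
  have h1 : (fun δ => f (p + δ) - f p - D δ) =O[𝓝 0] fun δ => ‖δ‖ ^ 2 :=
    Asymptotics.IsBigO.of_bound C (by
      filter_upwards [h] with δ hδ
      rwa [Real.norm_of_nonneg (by positivity)])
  exact h1.trans_isLittleO (Asymptotics.isLittleO_norm_pow_id one_lt_two)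

theorem hasFDerivAt_mom {F : ℂ → Fin (m + 1) → ℂ} {c : ℂ → ℂ} {p₀ : Params m} {η : ℝ}
    (hE : HasExpMoments Ω F c p₀ η) {p : Params m} (hp : dist p p₀ < η) (i : ℕ) (k : Fin m) :
    HasFDerivAt (mom Ω F c i k.castSucc) (momDeriv Ω F c i k p) p := by
  have hη := hE.pos
  -- The remainder is quadratic in a phase of size `‖δ‖ (1 + ‖u‖)³`, hence six extra powers. The
  -- weight `e^{2η growth}` pays once for `p - p₀` and once for `δ`.
  have hW := hE.memLp_weight k (i + 6)
  have hp2 : dist p p₀ < 2 * η := by linarith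
  refine hasFDerivAt_of_norm_le_sq (eLpNorm (fun u => ‖fVec F c p₀ u k.castSucc‖ *
    weight η (i + 6) u) 2 Ω.absMeasure).toReal ?_
  filter_upwards [Metric.ball_mem_nhds 0 hη] with δ hδ
  rw [mem_ball_zero_iff] at hδ
  have hpδ : dist (p + δ) p₀ < 2 * η := by
    have := dist_triangle (p + δ) p p₀
    rw [dist_self_add_left] at this
    linarith
  refine (norm_le_of_ae_le hW (C := ‖δ‖ ^ 2) ?_ (by positivity)).trans (le_of_eq (mul_comm _ _))
  have hm := fun j => toL2_coeFn (hE.memLp_mom hp2 j k)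
  have e2 : momDeriv Ω F c i k p δ = δ.1 k • mom Ω F c (i + 1) k.castSucc p +
    δ.2.1 k • mom Ω F c (i + 2) k.castSucc p + δ.2.2 k • mom Ω F c (i + 3) k.castSucc p := rfl
  filter_upwards [toL2_coeFn (hE.memLp_mom hpδ i k), hm i, hm (i + 1), hm (i + 2), hm (i + 3),
    Lp.coeFn_sub (mom Ω F c i k.castSucc (p + δ) - mom Ω F c i k.castSucc p)
      (momDeriv Ω F c i k p δ),
    Lp.coeFn_sub (mom Ω F c i k.castSucc (p + δ)) (mom Ω F c i k.castSucc p),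
    Lp.coeFn_add (δ.1 k • mom Ω F c (i + 1) k.castSucc p +
      δ.2.1 k • mom Ω F c (i + 2) k.castSucc p) (δ.2.2 k • mom Ω F c (i + 3) k.castSucc p),
    Lp.coeFn_add (δ.1 k • mom Ω F c (i + 1) k.castSucc p)
      (δ.2.1 k • mom Ω F c (i + 2) k.castSucc p),
    Lp.coeFn_smul (δ.1 k) (mom Ω F c (i + 1) k.castSucc p),
    Lp.coeFn_smul (δ.2.1 k) (mom Ω F c (i + 2) k.castSucc p),
    Lp.coeFn_smul (δ.2.2 k) (mom Ω F c (i + 3) k.castSucc p)] with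
    u h0 h1 h2 h3 h4 h5 h6 h7 h8 h9 h10 h11
  rw [h5, Pi.sub_apply, h6, Pi.sub_apply, e2, h7, Pi.add_apply, h8, Pi.add_apply, h9, h10, h11]
  simp only [Pi.smul_apply, mom, h0, h1, h2, h3, h4, Complex.real_smul]
  rw [fVec_add_castSucc]
  have e : u ^ i * (Complex.exp (phase δ k u) * fVec F c p u k.castSucc) -
      u ^ i * fVec F c p u k.castSucc - (δ.1 k * (u ^ (i + 1) * fVec F c p u k.castSucc) +
      δ.2.1 k * (u ^ (i + 2) * fVec F c p u k.castSucc) +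
      δ.2.2 k * (u ^ (i + 3) * fVec F c p u k.castSucc)) =
      u ^ i * fVec F c p u k.castSucc *
        (Complex.exp (phase δ k u) - 1 - phase δ k u) := by
    simp only [phase]; ring
  rw [e, norm_mul, norm_mul, norm_pow]
  have b1 := norm_fVec_le F c hp.le u k
  have b2 : ‖u‖ ^ i ≤ (1 + ‖u‖) ^ i := pow_le_pow_left₀ (norm_nonneg _) (by linarith) i
  have b3 : ‖Complex.exp (phase δ k u) - 1 - phase δ k u‖ ≤
      (‖δ‖ * (1 + ‖u‖) ^ 3) ^ 2 * Real.exp (η * growth u) :=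
    (norm_exp_sub_one_sub_le _).trans (mul_le_mul
      (pow_le_pow_left₀ (norm_nonneg _) (norm_phase_le δ k u) 2)
      (Real.exp_le_exp.2 ((abs_re_phase_le δ k u).trans
        (mul_le_mul_of_nonneg_right hδ.le (growth_nonneg u)))) (Real.exp_nonneg _) (by positivity))
  refine (mul_le_mul (mul_le_mul b2 b1 (norm_nonneg _) (by positivity)) b3 (norm_nonneg _)
    (by positivity)).trans (le_of_eq ?_)
  have b4 : Real.exp (2 * η * growth u) = Real.exp (η * growth u) * Real.exp (η * growth u) := by
    rw [← Real.exp_add]; ring_nf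
  rw [weight, b4]
  ring

theorem contDiffOn_mom {F : ℂ → Fin (m + 1) → ℂ} {c : ℂ → ℂ} {p₀ : Params m} {η : ℝ}
    (hE : HasExpMoments Ω F c p₀ η) (n : ℕ) (i : ℕ) (k : Fin m) :
    ContDiffOn ℝ n (mom Ω F c i k.castSucc) (Metric.ball p₀ η) := by
  induction n generalizing i with
  | zero =>
    exact contDiffOn_zero.2 fun p hp =>
      (hasFDerivAt_mom hE hp i k).continuousAt.continuousWithinAt
  | succ n ih =>
    -- The derivative of the `i`-th moment consists of moments of orders `i + 1`, `i + 2`, `i + 3`,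
    -- so the induction runs over all `i`. The analyticity clause is vacuous at finite order.
    refine (contDiffOn_succ_iff_hasFDerivWithinAt_of_uniqueDiffOn
      Metric.isOpen_ball.uniqueDiffOn).2 ⟨fun h => (WithTop.natCast_ne_top n h).elim, momDeriv Ω F c i k, ?_, fun p hp =>
      (hasFDerivAt_mom hE hp i k).hasFDerivWithinAt⟩
    exact ((contDiffOn_const.smulRight (ih _)).add (contDiffOn_const.smulRight (ih _))).add
      (contDiffOn_const.smulRight (ih _))

end CubicKP

namespace CubicKP

variable {m : ℕ} {Ω : Support}

/-! ### Operators with a principal value kernel -/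

/-- `T` is the principal value operator with kernel `k`, whose truncations converge absolutely. -/
def HasTruncKernel (Ω : Support) (T : Ω.L2 →L[ℂ] Ω.L2) (k : ℂ → ℂ → ℂ) : Prop :=
  IsIntegralOperator Ω T k ∧ ∀ h : Ω.L2, ∀ᵐ u ∂Ω.absMeasure, ∀ ε : ℝ, 0 < ε →
    IntegrableOn (fun v => k u v * h v * Ω.direction v) {v | ε ≤ dist u v} Ω.absMeasure

theorem IsIntegralOperator.hasTruncKernel {f g : ℂ → Fin (m + 1) → ℂ} {T : Ω.L2 →L[ℂ] Ω.L2}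
    (hg : ∀ a, MemLp (fun u => g u a) 2 Ω.absMeasure)
    (hT : IsIntegralOperator Ω T (iiksKernel f g)) : HasTruncKernel Ω T (iiksKernel f g) :=
  ⟨hT, fun h => ae_of_all _ fun u _ hε => integrableOn_iiksKernel hg hε u h⟩

/-- Principal values are limits, so the kernel determines the operator. -/
theorem IsIntegralOperator.unique {T T' : Ω.L2 →L[ℂ] Ω.L2} {k : ℂ → ℂ → ℂ}
    (h : IsIntegralOperator Ω T k) (h' : IsIntegralOperator Ω T' k) : T = T' := by
  ext1 φ
  refine Lp.ext ?_
  filter_upwards [h φ, h' φ] with u h1 h2 using tendsto_nhds_unique h1 h2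

namespace HasTruncKernel

theorem of_integral {T : Ω.L2 →L[ℂ] Ω.L2} {k : ℂ → ℂ → ℂ}
    (hT : ∀ h : Ω.L2, ∀ᵐ u ∂Ω.absMeasure,
      T h u = ∫ v, k u v * h v * Ω.direction v ∂Ω.absMeasure)
    (hi : ∀ h : Ω.L2, ∀ᵐ u ∂Ω.absMeasure,
      Integrable (fun v => k u v * h v * Ω.direction v) Ω.absMeasure)
    (h0 : ∀ᵐ u ∂Ω.absMeasure, k u u = 0) : HasTruncKernel Ω T k := by
  refine ⟨fun h => ?_, fun h => ?_⟩
  · filter_upwards [hT h, hi h, h0] with u h1 h2 h3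
    rw [h1]
    exact tendsto_setIntegral_dist_ge h2 (by simp [h3])
  · filter_upwards [hi h] with u hu ε _ using hu.integrableOn

variable {T T' : Ω.L2 →L[ℂ] Ω.L2} {k k' : ℂ → ℂ → ℂ}

/-- Absolute convergence of each truncation is what makes principal values additive. -/
theorem add (h : HasTruncKernel Ω T k) (h' : HasTruncKernel Ω T' k') :
    HasTruncKernel Ω (T + T') fun u v => k u v + k' u v := by
  refine ⟨fun φ => ?_, fun φ => ?_⟩
  · filter_upwards [h.1 φ, h'.1 φ, h.2 φ, h'.2 φ, Lp.coeFn_add (T φ) (T' φ)] with u h1 h2 h3 h4 h5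
    rw [show (T + T') φ = T φ + T' φ from rfl, h5]
    refine (h1.add h2).congr' ?_
    filter_upwards [self_mem_nhdsWithin] with ε hε
    simp only [Support.integralOn]
    rw [← integral_add (h3 ε hε) (h4 ε hε)]
    simp only [add_mul]
  · filter_upwards [h.2 φ, h'.2 φ] with u h1 h2 ε hε
    exact Integrable.congr ((h1 ε hε).add (h2 ε hε)) (ae_of_all _ fun v => by
      simp only [Pi.add_apply]; ring)

theorem smul (h : HasTruncKernel Ω T k) (c : ℝ) :
    HasTruncKernel Ω (c • T) fun u v => c * k u v := by
  refine ⟨fun φ => ?_, fun φ => ?_⟩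
  · filter_upwards [h.1 φ, Lp.coeFn_smul c (T φ)] with u h1 h2
    rw [show (c • T) φ = c • T φ from rfl, h2, Pi.smul_apply, Complex.real_smul]
    refine (h1.const_mul (c : ℂ)).congr fun ε => ?_
    simp only [Support.integralOn]
    rw [← integral_const_mul]
    simp only [mul_assoc]
  · filter_upwards [h.2 φ] with u h1 ε hε
    exact Integrable.congr ((h1 ε hε).const_mul (c : ℂ)) (ae_of_all _ fun v => by
      simp only [mul_assoc])

theorem sub (h : HasTruncKernel Ω T k) (h' : HasTruncKernel Ω T' k') :
    HasTruncKernel Ω (T - T') fun u v => k u v - k' u v := by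
  have := h.add (h'.smul (-1))
  simpa [sub_eq_add_neg] using this

theorem zero : HasTruncKernel Ω (0 : Ω.L2 →L[ℂ] Ω.L2) fun _ _ => 0 := by
  refine of_integral (fun h => ?_) (fun h => ?_) ?_
  · filter_upwards [Lp.coeFn_zero ℂ 2 Ω.absMeasure] with u hu
    simpa using hu
  · simp
  · simp

theorem sum {ι : Type*} (s : Finset ι) {T : ι → Ω.L2 →L[ℂ] Ω.L2} {k : ι → ℂ → ℂ → ℂ}
    (h : ∀ i ∈ s, HasTruncKernel Ω (T i) (k i)) :
    HasTruncKernel Ω (∑ i ∈ s, T i) fun u v => ∑ i ∈ s, k i u v := by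
  classical
  induction s using Finset.induction_on with
  | empty => simpa using zero
  | insert i s hi ih =>
    simp only [Finset.sum_insert hi]
    exact (h i (Finset.mem_insert_self i s)).add
      (ih fun j hj => h j (Finset.mem_insert_of_mem hj))

theorem norm_le (h : HasTruncKernel Ω T k) {E₁ E₂ : ℂ → ℝ} (h₁ : MemLp E₁ 2 Ω.absMeasure)
    (h₂ : MemLp E₂ 2 Ω.absMeasure) (h0 : ∀ u, 0 ≤ E₁ u) (h0' : ∀ u, 0 ≤ E₂ u) {C : ℝ}
    (hC : 0 ≤ C) (hb : ∀ u ∈ Ω.carrier, ∀ v ∈ Ω.carrier, ‖k u v‖ ≤ C * (E₁ u * E₂ v)) :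
    ‖T‖ ≤ C * ((eLpNorm E₁ 2 Ω.absMeasure).toReal * (eLpNorm E₂ 2 Ω.absMeasure).toReal) := by
  refine opNorm_le_of_kernel_bound h₁ h₂ (ae_of_all _ h0') hC fun φ => ?_
  filter_upwards [h.1 φ, Ω.ae_mem_carrier] with u h1 hcu
  refine le_of_tendsto h1.norm (Eventually.of_forall fun ε => ?_)
  have hi : Integrable (fun v => C * E₁ u * (E₂ v * ‖φ v‖)) Ω.absMeasure :=
    (h₂.integrable_mul (Lp.memLp φ).norm).const_mul _
  rw [← mul_assoc, ← integral_const_mul, Support.integralOn]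
  refine (norm_integral_le_of_norm_le hi.integrableOn (ae_restrict_of_ae ?_)).trans
    (setIntegral_le_integral hi (ae_of_all _ fun v => ?_))
  · filter_upwards [Ω.ae_mem_carrier] with v hcv
    rw [norm_mul, norm_mul]
    have := mul_le_mul_of_nonneg_right (hb u hcu v hcv) (norm_nonneg (φ v))
    refine (mul_le_of_le_one_right (by positivity) (Ω.norm_direction_le v)).trans
      (this.trans (le_of_eq (by ring)))
  · have := h0 u; have := h0' v
    change 0 ≤ C * E₁ u * (E₂ v * ‖φ v‖)
    positivity

end HasTruncKernel

variable (Ω) in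
/-- The rank one operators `(φ ⊗ ψ) h = (∫_Ω h ψ dμ) φ`. -/
def rankOne : Ω.L2 →L[ℂ] Ω.L2 →L[ℂ] (Ω.L2 →L[ℂ] Ω.L2) :=
  ((ContinuousLinearMap.smulRightL ℂ Ω.L2 Ω.L2).comp (pairing Ω).flip).flip

theorem rankOne_apply (φ ψ h : Ω.L2) : rankOne Ω φ ψ h = pairing Ω h ψ • φ := rfl

/-- The kernel vanishes on the diagonal, so excluding the point `v = u` changes nothing and the
principal value is the ordinary integral. -/
theorem hasTruncKernel_rankOne {φ ψ : ℂ → ℂ} (hφ : MemLp φ 2 Ω.absMeasure)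
    (hψ : MemLp ψ 2 Ω.absMeasure) (h0 : ∀ u ∈ Ω.carrier, φ u * ψ u = 0) :
    HasTruncKernel Ω (rankOne Ω (Ω.toL2 φ) (Ω.toL2 ψ)) fun u v => φ u * ψ v := by
  refine HasTruncKernel.of_integral (fun h => ?_) (fun h => ae_of_all _ fun u => ?_) ?_
  · rw [rankOne_apply]
    filter_upwards [Lp.coeFn_smul (pairing Ω h (Ω.toL2 ψ)) (Ω.toL2 φ), toL2_coeFn hφ] with u h1 h2
    rw [h1, Pi.smul_apply, h2, smul_eq_mul, pairing_apply, Support.integral, Support.integralOn,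
      Measure.restrict_univ, mul_comm, ← integral_const_mul]
    refine integral_congr_ae ?_
    filter_upwards [toL2_coeFn hψ] with v hv
    rw [hv]; ring
  · exact integrable_kernel_mul (hψ.1.const_mul _) hψ.norm (C := ‖φ u‖)
      (ae_of_all _ fun v => (norm_mul _ _).le) h
  · filter_upwards [Ω.ae_mem_carrier] with u hu using h0 u hu

end CubicKP

namespace CubicKP

variable {m : ℕ} {Ω : Support}

/-! ### The deformed operators -/

theorem iiksKernel_eq_div (f g : ℂ → Fin (m + 1) → ℂ) (u v : ℂ) :
    iiksKernel f g u v = (∑ a, f u a * g v a) / (u - v) := by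
  unfold iiksKernel
  split_ifs with h
  · simp [h]
  · rfl

theorem phase_neg (p : Params m) (k : Fin m) (u : ℂ) : phase (-p) k u = -phase p k u := by
  simp [phase]; ring

theorem gVec_add_castSucc (G : ℂ → Fin (m + 1) → ℂ) (c : ℂ → ℂ) (p δ : Params m) (u : ℂ)
    (k : Fin m) :
    gVec G c (p + δ) u k.castSucc = Complex.exp (-phase δ k u) * gVec G c p u k.castSucc := by
  rw [gVec_eq_fVec, gVec_eq_fVec, neg_add, fVec_add_castSucc, phase_neg]

theorem gVec_last (G : ℂ → Fin (m + 1) → ℂ) (c : ℂ → ℂ) (p q : Params m) (u : ℂ) :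
    gVec G c p u (Fin.last m) = gVec G c q u (Fin.last m) := by
  rw [gVec_eq_fVec, gVec_eq_fVec, fVec_last]

/-- The last component does not depend on the parameters and drops out. In the others the phases
enter only through their difference, which is divisible by `u - v`, so the singularity cancels. -/
theorem iiksKernel_add_sub (F G : ℂ → Fin (m + 1) → ℂ) (c : ℂ → ℂ) (p δ : Params m) (u v : ℂ) :
    iiksKernel (fVec F c (p + δ)) (gVec G c (p + δ)) u v -
        iiksKernel (fVec F c p) (gVec G c p) u v =
      ∑ k : Fin m, fVec F c p u k.castSucc * gVec G c p v k.castSucc *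
        ((Complex.exp ((u - v) * phaseQuot δ k u v) - 1) / (u - v)) := by
  rw [iiksKernel_eq_div, iiksKernel_eq_div, ← sub_div, Fin.sum_univ_castSucc, Fin.sum_univ_castSucc,
    fVec_last F c (p + δ) p, gVec_last G c (p + δ) p, add_sub_add_right_eq_sub,
    ← Finset.sum_sub_distrib, Finset.sum_div]
  refine Finset.sum_congr rfl fun k _ => ?_
  rw [← phase_sub_phase, sub_eq_add_neg (phase δ k u), Complex.exp_add, fVec_add_castSucc,
    gVec_add_castSucc]
  ring

/-- The components `f_k`, `k ≤ m`, at `p₀`, multiplied by the weight and summed. -/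
def weightedSum (f : ℂ → Fin (m + 1) → ℂ) (η : ℝ) (u : ℂ) : ℝ :=
  ∑ k : Fin m, ‖f u k.castSucc‖ * weight η 5 u

theorem weightedSum_nonneg (f : ℂ → Fin (m + 1) → ℂ) (η : ℝ) (u : ℂ) : 0 ≤ weightedSum f η u :=
  Finset.sum_nonneg fun _ _ => mul_nonneg (norm_nonneg _) (weight_nonneg _ _ _)

theorem HasExpMoments.memLp_weightedSum {F : ℂ → Fin (m + 1) → ℂ} {c : ℂ → ℂ} {p₀ : Params m}
    {η : ℝ} (hE : HasExpMoments Ω F c p₀ η) :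
    MemLp (weightedSum (fVec F c p₀) η) 2 Ω.absMeasure :=
  memLp_finsetSum Finset.univ fun k _ => hE.memLp_weight k 5

theorem norm_gVec_le (G : ℂ → Fin (m + 1) → ℂ) (c : ℂ → ℂ) {p p₀ : Params m} {r : ℝ}
    (hp : dist p p₀ ≤ r) (u : ℂ) (k : Fin m) : ‖gVec G c p u k.castSucc‖ ≤
      ‖gVec G c p₀ u k.castSucc‖ * Real.exp (r * growth u) := by
  rw [gVec_eq_fVec, gVec_eq_fVec]
  exact norm_fVec_le G _ (by rwa [dist_neg_neg]) u k

/-- The common bound for the kernels of difference quotients. -/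
theorem norm_sum_kernel_le (F G : ℂ → Fin (m + 1) → ℂ) (c : ℂ → ℂ) {p p₀ : Params m} {η : ℝ}
    (hp : dist p p₀ ≤ η) (u v : ℂ) {X : Fin m → ℂ} {B : ℝ}
    (hX : ∀ k, ‖X k‖ ≤ B * ((1 + ‖u‖) ^ 5 * (1 + ‖v‖) ^ 5 *
      (Real.exp (η * growth u) * Real.exp (η * growth v)))) (hB : 0 ≤ B) :
    ‖∑ k : Fin m, fVec F c p u k.castSucc * gVec G c p v k.castSucc * X k‖ ≤
      B * (weightedSum (fVec F c p₀) η u * weightedSum (gVec G c p₀) η v) := by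
  have h1 : ∀ k : Fin m, ‖fVec F c p u k.castSucc * gVec G c p v k.castSucc * X k‖ ≤
      B * ((‖fVec F c p₀ u k.castSucc‖ * weight η 5 u) * weightedSum (gVec G c p₀) η v) := by
    intro k
    rw [norm_mul, norm_mul]
    have e : ∀ w, Real.exp (2 * η * growth w) = Real.exp (η * growth w) * Real.exp (η * growth w) :=
      fun w => by rw [← Real.exp_add]; ring_nf
    have h2 : ‖fVec F c p u k.castSucc‖ * ‖gVec G c p v k.castSucc‖ * ‖X k‖ ≤
        B * ((‖fVec F c p₀ u k.castSucc‖ * weight η 5 u) *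
          (‖gVec G c p₀ v k.castSucc‖ * weight η 5 v)) := by
      refine (mul_le_mul (mul_le_mul (norm_fVec_le F c hp u k) (norm_gVec_le G c hp v k)
        (norm_nonneg _) (by positivity)) (hX k) (norm_nonneg _) (by positivity)).trans
        (le_of_eq ?_)
      rw [weight, weight, e, e]
      ring
    refine h2.trans (mul_le_mul_of_nonneg_left (mul_le_mul_of_nonneg_left ?_
      (mul_nonneg (norm_nonneg _) (weight_nonneg _ _ _))) hB)
    exact Finset.single_le_sum (f := fun k : Fin m => ‖gVec G c p₀ v k.castSucc‖ * weight η 5 v)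
      (fun _ _ => mul_nonneg (norm_nonneg _) (weight_nonneg _ _ _)) (Finset.mem_univ k)
  refine (norm_sum_le_of_le _ fun k _ => h1 k).trans (le_of_eq ?_)
  rw [← Finset.mul_sum, ← Finset.sum_mul]
  rfl

theorem exp_abs_re_mul_phaseQuot_le {δ : Params m} {η : ℝ} (hδ : ‖δ‖ ≤ η) (k : Fin m) (u v : ℂ) :
    Real.exp |((u - v) * phaseQuot δ k u v).re| ≤
      Real.exp (η * growth u) * Real.exp (η * growth v) := by
  rw [← Real.exp_add, ← phase_sub_phase, Complex.sub_re]
  refine Real.exp_le_exp.2 ((abs_sub _ _).trans (add_le_add ?_ ?_))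
  · exact (abs_re_phase_le δ k u).trans (mul_le_mul_of_nonneg_right hδ (growth_nonneg u))
  · exact (abs_re_phase_le δ k v).trans (mul_le_mul_of_nonneg_right hδ (growth_nonneg v))

theorem norm_kernel_quot_le {δ : Params m} {η : ℝ} (hδ : ‖δ‖ ≤ η) (k : Fin m) (u v : ℂ) :
    ‖(Complex.exp ((u - v) * phaseQuot δ k u v) - 1) / (u - v)‖ ≤
      ‖δ‖ * ((1 + ‖u‖) ^ 5 * (1 + ‖v‖) ^ 5 *
        (Real.exp (η * growth u) * Real.exp (η * growth v))) := by
  have hu : 1 ≤ 1 + ‖u‖ := by linarith [norm_nonneg u]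
  have hv : 1 ≤ 1 + ‖v‖ := by linarith [norm_nonneg v]
  rw [norm_div]
  refine div_le_of_le_mul₀ (norm_nonneg _) (by positivity) ?_
  refine (norm_exp_sub_one_le' _).trans ?_
  rw [norm_mul]
  have h1 := exp_abs_re_mul_phaseQuot_le hδ k u v
  have h2 : ‖phaseQuot δ k u v‖ ≤ ‖δ‖ * ((1 + ‖u‖) ^ 5 * (1 + ‖v‖) ^ 5) :=
    (norm_phaseQuot_le δ k u v).trans (mul_le_mul_of_nonneg_left (mul_le_mul
      (pow_le_pow_right₀ hu (by norm_num)) (pow_le_pow_right₀ hv (by norm_num))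
      (by positivity) (by positivity)) (norm_nonneg _))
  have h3 := mul_le_mul (mul_le_mul_of_nonneg_left h2 (norm_nonneg (u - v))) h1
    (Real.exp_nonneg _) (by positivity)
  exact h3.trans (le_of_eq (by ring))

/-- The quadratic remainder leaves one factor `u - v` after division. It costs one power of `(1 +
‖u‖)(1 + ‖v‖)`, and the squared `phaseQuot` costs four: this is the exponent 5 in `weightedSum`. -/
theorem norm_kernel_quot_sub_le {δ : Params m} {η : ℝ} (hδ : ‖δ‖ ≤ η) (k : Fin m) {u v : ℂ}
    (huv : u ≠ v) :
    ‖(Complex.exp ((u - v) * phaseQuot δ k u v) - 1) / (u - v) - phaseQuot δ k u v‖ ≤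
      ‖δ‖ ^ 2 * ((1 + ‖u‖) ^ 5 * (1 + ‖v‖) ^ 5 *
        (Real.exp (η * growth u) * Real.exp (η * growth v))) := by
  have hne := sub_ne_zero.2 huv
  have e : (Complex.exp ((u - v) * phaseQuot δ k u v) - 1) / (u - v) - phaseQuot δ k u v =
      (Complex.exp ((u - v) * phaseQuot δ k u v) - 1 - (u - v) * phaseQuot δ k u v) / (u - v) := by
    field_simp
  rw [e, norm_div]
  refine div_le_of_le_mul₀ (norm_nonneg _) (by positivity) ?_
  refine (norm_exp_sub_one_sub_le _).trans ?_
  rw [norm_mul, mul_pow]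
  have h1 := exp_abs_re_mul_phaseQuot_le hδ k u v
  have h2 := pow_le_pow_left₀ (norm_nonneg _) (norm_phaseQuot_le δ k u v) 2
  have h3 : ‖u - v‖ ≤ (1 + ‖u‖) * (1 + ‖v‖) := by
    have := norm_sub_le u v
    have : 0 ≤ ‖u‖ * ‖v‖ := by positivity
    linarith
  calc ‖u - v‖ ^ 2 * ‖phaseQuot δ k u v‖ ^ 2 * Real.exp |((u - v) * phaseQuot δ k u v).re|
      ≤ (((1 + ‖u‖) * (1 + ‖v‖)) * ‖u - v‖) * (‖δ‖ * ((1 + ‖u‖) ^ 2 * (1 + ‖v‖) ^ 2)) ^ 2 *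
        (Real.exp (η * growth u) * Real.exp (η * growth v)) := by
        refine mul_le_mul (mul_le_mul ?_ h2 (by positivity) (by positivity)) h1
          (Real.exp_nonneg _) (by positivity)
        rw [pow_two]
        exact mul_le_mul_of_nonneg_right h3 (norm_nonneg _)
    _ = _ := by ring

/-- The data at `p₀`: the vectors `f`, `g` formed with a fixed scalar have exponential moments, and
the kernel at `p₀` defines a bounded operator. -/
structure FrozenData (Ω : Support) (F G : ℂ → Fin (m + 1) → ℂ) (c : ℂ → ℂ) (p₀ : Params m)
    (η : ℝ) : Prop where
  orthogonal : ∀ u ∈ Ω.carrier, ∀ a, F u a * G u a = 0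
  expF : HasExpMoments Ω F c p₀ η
  expG : HasExpMoments Ω G (fun u => (c u)⁻¹) (-p₀) η
  exists_operator : ∃ T, IsIntegralOperator Ω T (iiksKernel (fVec F c p₀) (gVec G c p₀))

open Classical in
variable (Ω) in
/-- The operator with kernel `f(u)ᵀ g(v) / (u - v)` at the parameters `p`. -/
def deformedOp (F G : ℂ → Fin (m + 1) → ℂ) (c : ℂ → ℂ) (p : Params m) : Ω.L2 →L[ℂ] Ω.L2 :=
  if h : ∃ T, IsIntegralOperator Ω T (iiksKernel (fVec F c p) (gVec G c p)) then h.choose else 0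

variable (Ω) in
/-- The class of `z^i g_a` in `L²(Ω, |μ|)`. -/
def momG (G : ℂ → Fin (m + 1) → ℂ) (c : ℂ → ℂ) (i : ℕ) (a : Fin (m + 1)) (p : Params m) : Ω.L2 :=
  Ω.toL2 fun u => u ^ i * gVec G c p u a

theorem momG_eq_mom (G : ℂ → Fin (m + 1) → ℂ) (c : ℂ → ℂ) (i : ℕ) (a : Fin (m + 1))
    (p : Params m) : momG Ω G c i a p = mom Ω G (fun u => (c u)⁻¹) i a (-p) := by
  rw [momG, mom, gVec_eq_fVec]

variable (Ω) in
/-- The derivative of `deformedOp`. -/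
def opDeriv (F G : ℂ → Fin (m + 1) → ℂ) (c : ℂ → ℂ) (p : Params m) :
    Params m →L[ℝ] (Ω.L2 →L[ℂ] Ω.L2) :=
  let R := fun i j (k : Fin m) =>
    rankOne Ω (mom Ω F c i k.castSucc p) (momG Ω G c j k.castSucc p)
  ∑ k : Fin m, ((coordX k).smulRight (R 0 0 k) + (coordY k).smulRight (R 1 0 k + R 0 1 k) +
    (coordT k).smulRight (R 2 0 k + R 1 1 k + R 0 2 k))

variable (Ω) in
theorem contDiff_rankOne {n : WithTop ℕ∞} :
    ContDiff ℝ n fun x : Ω.L2 × Ω.L2 => rankOne Ω x.1 x.2 :=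
  ((rankOne Ω).bilinearRestrictScalars ℝ).isBoundedBilinearMap.contDiff

namespace FrozenData

variable {F G : ℂ → Fin (m + 1) → ℂ} {c : ℂ → ℂ} {p₀ : Params m} {η : ℝ}
  (hD : FrozenData Ω F G c p₀ η)
include hD

theorem memLp_momG {p : Params m} (hp : dist p p₀ < 2 * η) (i : ℕ)
    (k : Fin m) : MemLp (fun u => u ^ i * gVec G c p u k.castSucc) 2 Ω.absMeasure := by
  rw [gVec_eq_fVec]
  exact hD.expG.memLp_mom (by rwa [dist_neg_neg]) i k

theorem memLp_gVec {p : Params m} (hp : dist p p₀ < 2 * η) (a : Fin (m + 1)) :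
    MemLp (fun u => gVec G c p u a) 2 Ω.absMeasure := by
  rw [gVec_eq_fVec]
  exact hD.expG.memLp_fVec (by rwa [dist_neg_neg]) a

theorem fVec_mul_gVec (p : Params m) {u : ℂ} (hu : u ∈ Ω.carrier) (a : Fin (m + 1)) :
    fVec F c p u a * gVec G c p u a = 0 := by
  have := hD.orthogonal u hu a
  calc _ = (c u * expDiag p u a * ((c u)⁻¹ * (expDiag p u a)⁻¹)) * (F u a * G u a) := by
        rw [fVec, gVec]; ring
    _ = 0 := by rw [this, mul_zero]

theorem memLp_weightedSum_gVec : MemLp (weightedSum (gVec G c p₀) η) 2 Ω.absMeasure := by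
  rw [gVec_eq_fVec]
  exact hD.expG.memLp_weightedSum

theorem aestronglyMeasurable_iiksKernel {p : Params m} (hp : dist p p₀ < 2 * η) :
    AEStronglyMeasurable (Function.uncurry (iiksKernel (fVec F c p) (gVec G c p)))
      (Ω.absMeasure.prod Ω.absMeasure) := by
  have e : Function.uncurry (iiksKernel (fVec F c p) (gVec G c p)) = fun z : ℂ × ℂ =>
      (∑ a, fVec F c p z.1 a * gVec G c p z.2 a) * (z.1 - z.2)⁻¹ := by
    ext z
    rw [Function.uncurry, iiksKernel_eq_div, div_eq_mul_inv]
  rw [e]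
  exact (Finset.aestronglyMeasurable_fun_sum _ fun a _ =>
    (hD.expF.memLp_fVec hp a).1.comp_fst.mul (hD.memLp_gVec hp a).1.comp_snd).mul
    (measurable_fst.sub measurable_snd).inv.aestronglyMeasurable

/-- The difference of the kernels at `p` and `p₀` is dominated by a product of square integrable
functions, so it defines a bounded operator that is added to the given one at `p₀`. -/
theorem exists_deformed {p : Params m} (hp : dist p p₀ < η) :
    ∃ T, IsIntegralOperator Ω T (iiksKernel (fVec F c p) (gVec G c p)) := by
  obtain ⟨T₀, hT₀⟩ := hD.exists_operator
  have hη := hD.expF.pos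
  have hp2 : dist p p₀ < 2 * η := by linarith
  have h02 : dist p₀ p₀ < 2 * η := by rw [dist_self]; linarith
  let k : ℂ → ℂ → ℂ := fun u v => iiksKernel (fVec F c p) (gVec G c p) u v -
    iiksKernel (fVec F c p₀) (gVec G c p₀) u v
  have hE₁ := (hD.expF.memLp_weightedSum).const_mul ‖p - p₀‖
  have hE₂ := hD.memLp_weightedSum_gVec
  have hkb : ∀ u v, ‖k u v‖ ≤
      ‖p - p₀‖ * weightedSum (fVec F c p₀) η u * weightedSum (gVec G c p₀) η v := fun u v => by
    have := iiksKernel_add_sub F G c p₀ (p - p₀) u v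
    rw [add_sub_cancel] at this
    simp only [k, this]
    rw [mul_assoc]
    exact norm_sum_kernel_le F G c (by rw [dist_self]; exact hη.le) u v
      (fun i => norm_kernel_quot_le (by rw [← dist_eq_norm]; exact hp.le) i u v) (norm_nonneg _)
  have hkm : AEStronglyMeasurable (Function.uncurry k) (Ω.absMeasure.prod Ω.absMeasure) :=
    (hD.aestronglyMeasurable_iiksKernel hp2).sub (hD.aestronglyMeasurable_iiksKernel h02)
  obtain ⟨K, hK⟩ := exists_operator_of_kernel hkm hE₁ hE₂
    (ae_of_all _ fun u => weightedSum_nonneg _ _ _) (ae_of_all _ fun u => ae_of_all _ (hkb u))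
  have hK' : HasTruncKernel Ω K k := HasTruncKernel.of_integral hK (fun h => by
      filter_upwards [hkm.prodMk_left] with u hu
      exact integrable_kernel_mul hu hE₂ (ae_of_all _ (hkb u)) h)
    (ae_of_all _ fun u => by simp [k, iiksKernel])
  have := ((hT₀.hasTruncKernel (hD.memLp_gVec h02)).add hK').1
  refine ⟨T₀ + K, ?_⟩
  simpa [k] using this

theorem deformedOp_spec {p : Params m} (hp : dist p p₀ < η) :
    IsIntegralOperator Ω (deformedOp Ω F G c p) (iiksKernel (fVec F c p) (gVec G c p)) := by
  have h := hD.exists_deformed hp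
  rw [deformedOp, dif_pos h]
  exact h.choose_spec

theorem hasTruncKernel_rankOne {p : Params m} (hp : dist p p₀ < 2 * η) (i j : ℕ) (k : Fin m) :
    HasTruncKernel Ω (rankOne Ω (mom Ω F c i k.castSucc p) (momG Ω G c j k.castSucc p))
      fun u v => u ^ i * fVec F c p u k.castSucc * (v ^ j * gVec G c p v k.castSucc) :=
  CubicKP.hasTruncKernel_rankOne (hD.expF.memLp_mom hp i k) (hD.memLp_momG hp j k) fun u hu => by
    have := hD.fVec_mul_gVec p hu k.castSucc
    calc _ = u ^ i * u ^ j * (fVec F c p u k.castSucc * gVec G c p u k.castSucc) := by ring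
      _ = 0 := by rw [this, mul_zero]

/-- The divided differences of `z`, `z²`, `z³` are `1`, `u + v`, `u² + uv + v²`; each monomial
corresponds to one rank one operator. -/
theorem hasTruncKernel_opDeriv {p : Params m} (hp : dist p p₀ < 2 * η) (δ : Params m) :
    ∃ κ, HasTruncKernel Ω (opDeriv Ω F G c p δ) κ ∧ ∀ u v, κ u v =
      ∑ k : Fin m, fVec F c p u k.castSucc * gVec G c p v k.castSucc * phaseQuot δ k u v := by
  have hR := hD.hasTruncKernel_rankOne hp
  have e : opDeriv Ω F G c p δ = ∑ k : Fin m, (δ.1 k • rankOne Ω (mom Ω F c 0 k.castSucc p)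
      (momG Ω G c 0 k.castSucc p) + δ.2.1 k • (rankOne Ω (mom Ω F c 1 k.castSucc p)
      (momG Ω G c 0 k.castSucc p) + rankOne Ω (mom Ω F c 0 k.castSucc p)
      (momG Ω G c 1 k.castSucc p)) + δ.2.2 k • (rankOne Ω (mom Ω F c 2 k.castSucc p)
      (momG Ω G c 0 k.castSucc p) + rankOne Ω (mom Ω F c 1 k.castSucc p)
      (momG Ω G c 1 k.castSucc p) + rankOne Ω (mom Ω F c 0 k.castSucc p)
      (momG Ω G c 2 k.castSucc p))) := by
    simp only [opDeriv, _root_.sum_apply]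
    rfl
  refine ⟨_, by
    rw [e]
    exact HasTruncKernel.sum _ fun k _ => (((hR 0 0 k).smul _).add
      (((hR 1 0 k).add (hR 0 1 k)).smul _)).add
      ((((hR 2 0 k).add (hR 1 1 k)).add (hR 0 2 k)).smul _), fun u v => ?_⟩
  refine Finset.sum_congr rfl fun k _ => ?_
  rw [phaseQuot]
  ring

theorem hasFDerivAt_deformedOp {p : Params m} (hp : dist p p₀ < η) :
    HasFDerivAt (deformedOp Ω F G c) (opDeriv Ω F G c p) p := by
  have hη := hD.expF.pos
  refine hasFDerivAt_of_norm_le_sq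
    ((eLpNorm (weightedSum (fVec F c p₀) η) 2 Ω.absMeasure).toReal *
      (eLpNorm (weightedSum (gVec G c p₀) η) 2 Ω.absMeasure).toReal) ?_
  have hmem : ∀ᶠ δ in 𝓝 (0 : Params m), dist (p + δ) p₀ < η := by
    have : Tendsto (fun δ : Params m => p + δ) (𝓝 0) (𝓝 p) := by
      simpa using (continuous_const.add continuous_id).tendsto (0 : Params m) (f := fun δ => p + δ)
    exact this.eventually (Metric.isOpen_ball.mem_nhds hp)
  filter_upwards [Metric.ball_mem_nhds 0 hη, hmem] with δ hδ hpδ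
  rw [mem_ball_zero_iff] at hδ
  obtain ⟨κ, hκ, hκ'⟩ := hD.hasTruncKernel_opDeriv (show dist p p₀ < 2 * η by linarith) δ
  have hT : ∀ {q : Params m}, dist q p₀ < η → HasTruncKernel Ω (deformedOp Ω F G c q)
      (iiksKernel (fVec F c q) (gVec G c q)) := fun {q} hq =>
    (hD.deformedOp_spec hq).hasTruncKernel (hD.memLp_gVec (by linarith))
  have h1 := ((hT hpδ).sub (hT hp)).sub hκ
  refine (h1.norm_le hD.expF.memLp_weightedSum hD.memLp_weightedSum_gVec
    (weightedSum_nonneg _ _) (weightedSum_nonneg _ _) (C := ‖δ‖ ^ 2) (by positivity)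
    fun u hu v hv => ?_).trans (le_of_eq (by ring))
  rw [iiksKernel_add_sub, hκ']
  -- The kernels of the operators vanish on the diagonal by definition, that of the derivative by
  -- orthogonality.
  rcases eq_or_ne u v with rfl | huv
  · have : ∀ k : Fin m, fVec F c p u k.castSucc * gVec G c p u k.castSucc = 0 :=
      fun k => hD.fVec_mul_gVec p hu _
    simp only [this, zero_mul, Finset.sum_const_zero, sub_zero, norm_zero]
    exact mul_nonneg (by positivity) (mul_nonneg (weightedSum_nonneg _ _ _)
      (weightedSum_nonneg _ _ _))
  · rw [← Finset.sum_sub_distrib]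
    simp_rw [← mul_sub]
    exact norm_sum_kernel_le F G c hp.le u v
      (fun k => norm_kernel_quot_sub_le hδ.le k huv) (by positivity)

theorem contDiffOn_momG (n : ℕ) (i : ℕ) (k : Fin m) :
    ContDiffOn ℝ n (momG Ω G c i k.castSucc) (Metric.ball p₀ η) := by
  have := (contDiffOn_mom hD.expG n i k).comp (contDiff_neg.contDiffOn (s := Metric.ball p₀ η))
    fun p hp => by
      rw [Metric.mem_ball, dist_neg_neg]; exact hp
  exact this.congr fun p _ => momG_eq_mom G c i _ p

theorem contDiffOn_deformedOp (n : ℕ) :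
    ContDiffOn ℝ n (deformedOp Ω F G c) (Metric.ball p₀ η) := by
  -- No induction is needed: the derivative is a bilinear expression in moments, which are already
  -- smooth to every order.
  cases n with
  | zero =>
    exact contDiffOn_zero.2 fun p hp =>
      (hD.hasFDerivAt_deformedOp hp).continuousAt.continuousWithinAt
  | succ n =>
    refine (contDiffOn_succ_iff_hasFDerivWithinAt_of_uniqueDiffOn
      Metric.isOpen_ball.uniqueDiffOn).2 ⟨fun h => (WithTop.natCast_ne_top n h).elim,
      opDeriv Ω F G c, ?_, fun p hp => (hD.hasFDerivAt_deformedOp hp).hasFDerivWithinAt⟩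
    have hR : ∀ i j (k : Fin m), ContDiffOn ℝ n (fun p => rankOne Ω (mom Ω F c i k.castSucc p)
        (momG Ω G c j k.castSucc p)) (Metric.ball p₀ η) := fun i j k =>
      ContDiff.comp_contDiffOn (g := fun x : Ω.L2 × Ω.L2 => rankOne Ω x.1 x.2)
        (f := fun p => (mom Ω F c i k.castSucc p, momG Ω G c j k.castSucc p)) (contDiff_rankOne Ω)
        ((contDiffOn_mom hD.expF n i k).prodMk (hD.contDiffOn_momG n j k))
    refine ContDiffOn.sum fun k _ => ?_
    exact ((contDiffOn_const.smulRight (hR 0 0 k)).add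
      (contDiffOn_const.smulRight ((hR 1 0 k).add (hR 0 1 k)))).add
      (contDiffOn_const.smulRight (((hR 2 0 k).add (hR 1 1 k)).add (hR 0 2 k)))

end FrozenData

end CubicKP

namespace CubicKP

variable {m : ℕ} {Ω : Support}

/-! ### Derivatives of the moment matrices -/

theorem inverse_one_sub_hasFDerivAt {T : Params m → Ω.L2 →L[ℂ] Ω.L2}
    {T' : Params m →L[ℝ] (Ω.L2 →L[ℂ] Ω.L2)} {p : Params m} (hT : HasFDerivAt T T' p)
    (hu : IsUnit (1 - T p)) :
    ∃ D : Params m →L[ℝ] (Ω.L2 →L[ℂ] Ω.L2),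
      HasFDerivAt (fun p => Ring.inverse (1 - T p)) D p ∧
      ∀ δ, D δ = Ring.inverse (1 - T p) * T' δ * Ring.inverse (1 - T p) := by
  obtain ⟨x, hx⟩ := hu
  have h1 := hasFDerivAt_ringInverse (𝕜 := ℝ) x
  rw [hx] at h1
  have h2 := HasFDerivAt.comp (g := Ring.inverse) (f := fun p => 1 - T p) p h1 (hT.const_sub 1)
  refine ⟨_, h2, fun δ => ?_⟩
  rw [← hx, Ring.inverse_unit]
  -- The sign from differentiating an inverse cancels the one from `1 - T`.
  change -(↑x⁻¹ * -T' δ * ↑x⁻¹) = _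
  rw [mul_neg, neg_mul, neg_neg]

theorem pairing_inverse_hasFDerivAt {T : Params m → Ω.L2 →L[ℂ] Ω.L2}
    {T' : Params m →L[ℝ] (Ω.L2 →L[ℂ] Ω.L2)} {f g : Params m → Ω.L2} {f' g' : Params m →L[ℝ] Ω.L2}
    {p : Params m} (hT : HasFDerivAt T T' p) (hu : IsUnit (1 - T p)) (hf : HasFDerivAt f f' p)
    (hg : HasFDerivAt g g' p) :
    ∃ D : Params m →L[ℝ] ℂ,
      HasFDerivAt (fun p => pairing Ω (Ring.inverse (1 - T p) (f p)) (g p)) D p ∧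
      ∀ δ, D δ = pairing Ω (Ring.inverse (1 - T p) (f' δ)) (g p)
        + pairing Ω (Ring.inverse (1 - T p) (T' δ (Ring.inverse (1 - T p) (f p)))) (g p)
        + pairing Ω (Ring.inverse (1 - T p) (f p)) (g' δ) := by
  obtain ⟨R', hR, hR'⟩ := inverse_one_sub_hasFDerivAt hT hu
  have h1 := ((ContinuousLinearMap.id ℂ (Ω.L2 →L[ℂ] Ω.L2)).bilinearRestrictScalars
    ℝ).hasFDerivAt_of_bilinear hR hf
  have h2 := ((pairing Ω).bilinearRestrictScalars ℝ).hasFDerivAt_of_bilinear h1 hg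
  refine ⟨_, h2, fun δ => ?_⟩
  have e : R' δ (f p) = Ring.inverse (1 - T p) (T' δ (Ring.inverse (1 - T p) (f p))) := by
    rw [hR']; rfl
  change pairing Ω (Ring.inverse (1 - T p) (f p)) (g' δ) +
    pairing Ω (Ring.inverse (1 - T p) (f' δ) + R' δ (f p)) (g p) = _
  rw [map_add, _root_.add_apply, e]
  ring

/-- The matrix of moments `∫_Ω ((1 - T)⁻¹ z^i f)(z) z^j g(z)ᵀ dμ(z)`. -/
def momentMatrix (Ω : Support) (F G : ℂ → Fin (m + 1) → ℂ) (c : ℂ → ℂ) (i j : ℕ) (p : Params m) :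
    Matrix (Fin (m + 1)) (Fin (m + 1)) ℂ :=
  Matrix.of fun a b => pairing Ω (Ring.inverse (1 - deformedOp Ω F G c p) (mom Ω F c i a p))
    (momG Ω G c j b p)

/-- The direction of `∂_x`. -/
def dirX (S : Finset (Fin m)) : Params m := ∑ k ∈ S, (Pi.single k 1, 0, 0)

/-- The direction of `∂_y`. -/
def dirY (S : Finset (Fin m)) : Params m := ∑ k ∈ S, (0, Pi.single k 1, 0)

/-- The direction of `∂_t`. -/
def dirT (S : Finset (Fin m)) : Params m := ∑ k ∈ S, (0, 0, Pi.single k 1)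

theorem dirX_coord (S : Finset (Fin m)) (k : Fin m) : (coordX k) (dirX S) = (if k ∈ S then 1 else 0)
    ∧ (coordY k) (dirX S) = 0 ∧ (coordT k) (dirX S) = 0 := by
  simp [coordX, coordY, coordT, dirX]

theorem dirY_coord (S : Finset (Fin m)) (k : Fin m) : (coordX k) (dirY S) = 0
    ∧ (coordY k) (dirY S) = (if k ∈ S then 1 else 0) ∧ (coordT k) (dirY S) = 0 := by
  simp [coordX, coordY, coordT, dirY]

theorem dirT_coord (S : Finset (Fin m)) (k : Fin m) : (coordX k) (dirT S) = 0
    ∧ (coordY k) (dirT S) = 0 ∧ (coordT k) (dirT S) = (if k ∈ S then 1 else 0) := by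
  simp [coordX, coordY, coordT, dirT]

theorem castSucc_mem_liftSet {S : Finset (Fin m)} {k : Fin m} :
    k.castSucc ∈ liftSet S ↔ k ∈ S := by
  simp [liftSet]

theorem sum_map_liftSet {M : Type*} [AddCommMonoid M] (S : Finset (Fin m)) (w : Fin (m + 1) → M) :
    ∑ k ∈ liftSet S, w k = ∑ k ∈ S, w k.castSucc :=
  Finset.sum_map _ _ _

theorem last_notMem_liftSet (S : Finset (Fin m)) : Fin.last m ∉ liftSet S := by
  simp [liftSet, Fin.castSucc_ne_last]

section

variable {F G : ℂ → Fin (m + 1) → ℂ} {c : ℂ → ℂ} {p₀ : Params m} {η : ℝ}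

theorem mom_last_eq (F : ℂ → Fin (m + 1) → ℂ) (c : ℂ → ℂ) (i : ℕ) (p q : Params m) :
    mom Ω F c i (Fin.last m) p = mom Ω F c i (Fin.last m) q := by
  rw [mom, mom]
  simp_rw [fVec_last F c p q]

theorem HasExpMoments.contDiffOn_mom' (hE : HasExpMoments Ω F c p₀ η) (n i : ℕ)
    (a : Fin (m + 1)) : ContDiffOn ℝ n (mom Ω F c i a) (Metric.ball p₀ η) := by
  refine Fin.lastCases ?_ (fun k => contDiffOn_mom hE n i k) a
  exact contDiffOn_const.congr fun p _ => mom_last_eq F c i p p₀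

theorem HasExpMoments.exists_hasFDerivAt_mom (hE : HasExpMoments Ω F c p₀ η) {p : Params m}
    (hp : dist p p₀ < η) (S : Finset (Fin m)) (i : ℕ) (a : Fin (m + 1)) :
    ∃ D : Params m →L[ℝ] Ω.L2, HasFDerivAt (mom Ω F c i a) D p ∧
      D (dirX S) = (if a ∈ liftSet S then mom Ω F c (i + 1) a p else 0) ∧
      D (dirY S) = (if a ∈ liftSet S then mom Ω F c (i + 2) a p else 0) ∧
      D (dirT S) = (if a ∈ liftSet S then mom Ω F c (i + 3) a p else 0) := by
  refine Fin.lastCases ?_ (fun k => ?_) a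
  -- The last component is constant in the parameters, so its class is constant too, even when `zⁱ
  -- f` is not square integrable and the class is `0` by convention.
  · refine ⟨0, ?_, by simp [last_notMem_liftSet], by simp [last_notMem_liftSet],
      by simp [last_notMem_liftSet]⟩
    have : mom Ω F c i (Fin.last m) = fun _ => mom Ω F c i (Fin.last m) p₀ :=
      funext fun q => mom_last_eq F c i q p₀
    rw [this]
    exact hasFDerivAt_const _ _
  · refine ⟨_, hasFDerivAt_mom hE hp i k, ?_, ?_, ?_⟩ <;>
    simp only [momDeriv, _root_.add_apply, ContinuousLinearMap.smulRight_apply, dirX_coord,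
      dirY_coord, dirT_coord, castSucc_mem_liftSet] <;> split_ifs <;> simp

namespace FrozenData

variable (hD : FrozenData Ω F G c p₀ η)
include hD

theorem contDiffOn_momG' (n i : ℕ) (a : Fin (m + 1)) :
    ContDiffOn ℝ n (momG Ω G c i a) (Metric.ball p₀ η) := by
  have := (hD.expG.contDiffOn_mom' n i a).comp (contDiff_neg.contDiffOn (s := Metric.ball p₀ η))
    fun p hp => by
      rw [Metric.mem_ball, dist_neg_neg]; exact hp
  exact this.congr fun p _ => momG_eq_mom G c i _ p

theorem exists_hasFDerivAt_momG {p : Params m} (hp : dist p p₀ < η) (S : Finset (Fin m)) (i : ℕ)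
    (a : Fin (m + 1)) :
    ∃ D : Params m →L[ℝ] Ω.L2, HasFDerivAt (momG Ω G c i a) D p ∧
      D (dirX S) = (if a ∈ liftSet S then -momG Ω G c (i + 1) a p else 0) ∧
      D (dirY S) = (if a ∈ liftSet S then -momG Ω G c (i + 2) a p else 0) ∧
      D (dirT S) = (if a ∈ liftSet S then -momG Ω G c (i + 3) a p else 0) := by
  obtain ⟨D, h, hX, hY, hT⟩ := hD.expG.exists_hasFDerivAt_mom (p := -p)
    (by rwa [dist_neg_neg]) S i a
  have e : momG Ω G c i a = mom Ω G (fun u => (c u)⁻¹) i a ∘ Neg.neg := by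
    ext1 q
    exact momG_eq_mom G c i _ q
  refine ⟨-D, ?_, ?_, ?_, ?_⟩
  · rw [e]
    exact (h.comp p (hasFDerivAt_id p).neg).congr_fderiv (ContinuousLinearMap.ext fun δ => by simp)
  · rw [_root_.neg_apply, hX, momG_eq_mom]; split_ifs <;> simp
  · rw [_root_.neg_apply, hY, momG_eq_mom]; split_ifs <;> simp
  · rw [_root_.neg_apply, hT, momG_eq_mom]; split_ifs <;> simp

end FrozenData

theorem opDeriv_dir (S : Finset (Fin m)) (p : Params m) (h : Ω.L2) :
    opDeriv Ω F G c p (dirX S) h = ∑ k ∈ S,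
      pairing Ω h (momG Ω G c 0 k.castSucc p) • mom Ω F c 0 k.castSucc p ∧
    opDeriv Ω F G c p (dirY S) h = ∑ k ∈ S,
      (pairing Ω h (momG Ω G c 0 k.castSucc p) • mom Ω F c 1 k.castSucc p +
      pairing Ω h (momG Ω G c 1 k.castSucc p) • mom Ω F c 0 k.castSucc p) ∧
    opDeriv Ω F G c p (dirT S) h = ∑ k ∈ S,
      (pairing Ω h (momG Ω G c 0 k.castSucc p) • mom Ω F c 2 k.castSucc p +
      pairing Ω h (momG Ω G c 1 k.castSucc p) • mom Ω F c 1 k.castSucc p +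
      pairing Ω h (momG Ω G c 2 k.castSucc p) • mom Ω F c 0 k.castSucc p) := by
  refine ⟨?_, ?_, ?_⟩ <;>
  simp only [opDeriv, _root_.sum_apply, _root_.add_apply, ContinuousLinearMap.smulRight_apply,
    dirX_coord, dirY_coord, dirT_coord, ite_smul, one_smul, zero_smul, add_zero, zero_add,
    Finset.sum_ite_mem, Finset.univ_inter, rankOne_apply]

namespace FrozenData

variable (hD : FrozenData Ω F G c p₀ η)
include hD

/-- Product rule for `pairing (R zⁱf_a) (zʲg_b)`: the vector `f` raises `i` in rows of `S`, the
vector `g` raises `j` with a minus sign in columns of `S`, and `∂R = R (∂T) R` with `∂T` of finite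
rank gives the products of moments. -/
theorem exists_hasFDerivAt_momentMatrix {p : Params m} (hp : dist p p₀ < η)
    (hu : IsUnit (1 - deformedOp Ω F G c p)) (S : Finset (Fin m)) (i j : ℕ) (a b : Fin (m + 1)) :
    ∃ D : Params m →L[ℝ] ℂ, HasFDerivAt (fun p => momentMatrix Ω F G c i j p a b) D p ∧
      D (dirX S) = (if a ∈ liftSet S then momentMatrix Ω F G c (i + 1) j p a b else 0) -
        (if b ∈ liftSet S then momentMatrix Ω F G c i (j + 1) p a b else 0) +
        ∑ k ∈ liftSet S, momentMatrix Ω F G c i 0 p a k * momentMatrix Ω F G c 0 j p k b ∧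
      D (dirY S) = (if a ∈ liftSet S then momentMatrix Ω F G c (i + 2) j p a b else 0) -
        (if b ∈ liftSet S then momentMatrix Ω F G c i (j + 2) p a b else 0) +
        ((∑ k ∈ liftSet S, momentMatrix Ω F G c i 0 p a k * momentMatrix Ω F G c 1 j p k b) +
        ∑ k ∈ liftSet S, momentMatrix Ω F G c i 1 p a k * momentMatrix Ω F G c 0 j p k b) ∧
      D (dirT S) = (if a ∈ liftSet S then momentMatrix Ω F G c (i + 3) j p a b else 0) -
        (if b ∈ liftSet S then momentMatrix Ω F G c i (j + 3) p a b else 0) +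
        ((∑ k ∈ liftSet S, momentMatrix Ω F G c i 0 p a k * momentMatrix Ω F G c 2 j p k b) +
        (∑ k ∈ liftSet S, momentMatrix Ω F G c i 1 p a k * momentMatrix Ω F G c 1 j p k b) +
        ∑ k ∈ liftSet S, momentMatrix Ω F G c i 2 p a k * momentMatrix Ω F G c 0 j p k b) := by
  obtain ⟨f', hf, fX, fY, fT⟩ := hD.expF.exists_hasFDerivAt_mom hp S i a
  obtain ⟨g', hg, gX, gY, gT⟩ := hD.exists_hasFDerivAt_momG hp S j b
  obtain ⟨D, h, hδ⟩ := pairing_inverse_hasFDerivAt (hD.hasFDerivAt_deformedOp hp) hu hf hg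
  refine ⟨D, h, ?_, ?_, ?_⟩
  · rw [hδ, fX, gX, (opDeriv_dir S p _).1]
    by_cases ha : a ∈ liftSet S <;> by_cases hb : b ∈ liftSet S <;>
    simp only [ha, hb, if_true, if_false, momentMatrix, Matrix.of_apply, sum_map_liftSet, map_sum,
      map_neg, map_zero, map_smul, _root_.sum_apply, _root_.zero_apply,
      _root_.smul_apply, smul_eq_mul] <;> ring
  · rw [hδ, fY, gY, (opDeriv_dir S p _).2.1]
    by_cases ha : a ∈ liftSet S <;> by_cases hb : b ∈ liftSet S <;>
    simp only [ha, hb, if_true, if_false, momentMatrix, Matrix.of_apply, sum_map_liftSet, map_sum,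
      map_add, map_neg, map_zero, map_smul, _root_.sum_apply, _root_.add_apply, _root_.zero_apply,
      _root_.smul_apply, smul_eq_mul, Finset.sum_add_distrib] <;> ring
  · rw [hδ, fT, gT, (opDeriv_dir S p _).2.2]
    by_cases ha : a ∈ liftSet S <;> by_cases hb : b ∈ liftSet S <;>
    simp only [ha, hb, if_true, if_false, momentMatrix, Matrix.of_apply, sum_map_liftSet, map_sum,
      map_add, map_neg, map_zero, map_smul, _root_.sum_apply, _root_.add_apply, _root_.zero_apply,
      _root_.smul_apply, smul_eq_mul, Finset.sum_add_distrib] <;> ring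

/-- This pairs `[z, R]` with `zⁱ f_k` and `zʲ g_l`. Only `k, l ≤ m` are allowed, since the last
components need not have moments; in the sum over all `a` they occur without powers of `z`. -/
theorem momentMatrix_comm {p : Params m} (hp : dist p p₀ < η)
    (hu : IsUnit (1 - deformedOp Ω F G c p)) (i j : ℕ) (k l : Fin m) :
    momentMatrix Ω F G c i (j + 1) p k.castSucc l.castSucc =
      momentMatrix Ω F G c (i + 1) j p k.castSucc l.castSucc +
      ∑ a, momentMatrix Ω F G c i 0 p k.castSucc a * momentMatrix Ω F G c 0 j p a l.castSucc := by
  have hη := hD.expF.pos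
  have hp2 : dist p p₀ < 2 * η := by linarith
  have eF := hD.expF.memLp_mom hp2 (i + 1) k
  have eG := hD.memLp_momG hp2 (j + 1) l
  simp only [pow_succ', mul_assoc] at eF eG
  have := (hD.deformedOp_spec hp).pairing_inverse_mul_id (fun a => hD.expF.memLp_fVec hp2 a)
    (fun a => hD.memLp_gVec hp2 a) (fun u hu a => hD.fVec_mul_gVec p hu a) hu
    (hD.expF.memLp_mom hp2 i k) eF (hD.memLp_momG hp2 j l) eG
  simp only [momentMatrix, Matrix.of_apply, mom, momG, pow_succ', mul_assoc, pow_zero, one_mul]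
  exact this

theorem isOpen_regular :
    IsOpen {p | p ∈ Metric.ball p₀ η ∧ IsUnit (1 - deformedOp Ω F G c p)} := by
  have hc : ContinuousOn (fun p => 1 - deformedOp Ω F G c p) (Metric.ball p₀ η) :=
    continuousOn_const.sub (hD.contDiffOn_deformedOp 0).continuousOn
  exact hc.isOpen_inter_preimage Metric.isOpen_ball Units.isOpen

theorem contDiffOn_momentMatrix (n i j : ℕ) (a b : Fin (m + 1)) :
    ContDiffOn ℝ n (fun p => momentMatrix Ω F G c i j p a b)
      {p | p ∈ Metric.ball p₀ η ∧ IsUnit (1 - deformedOp Ω F G c p)} := by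
  have hsub : {p | p ∈ Metric.ball p₀ η ∧ IsUnit (1 - deformedOp Ω F G c p)} ⊆
      Metric.ball p₀ η := fun p hp => hp.1
  have hR : ContDiffOn ℝ n (fun p => Ring.inverse (1 - deformedOp Ω F G c p))
      {p | p ∈ Metric.ball p₀ η ∧ IsUnit (1 - deformedOp Ω F G c p)} := fun p hp => by
    obtain ⟨x, hx⟩ := hp.2
    have h1 : ContDiffAt ℝ n Ring.inverse (1 - deformedOp Ω F G c p) := by
      rw [← hx]; exact contDiffAt_ringInverse ℝ x
    exact ContDiffAt.comp_contDiffWithinAt (f := fun p => 1 - deformedOp Ω F G c p) p h1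
      ((contDiffOn_const.sub ((hD.contDiffOn_deformedOp n).mono hsub)) p hp)
  have h1 : ContDiffOn ℝ n (fun p => Ring.inverse (1 - deformedOp Ω F G c p) (mom Ω F c i a p))
      {p | p ∈ Metric.ball p₀ η ∧ IsUnit (1 - deformedOp Ω F G c p)} :=
    ContDiff.comp_contDiffOn (g := fun x : (Ω.L2 →L[ℂ] Ω.L2) × Ω.L2 => x.1 x.2)
      (f := fun p => (Ring.inverse (1 - deformedOp Ω F G c p), mom Ω F c i a p))
      ((ContinuousLinearMap.id ℂ (Ω.L2 →L[ℂ] Ω.L2)).bilinearRestrictScalars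
        ℝ).isBoundedBilinearMap.contDiff
      (hR.prodMk ((hD.expF.contDiffOn_mom' n i a).mono hsub))
  exact ContDiff.comp_contDiffOn (g := fun x : Ω.L2 × Ω.L2 => pairing Ω x.1 x.2)
    (f := fun p => (Ring.inverse (1 - deformedOp Ω F G c p) (mom Ω F c i a p), momG Ω G c j b p))
    ((pairing Ω).bilinearRestrictScalars ℝ).isBoundedBilinearMap.contDiff
    (h1.prodMk ((hD.contDiffOn_momG' n j b).mono hsub))

end FrozenData

end

/-! ### Blocks -/

theorem blockPerm_inl_mem (S : Finset (Fin m)) (i : Fin S.card) :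
    blockPerm S (Sum.inl i) ∈ liftSet S := by
  simp [blockPerm]

theorem blockPerm_inr_notMem (S : Finset (Fin m)) (i : Fin (m + 1 - S.card)) :
    blockPerm S (Sum.inr i) ∉ liftSet S := by
  have h := Finset.orderEmbOfFin_mem (liftSet S)ᶜ (card_compl_liftSet S) i
  rw [blockPerm, finSumEquivOfFinset_inr]
  exact Finset.mem_compl.1 h

theorem sum_liftSet (S : Finset (Fin m)) (w : Fin (m + 1) → ℂ) :
    ∑ k ∈ liftSet S, w k = ∑ i : Fin S.card, w (blockPerm S (Sum.inl i)) := by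
  have h : ∑ k, (if k ∈ liftSet S then w k else 0) = ∑ k ∈ liftSet S, w k := by simp
  rw [← h, ← (blockPerm S).sum_comp, Fintype.sum_sum_type]
  simp [blockPerm_inl_mem, blockPerm_inr_notMem]

theorem sum_blocks (S : Finset (Fin m)) (w : Fin (m + 1) → ℂ) :
    ∑ k, w k = (∑ i : Fin S.card, w (blockPerm S (Sum.inl i))) +
      ∑ i : Fin (m + 1 - S.card), w (blockPerm S (Sum.inr i)) := by
  rw [← (blockPerm S).sum_comp, Fintype.sum_sum_type]

theorem exists_castSucc_eq {S : Finset (Fin m)} {a : Fin (m + 1)} (h : a ∈ liftSet S) :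
    ∃ k : Fin m, a = k.castSucc := by
  obtain ⟨k, -, rfl⟩ := Finset.mem_map.1 h
  exact ⟨k, rfl⟩

theorem qBlock_apply (S : Finset (Fin m)) (A : Matrix (Fin (m + 1)) (Fin (m + 1)) ℂ) (i j) :
    qBlock S A i j = A (blockPerm S (Sum.inl i)) (blockPerm S (Sum.inl j)) := rfl

theorem pBlock_apply (S : Finset (Fin m)) (A : Matrix (Fin (m + 1)) (Fin (m + 1)) ℂ) (i j) :
    pBlock S A i j = A (blockPerm S (Sum.inl i)) (blockPerm S (Sum.inr j)) := rfl

theorem rBlock_apply (S : Finset (Fin m)) (A : Matrix (Fin (m + 1)) (Fin (m + 1)) ℂ) (i j) :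
    rBlock S A i j = A (blockPerm S (Sum.inr i)) (blockPerm S (Sum.inl j)) := rfl

theorem sBlock_apply (S : Finset (Fin m)) (A : Matrix (Fin (m + 1)) (Fin (m + 1)) ℂ) (i j) :
    sBlock S A i j = A (blockPerm S (Sum.inr i)) (blockPerm S (Sum.inr j)) := rfl

/-- The flows raise indices only in rows and columns of `S`, so the complementary block, which
contains the last index, is never multiplied by `z`. In `comm` the sum over all indices splits into
the products `q q` and `p r`. -/
theorem FrozenData.momentHierarchy {F G : ℂ → Fin (m + 1) → ℂ} {c : ℂ → ℂ} {p₀ : Params m} {η : ℝ}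
    (hD : FrozenData Ω F G c p₀ η) (S : Finset (Fin m)) :
    MomentHierarchy {p | p ∈ Metric.ball p₀ η ∧ IsUnit (1 - deformedOp Ω F G c p)}
      (dirX S) (dirY S) (dirT S)
      (fun i j p => qBlock S (momentMatrix Ω F G c i j p))
      (fun i p => pBlock S (momentMatrix Ω F G c i 0 p))
      (fun j p => rBlock S (momentMatrix Ω F G c 0 j p))
      (fun p => sBlock S (momentMatrix Ω F G c 0 0 p)) where
  comm i j z hz := by
    ext a b
    obtain ⟨k, hk⟩ := exists_castSucc_eq (blockPerm_inl_mem S a)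
    obtain ⟨l, hl⟩ := exists_castSucc_eq (blockPerm_inl_mem S b)
    simp only [Matrix.add_apply, Matrix.mul_apply, qBlock_apply, pBlock_apply, rBlock_apply]
    rw [hk, hl, hD.momentMatrix_comm hz.1 hz.2, sum_blocks S, add_assoc]
  q_x i j z hz a b := by
    obtain ⟨D, h, h1, -, -⟩ := hD.exists_hasFDerivAt_momentMatrix hz.1 hz.2 S i j
      (blockPerm S (Sum.inl a)) (blockPerm S (Sum.inl b))
    refine ⟨h.differentiableAt, ?_⟩
    simp only [qBlock_apply, h.fderiv, h1, blockPerm_inl_mem, if_true, sum_liftSet,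
      Matrix.add_apply, Matrix.sub_apply, Matrix.mul_apply]
  q_y i j z hz a b := by
    obtain ⟨D, h, -, h1, -⟩ := hD.exists_hasFDerivAt_momentMatrix hz.1 hz.2 S i j
      (blockPerm S (Sum.inl a)) (blockPerm S (Sum.inl b))
    refine ⟨h.differentiableAt, ?_⟩
    simp only [qBlock_apply, h.fderiv, h1, blockPerm_inl_mem, if_true, sum_liftSet,
      Matrix.add_apply, Matrix.sub_apply, Matrix.mul_apply]
  p_x i z hz a b := by
    obtain ⟨D, h, h1, -, -⟩ := hD.exists_hasFDerivAt_momentMatrix hz.1 hz.2 S i 0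
      (blockPerm S (Sum.inl a)) (blockPerm S (Sum.inr b))
    refine ⟨h.differentiableAt, ?_⟩
    simp only [qBlock_apply, pBlock_apply, h.fderiv, h1, blockPerm_inl_mem, blockPerm_inr_notMem,
      if_true, if_false, sub_zero, sum_liftSet, Matrix.add_apply, Matrix.mul_apply]
  p_y i z hz a b := by
    obtain ⟨D, h, -, h1, -⟩ := hD.exists_hasFDerivAt_momentMatrix hz.1 hz.2 S i 0
      (blockPerm S (Sum.inl a)) (blockPerm S (Sum.inr b))
    refine ⟨h.differentiableAt, ?_⟩
    simp only [qBlock_apply, pBlock_apply, h.fderiv, h1, blockPerm_inl_mem, blockPerm_inr_notMem,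
      if_true, if_false, sub_zero, sum_liftSet, Matrix.add_apply, Matrix.mul_apply]
  p_t i z hz a b := by
    obtain ⟨D, h, -, -, h1⟩ := hD.exists_hasFDerivAt_momentMatrix hz.1 hz.2 S i 0
      (blockPerm S (Sum.inl a)) (blockPerm S (Sum.inr b))
    refine ⟨h.differentiableAt, ?_⟩
    simp only [qBlock_apply, pBlock_apply, h.fderiv, h1, blockPerm_inl_mem, blockPerm_inr_notMem,
      if_true, if_false, sub_zero, sum_liftSet, Matrix.add_apply, Matrix.mul_apply]
  r_x j z hz a b := by
    obtain ⟨D, h, h1, -, -⟩ := hD.exists_hasFDerivAt_momentMatrix hz.1 hz.2 S 0 j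
      (blockPerm S (Sum.inr a)) (blockPerm S (Sum.inl b))
    refine ⟨h.differentiableAt, ?_⟩
    simp only [qBlock_apply, rBlock_apply, h.fderiv, h1, blockPerm_inl_mem, blockPerm_inr_notMem,
      if_true, if_false, zero_sub, sum_liftSet, Matrix.add_apply, Matrix.neg_apply,
      Matrix.mul_apply]
  r_y j z hz a b := by
    obtain ⟨D, h, -, h1, -⟩ := hD.exists_hasFDerivAt_momentMatrix hz.1 hz.2 S 0 j
      (blockPerm S (Sum.inr a)) (blockPerm S (Sum.inl b))
    refine ⟨h.differentiableAt, ?_⟩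
    simp only [qBlock_apply, rBlock_apply, h.fderiv, h1, blockPerm_inl_mem, blockPerm_inr_notMem,
      if_true, if_false, zero_sub, sum_liftSet, Matrix.add_apply, Matrix.neg_apply,
      Matrix.mul_apply]
  r_t j z hz a b := by
    obtain ⟨D, h, -, -, h1⟩ := hD.exists_hasFDerivAt_momentMatrix hz.1 hz.2 S 0 j
      (blockPerm S (Sum.inr a)) (blockPerm S (Sum.inl b))
    refine ⟨h.differentiableAt, ?_⟩
    simp only [qBlock_apply, rBlock_apply, h.fderiv, h1, blockPerm_inl_mem, blockPerm_inr_notMem,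
      if_true, if_false, zero_sub, sum_liftSet, Matrix.add_apply, Matrix.neg_apply,
      Matrix.mul_apply]
  s_x z hz a b := by
    obtain ⟨D, h, h1, -, -⟩ := hD.exists_hasFDerivAt_momentMatrix hz.1 hz.2 S 0 0
      (blockPerm S (Sum.inr a)) (blockPerm S (Sum.inr b))
    refine ⟨h.differentiableAt, ?_⟩
    simp only [pBlock_apply, rBlock_apply, sBlock_apply, h.fderiv, h1, blockPerm_inr_notMem,
      if_false, sub_zero, zero_add, sum_liftSet, Matrix.mul_apply]
  s_y z hz a b := by
    obtain ⟨D, h, -, h1, -⟩ := hD.exists_hasFDerivAt_momentMatrix hz.1 hz.2 S 0 0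
      (blockPerm S (Sum.inr a)) (blockPerm S (Sum.inr b))
    refine ⟨h.differentiableAt, ?_⟩
    simp only [pBlock_apply, rBlock_apply, sBlock_apply, h.fderiv, h1, blockPerm_inr_notMem,
      if_false, sub_zero, zero_add, sum_liftSet, Matrix.add_apply, Matrix.mul_apply]

end CubicKP

namespace CubicKP

variable {m : ℕ} {Ω : Support}

/-! ### Freezing the scalar -/

/-- The ratio of two scalars can be replaced by a measurable function. -/
theorem exists_measurable_gauge {f g f₀ g₀ : ℂ → Fin (m + 1) → ℂ}
    (hf : ∀ a, AEStronglyMeasurable (fun u => f u a) Ω.absMeasure)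
    (hg : ∀ a, AEStronglyMeasurable (fun u => g u a) Ω.absMeasure)
    (hf₀ : ∀ a, AEStronglyMeasurable (fun u => f₀ u a) Ω.absMeasure)
    (hg₀ : ∀ a, AEStronglyMeasurable (fun u => g₀ u a) Ω.absMeasure) {κ : ℂ → ℂ}
    (hκ : ∀ R : ℝ, ∃ B : ℝ, ∀ u ∈ Ω.carrier, ‖u‖ ≤ R → ‖κ u‖ ≤ B)
    (hκf : ∀ u ∈ Ω.carrier, ∀ a, f₀ u a = κ u * f u a)
    (hκg : ∀ u ∈ Ω.carrier, ∀ a, g u a = κ u * g₀ u a) :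
    ∃ s : ℂ → ℂ, AEStronglyMeasurable s Ω.absMeasure ∧
      (∀ R : ℝ, ∃ B : ℝ, ∀ u ∈ Ω.carrier, ‖u‖ ≤ R → ‖s u‖ ≤ B) ∧
      (∀ u ∈ Ω.carrier, ∀ a, f₀ u a = s u * f u a) ∧
      ∀ u ∈ Ω.carrier, ∀ a, g u a = s u * g₀ u a := by
  let N : ℂ → ℝ := fun u => ∑ a, (‖f u a‖ ^ 2 + ‖g₀ u a‖ ^ 2)
  -- Least squares solution of `f₀ = s f`, `g = s g₀`, measurable by its formula. It equals `κ`
  -- unless `f` and `g₀` both vanish; then `f₀` and `g` vanish too, and the value `s = 0` from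
  -- division by zero is harmless.
  let s : ℂ → ℂ := fun u =>
    (∑ a, (star (f u a) * f₀ u a + star (g₀ u a) * g u a)) / (N u : ℂ)
  have hs : ∀ u ∈ Ω.carrier, N u ≠ 0 → s u = κ u := fun u hu hN => by
    have hN' : (N u : ℂ) ≠ 0 := Complex.ofReal_ne_zero.2 hN
    rw [div_eq_iff hN', Complex.ofReal_sum, Finset.mul_sum]
    refine Finset.sum_congr rfl fun a _ => ?_
    have key : ∀ z : ℂ, star z * (κ u * z) = κ u * ((‖z‖ ^ 2 : ℝ) : ℂ) := fun z => by
      rw [Complex.ofReal_pow, ← Complex.conj_mul']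
      change star z * (κ u * z) = κ u * (star z * z)
      ring
    rw [hκf u hu, hκg u hu, key, key, Complex.ofReal_add, mul_add]
  have hz : ∀ u, N u = 0 → ∀ a, f u a = 0 ∧ g₀ u a = 0 := fun u hN a => by
    have h := (Finset.sum_eq_zero_iff_of_nonneg fun a _ =>
      add_nonneg (sq_nonneg ‖f u a‖) (sq_nonneg ‖g₀ u a‖)).1 hN a (Finset.mem_univ a)
    have h' := (add_eq_zero_iff_of_nonneg (sq_nonneg _) (sq_nonneg _)).1 h
    simpa using h'
  refine ⟨s, ?_, fun R => ?_, fun u hu a => ?_, fun u hu a => ?_⟩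
  · refine (AEMeasurable.div ?_ ?_).aestronglyMeasurable
    · exact Finset.aemeasurable_fun_sum _ fun a _ =>
        ((hf a).star.aemeasurable.mul (hf₀ a).aemeasurable).add
          ((hg₀ a).star.aemeasurable.mul (hg a).aemeasurable)
    · exact Complex.measurable_ofReal.comp_aemeasurable (Finset.aemeasurable_fun_sum _ fun a _ =>
        ((hf a).norm.aemeasurable.pow_const 2).add ((hg₀ a).norm.aemeasurable.pow_const 2))
  · obtain ⟨B, hB⟩ := hκ R
    refine ⟨max B 0, fun u hu hR => ?_⟩
    by_cases hN : N u = 0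
    · simp [s, hN]
    · rw [hs u hu hN]
      exact (hB u hu hR).trans (le_max_left _ _)
  · by_cases hN : N u = 0
    · rw [hκf u hu a, (hz u hN a).1, mul_zero, mul_zero]
    · rw [hs u hu hN, hκf u hu a]
  · by_cases hN : N u = 0
    · rw [hκg u hu a, (hz u hN a).2, mul_zero, mul_zero]
    · rw [hs u hu hN, hκg u hu a]

theorem phiOne_apply {F G : ℂ → Fin (m + 1) → ℂ} {c : ℂ → ℂ} {p : Params m} {T : Ω.L2 →L[ℂ] Ω.L2}
    {b : Fin (m + 1)} (hg : MemLp (fun u => gVec G c p u b) 2 Ω.absMeasure) (a : Fin (m + 1)) :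
    phiOne Ω F G c p T a b = pairing Ω
      (Ring.inverse (1 - T) (Ω.toL2 fun u => fVec F c p u a)) (Ω.toL2 fun u => gVec G c p u b) := by
  rw [pairing_apply, phiOne, Matrix.of_apply]
  refine integral_congr_ae' Ω ?_
  filter_upwards [toL2_coeFn hg] with u hu
  rw [hu]

theorem momentMatrix_zero (F G : ℂ → Fin (m + 1) → ℂ) (c : ℂ → ℂ) (p : Params m)
    (a b : Fin (m + 1)) : momentMatrix Ω F G c 0 0 p a b = pairing Ω
      (Ring.inverse (1 - deformedOp Ω F G c p) (Ω.toL2 fun u => fVec F c p u a))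
      (Ω.toL2 fun u => gVec G c p u b) := by
  simp only [momentMatrix, Matrix.of_apply, mom, momG, pow_zero, one_mul]

/-- `Φ₁` can be computed with the scalar frozen at `p₀`. -/
theorem FrozenData.phiOne_eq_momentMatrix {F G : ℂ → Fin (m + 1) → ℂ} {c₀ c : ℂ → ℂ}
    {p₀ p : Params m} {η : ℝ} (hD : FrozenData Ω F G c₀ p₀ η) (hp : dist p p₀ < η)
    (hu₀ : IsUnit (1 - deformedOp Ω F G c₀ p)) (h₀ : ∀ u ∈ Ω.carrier, c₀ u ≠ 0)
    {T : Ω.L2 →L[ℂ] Ω.L2} (hT : IsCubicIntegrable Ω F G c p T) (hu : IsUnit (1 - T))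
    (hb : ∀ R : ℝ, ∃ B : ℝ, ∀ u ∈ Ω.carrier, ‖u‖ ≤ R → ‖c₀ u‖ ≤ B * ‖c u‖) :
    phiOne Ω F G c p T = momentMatrix Ω F G c₀ 0 0 p := by
  have hη := hD.expF.pos
  have hp2 : dist p p₀ < 2 * η := by linarith
  have hf₀ : ∀ a, MemLp (fun u => fVec F c₀ p u a) 2 Ω.absMeasure :=
    fun a => hD.expF.memLp_fVec hp2 a
  have hg₀ : ∀ a, MemLp (fun u => gVec G c₀ p u a) 2 Ω.absMeasure := fun a => hD.memLp_gVec hp2 a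
  -- The ratio `c₀ / c` conjugates the operator with scalar `c` into the one with scalar `c₀`; it
  -- may fail to be measurable and is replaced.
  obtain ⟨s, hs, hsb, hsf, hsg⟩ := exists_measurable_gauge (κ := fun u => c₀ u / c u)
    (fun a => (hT.f_memL2 a).aestronglyMeasurable) (fun a => (hT.g_memL2 a).aestronglyMeasurable)
    (fun a => (hf₀ a).aestronglyMeasurable) (fun a => (hg₀ a).aestronglyMeasurable)
    (fun R => by
      obtain ⟨B, hB⟩ := hb R
      refine ⟨B, fun u hu hR => ?_⟩
      rw [norm_div, div_le_iff₀ (norm_pos_iff.2 (hT.scalar_ne_zero u hu))]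
      exact hB u hu hR)
    (fun u hu a => by
      have := hT.scalar_ne_zero u hu
      simp only [fVec]
      field_simp)
    (fun u hu a => by
      have h1 := hT.scalar_ne_zero u hu
      have h2 := h₀ u hu
      simp only [gVec]
      field_simp)
  ext a b
  rw [phiOne_apply (hT.g_memL2 b), momentMatrix_zero]
  exact pairing_inverse_gauge hT.f_memL2 hT.g_memL2 hf₀ hg₀ hT.kernel (hD.deformedOp_spec hp) hu hu₀
    hs hsb hsf hsg a b

theorem sumPartial_congr {ι κ : Type} {e : Fin m → Params m} {S : Finset (Fin m)}
    {A B : Params m → Matrix ι κ ℂ} {V : Set (Params m)} (hV : IsOpen V) (h : Set.EqOn A B V) :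
    Set.EqOn (sumPartial e S A) (sumPartial e S B) V := fun z hz => by
  ext i j
  simp only [sumPartial, Matrix.of_apply]
  refine Finset.sum_congr rfl fun k _ => Filter.EventuallyEq.lineDeriv_eq ?_
  filter_upwards [hV.mem_nhds hz] with w hw
  rw [h hw]

/-- Near each point of `U`, the matrix `Φ₁` is the lowest member of a moment hierarchy. -/
theorem exists_frozenData {F G : ℂ → Fin (m + 1) → ℂ} {c : Params m → ℂ → ℂ}
    {H : Params m → (Ω.L2 →L[ℂ] Ω.L2)} {U : Set (Params m)} (hU : IsOpen U)
    (hH : ∀ p ∈ U, IsCubicIntegrable Ω F G (c p) p (H p)) (hc : IsRegularScalar Ω F G c U)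
    (hinv : ∀ p ∈ U, IsUnit (1 - H p)) {p₀ : Params m} (hp₀ : p₀ ∈ U) :
    ∃ η, FrozenData Ω F G (c p₀) p₀ η ∧
      p₀ ∈ {p | p ∈ Metric.ball p₀ η ∧ IsUnit (1 - deformedOp Ω F G (c p₀) p)} ∧
      Set.EqOn (fun p => phiOne Ω F G (c p) p (H p)) (momentMatrix Ω F G (c p₀) 0 0)
        {p | p ∈ Metric.ball p₀ η ∧ IsUnit (1 - deformedOp Ω F G (c p₀) p)} := by
  obtain ⟨ε, hε, hball⟩ := Metric.eventually_nhds_iff.1 ((hc p₀ hp₀).and (hU.mem_nhds hp₀))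
  -- Any radius `η` with `3η < ε` would serve in `HasExpMoments.of_ball`.
  have hη : 0 < ε / 6 := by positivity
  have hD : FrozenData Ω F G (c p₀) p₀ (ε / 6) :=
    { orthogonal := (hH p₀ hp₀).orthogonal
      expF := .of_ball hε (fun p hp a => ((hball hp).1.2 a).1) hη (by linarith)
      -- The vector `g` is an `f`-type vector at `-p` with scalar `c⁻¹`, so the same ball is used
      -- after reflection.
      expG := .of_ball hε (fun p hp a => by
        have h := ((hball (y := -p) (by rwa [← dist_neg_neg, neg_neg])).1.2 a).2
        rwa [gVec_eq_fVec, neg_neg] at h) hη (by linarith)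
      exists_operator := ⟨H p₀, (hH p₀ hp₀).kernel⟩ }
  refine ⟨ε / 6, hD, ⟨Metric.mem_ball_self hη, ?_⟩, fun p hp => ?_⟩
  -- At `p₀` the chosen operator is `H p₀` by uniqueness, so the base point lies in the open set of
  -- regular parameters.
  · rw [(hD.deformedOp_spec (by simpa using hη)).unique (hH p₀ hp₀).kernel]
    exact hinv p₀ hp₀
  · have h := hball (y := p) ((Metric.mem_ball.1 hp.1).trans (by linarith))
    refine hD.phiOne_eq_momentMatrix hp.1 hp.2 (hH p₀ hp₀).scalar_ne_zero (hH p h.2) (hinv p h.2)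
      fun R => ?_
    obtain ⟨B, hB⟩ := h.1.1 R
    exact ⟨B, fun u hu hR => (hB u hu hR).2⟩

end CubicKP

end

/-! ### The matrix KP theorem -/

theorem mainTheorem2 (m : ℕ) (Ω : CubicKP.Support) (F G : ℂ → Fin (m + 1) → ℂ)
    (c : CubicKP.Params m → ℂ → ℂ) (H : CubicKP.Params m → (Ω.L2 →L[ℂ] Ω.L2))
    (U : Set (CubicKP.Params m)) (hU : IsOpen U)
    (hH : ∀ p ∈ U, CubicKP.IsCubicIntegrable Ω F G (c p) p (H p))
    (hc : CubicKP.IsRegularScalar Ω F G c U)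
    (hinv : ∀ p ∈ U, IsUnit (1 - H p))
    (S : Finset (Fin m)) (hS : S.Nonempty) :
    let Φ₁ := fun p => CubicKP.phiOne Ω F G (c p) p (H p)
    let q := fun p => CubicKP.qBlock S (Φ₁ p)
    let s := fun p => CubicKP.sBlock S (Φ₁ p)
    let u := fun p => CubicKP.pBlock S (Φ₁ p) * CubicKP.rBlock S (Φ₁ p)
    let v := fun p => CubicKP.rBlock S (Φ₁ p) * CubicKP.pBlock S (Φ₁ p)
    (∀ a b, ContDiffOn ℝ 3 (fun p => Φ₁ p a b) U) ∧
    ∀ p ∈ U,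
      ((-4 : ℂ) • CubicKP.dT S u p
          + CubicKP.dX S (CubicKP.dX S (CubicKP.dX S u)) p
          + (6 : ℂ) • CubicKP.dX S (fun p' => u p' ^ 2) p
          - (3 : ℂ) • CubicKP.dY S (CubicKP.dY S q) p
          + (6 : ℂ) • (u p * CubicKP.dY S q p - CubicKP.dY S q p * u p) = 0 ∧
        CubicKP.dX S q p = -u p) ∧
      ((-4 : ℂ) • CubicKP.dT S v p
          + CubicKP.dX S (CubicKP.dX S (CubicKP.dX S v)) p
          + (6 : ℂ) • CubicKP.dX S (fun p' => v p' ^ 2) p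
          + (3 : ℂ) • CubicKP.dY S (CubicKP.dY S s) p
          + (6 : ℂ) • (v p * CubicKP.dY S s p - CubicKP.dY S s p * v p) = 0 ∧
        CubicKP.dX S s p = v p) := by
  intro Φ₁ q s u v
  refine ⟨fun a b z hz => ?_, fun z hz => ?_⟩
  · obtain ⟨η, hD, hzV, hΦ⟩ := CubicKP.exists_frozenData hU hH hc hinv hz
    have hM := (hD.contDiffOn_momentMatrix 3 0 0 a b).contDiffAt (hD.isOpen_regular.mem_nhds hzV)
    refine (hM.congr_of_eventuallyEq ?_).contDiffWithinAt
    filter_upwards [hD.isOpen_regular.mem_nhds hzV] with w hw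
    exact congrFun (congrFun (hΦ hw) a) b
  · obtain ⟨η, hD, hzV, hΦ⟩ := CubicKP.exists_frozenData hU hH hc hinv hz
    have hV := hD.isOpen_regular
    have hq := hΦ.comp_left (g := CubicKP.qBlock S)
    have hs := hΦ.comp_left (g := CubicKP.sBlock S)
    have hu := hΦ.comp_left (g := fun A => CubicKP.pBlock S A * CubicKP.rBlock S A)
    have hv := hΦ.comp_left (g := fun A => CubicKP.rBlock S A * CubicKP.pBlock S A)
    have hu2 := hΦ.comp_left (g := fun A => (CubicKP.pBlock S A * CubicKP.rBlock S A) ^ 2)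
    have hv2 := hΦ.comp_left (g := fun A => (CubicKP.rBlock S A * CubicKP.pBlock S A) ^ 2)
    -- `Φ₁` and the frozen moment matrix agree on an open set, hence so do all their iterated
    -- derivatives there; each application of `e` transfers one more derivative.
    have e {ι κ : Type} (d : Fin m → CubicKP.Params m) {A B : CubicKP.Params m → Matrix ι κ ℂ}
        (h : Set.EqOn A B _) := CubicKP.sumPartial_congr (e := d) (S := S) hV h
    have hL := (hD.momentHierarchy S).kp_left hV hzV
    have hR := (hD.momentHierarchy S).kp_right hV hzV
    constructor
    · rw [show CubicKP.dT S u z = _ from e _ hu hzV,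
        show CubicKP.dX S (CubicKP.dX S (CubicKP.dX S u)) z = _ from e _ (e _ (e _ hu)) hzV,
        show CubicKP.dX S (fun p' => u p' ^ 2) z = _ from e _ hu2 hzV,
        show CubicKP.dY S (CubicKP.dY S q) z = _ from e _ (e _ hq) hzV,
        show CubicKP.dY S q z = _ from e _ hq hzV,
        show CubicKP.dX S q z = _ from e _ hq hzV, show u z = _ from hu hzV]
      exact hL
    · rw [show CubicKP.dT S v z = _ from e _ hv hzV,
        show CubicKP.dX S (CubicKP.dX S (CubicKP.dX S v)) z = _ from e _ (e _ (e _ hv)) hzV,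
        show CubicKP.dX S (fun p' => v p' ^ 2) z = _ from e _ hv2 hzV,
        show CubicKP.dY S (CubicKP.dY S s) z = _ from e _ (e _ hs) hzV,
        show CubicKP.dY S s z = _ from e _ hs hzV,
        show CubicKP.dX S s z = _ from e _ hs hzV, show v z = _ from hv hzV]
      exact hR
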